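/- Let $n\ge 2$, $\mathbb T=\mathbb R/\mathbb Z$, let $B\subset\mathbb R^n$ be the closed unit ball and let $U\subset\mathbb R^n$ be an open set containing $B$ (for instance $U=\mathbb R^n$). Write $p=(p^s,p^f)$, $\theta=(\theta^s,\theta^f)$ with $p^s=(p_1,\dots,p_{n-1})$, $p^f=p_n$, and similarly for $\theta\in\mathbb T^n$. The norm $\|\cdot\|_{C^r}$ is the supremum of all partial derivatives of order at most $r$; for $H_0$ it is taken on $U$ and for $H_1$ on $\mathbb T^n\times U\times\mathbb T$. For $H_0:U\to\mathbb R$ of class $C^4$ and $K,s>0$ let $\mathcal D(K,s)$ be the set of all $p\in B$ such that $\|\partial_{p^s}H_0(p)\|\le s$ (Euclidean norm) and $|k^f\,\partial_{p^f}H_0(p)+k^t|\ge 3Ks$ for every $(k^f,k^t)\in\mathbb Z^2$ with $0<\max(|k^f|,|k^t|)\le K$. For $H_1:\mathbb T^n\times U\times\mathbb T\to\mathbb R$ let $Z(\theta^s,p)=\iint_{\mathbb T^2}H_1(\theta^s,\theta^f,p,t)\,d\theta^f\,dt$. **Theorem (Normal form).** For every $M\ge 0$ there is a constant $c>0$, depending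 only on $n$, $U$ and $M$, with the following property. Let $H_0:U\to\mathbb R$ be $C^4$ with $\|H_0\|_{C^4}\le M$, let $\delta\in(0,1)$, and put $K_0=c\,\delta^{-2}$, $\beta=c\,\delta^{-1-n}$, $\varepsilon_0=\delta^{6n+5}/c$. Then for every $C^4$ function $H_1:\mathbb T^n\times U\times\mathbb T\to\mathbb R$ with $\|H_1\|_{C^4}\le 1$, every $K\ge K_0$ and every $0<\varepsilon\le\varepsilon_0$ there are an injective $C^2$ map $\Phi:\mathbb T^n\times B\times\mathbb T\to\mathbb T^n\times U\times\mathbb T$ that fixes the last variable $t$, and $C^2$ functions $f,R:\mathbb T^n\times B\times\mathbb T\to\mathbb R$, such that the map $$\tilde\Phi(\theta,p,t,e)=\big(\Phi(\theta,p,t),\,e+f(\theta,p,t)\big)$$ preserves the symplectic form $\sum_i d\theta_i\wedge dp_i+dt\wedge de$, satisfies $\|\tilde\Phi-\mathrm{id}\|_{C^0}\le\sqrt\varepsilon$ and $\|\tilde\Phi-\mathrm{id}\|_{C^2}\le\delta$ (hence the same holds for $\Phi$), and transforms the Hamiltonian $H_\varepsilon=H_0+\varepsilon H_1$ into $$N_\varepsilon(\theta,p,t)=H_0(p)+\varepsilon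 Z(\theta^s,p)+\varepsilon R(\theta,p,t)$$ in the sense that $N_\varepsilon+e=(H_\varepsilon+e)\circ\tilde\Phi$; moreover $$\|R\|_{C^2}\le\delta\quad\text{on }\ \mathbb T^n\times\mathcal D(K,\beta\varepsilon^{1/4})\times\mathbb T .$$ -/

import Mathlib

open Set
open scoped ENNReal NNReal Gradient

namespace NearlyIntegrable

noncomputable section

/-- Action space (and universal cover of the angle torus) with `n = m + 1` degrees of freedom:
the indices `i.castSucc`, `i : Fin m`, are the slow ones, and `Fin.last m` is the fast one. -/
abbrev E (m : ℕ) : Type := EuclideanSpace ℝ (Fin (m + 1))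

/-- The space of triples `(θ, p, t)`. Functions and maps on `𝕋ⁿ × A × 𝕋`, with `𝕋 = ℝ / ℤ`, are
represented by their lifts to `ℝⁿ × A × ℝ`, see `PeriodicOn`. -/
abbrev X (m : ℕ) : Type := E m × E m × ℝ

/-- The set `𝕋ⁿ × A × 𝕋` (lifted). -/
def cyl {m : ℕ} (A : Set (E m)) : Set (X m) := univ ×ˢ A ×ˢ univ

/-- The closed unit ball `B` of `ℝⁿ`. -/
def B (m : ℕ) : Set (E m) := Metric.closedBall 0 1

/-- The deck translation of `ℝⁿ × ℝⁿ × ℝ` over `𝕋ⁿ × ℝⁿ × 𝕋` given by the integers `(k, l)`. -/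
def deck {m : ℕ} (k : Fin (m + 1) → ℤ) (l : ℤ) : X m :=
  (WithLp.toLp 2 (fun i => (k i : ℝ)), 0, (l : ℝ))

/-- `f` is `ℤⁿ`-periodic in `θ` and `1`-periodic in `t` over `A`, that is, it is the lift of
a function on `𝕋ⁿ × A × 𝕋`. -/
def PeriodicOn {m : ℕ} {F : Type*} (f : X m → F) (A : Set (E m)) : Prop :=
  ∀ x ∈ cyl A, ∀ (k : Fin (m + 1) → ℤ) (l : ℤ), f (x + deck k l) = f x

/-- The coordinate directions of the action space. -/
def dirE (m : ℕ) (i : Fin (m + 1)) : E m := EuclideanSpace.single i 1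

/-- The coordinate directions `∂/∂θᵢ`, `∂/∂pᵢ`, `∂/∂t`. -/
def dirX (m : ℕ) : Fin (m + 1) ⊕ Fin (m + 1) ⊕ Unit → X m
  | Sum.inl i => (EuclideanSpace.single i 1, 0, 0)
  | Sum.inr (Sum.inl i) => (0, EuclideanSpace.single i 1, 0)
  | Sum.inr (Sum.inr _) => (0, 0, 1)

/-- The `C^r` norm on `S` of a function `f` of class `C^r` on `D ⊇ S`: the supremum over the points
of `S` of all partial derivatives of order at most `r`, with respect to the coordinate
directions `b`. (At boundary points of `D` derivatives are taken within `D`.) -/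
def cNorm {V F ι : Type*} [NormedAddCommGroup V] [NormedSpace ℝ V] [NormedAddCommGroup F]
    [NormedSpace ℝ F] (b : ι → V) (r : ℕ) (D S : Set V) (f : V → F) : ℝ≥0∞ :=
  ⨆ (k : ℕ) (_ : k ≤ r) (x : V) (_ : x ∈ S) (j : Fin k → ι),
    ‖iteratedFDerivWithin ℝ k f D x (fun i => b (j i))‖ₑ

/-- The slow part `v^s = (v₁, …, v_{n-1})` of a vector of `ℝⁿ`. -/
def slow {m : ℕ} (v : E m) : EuclideanSpace ℝ (Fin m) :=
  WithLp.toLp 2 (fun i => v i.castSucc)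

/-- The vector of `ℝⁿ` with slow part `v` and fast coordinate `a`. -/
def join {m : ℕ} (v : EuclideanSpace ℝ (Fin m)) (a : ℝ) : E m :=
  WithLp.toLp 2 (Fin.snoc (α := fun _ => ℝ) (fun i => v i) a)

/-- The average `Z(θ^s, p) = ∬ H₁(θ^s, θ^f, p, t) dθ^f dt` over `𝕋 × 𝕋`. -/
def average {m : ℕ} (H₁ : X m → ℝ) (θs : EuclideanSpace ℝ (Fin m)) (p : E m) : ℝ :=
  ∫ a in (0 : ℝ)..1, ∫ t in (0 : ℝ)..1, H₁ (join θs a, p, t)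

/-- The set `𝒟(K, s)` of the momenta `p ∈ B` near the resonance `∂_{p^s} H₀ = 0` and away from
additional resonances of order at most `K`. -/
def nonresonant {m : ℕ} (H₀ : E m → ℝ) (K s : ℝ) : Set (E m) :=
  {p | p ∈ B m ∧ ‖slow (∇ H₀ p)‖ ≤ s ∧
    ∀ kf kt : ℤ, 0 < max |kf| |kt| → ((max |kf| |kt| : ℤ) : ℝ) ≤ K →
      3 * K * s ≤ |(kf : ℝ) * (∇ H₀ p) (Fin.last m) + (kt : ℝ)|}

/-- The standard symplectic form `∑ dθᵢ ∧ dpᵢ + dt ∧ de` on the extended phase space of points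
`((θ, p, t), e)`. -/
def symplForm {m : ℕ} (v w : X m × ℝ) : ℝ :=
  (inner ℝ v.1.1 w.1.2.1 - inner ℝ v.1.2.1 w.1.1) + (v.1.2.2 * w.2 - v.2 * w.1.2.2)

/-- The map `((θ, p, t), e) ↦ (Φ(θ, p, t), e + f(θ, p, t))`. -/
def extendMap {m : ℕ} (Φ : X m → X m) (f : X m → ℝ) (z : X m × ℝ) : X m × ℝ :=
  (Φ z.1, z.2 + f z.1)

/-- The map `Ψ` preserves the symplectic form on `S`. -/
def IsSymplecticOn {m : ℕ} (Ψ : X m × ℝ → X m × ℝ) (S : Set (X m × ℝ)) : Prop :=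
  ∀ z ∈ S, ∀ v w : X m × ℝ,
    symplForm (fderivWithin ℝ Ψ S z v) (fderivWithin ℝ Ψ S z w) = symplForm v w

/-- `(Φ, f)` is a `C²` symplectic change of coordinates from `𝕋ⁿ × A × 𝕋` to `𝕋ⁿ × U × 𝕋`
for time-periodic Hamiltonians: `Φ` (the lift of a map of `𝕋ⁿ × A × 𝕋`) is injective and fixes
the time `t`, and `(θ, p, t, e) ↦ (Φ(θ, p, t), e + f(θ, p, t))` is symplectic. -/
structure IsCoordChange {m : ℕ} (Φ : X m → X m) (f : X m → ℝ) (A U : Set (E m)) : Prop where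
  contDiffOn : ContDiffOn ℝ 2 Φ (cyl A)
  contDiffOn_energy : ContDiffOn ℝ 2 f (cyl A)
  mapsTo : MapsTo Φ (cyl A) (cyl U)
  injOn : InjOn Φ (cyl A)
  periodic : PeriodicOn (fun x => Φ x - x) A
  periodic_energy : PeriodicOn f A
  time : ∀ x ∈ cyl A, (Φ x).2.2 = x.2.2
  symplectic : IsSymplecticOn (extendMap Φ f) (cyl A ×ˢ univ)

/-- In the coordinates `(Φ, f)` the time-periodic Hamiltonian `H` takes the form `N` over `A`:
`N + e = (H + e) ∘ Φ̃`, where `Φ̃(θ, p, t, e) = (Φ(θ, p, t), e + f(θ, p, t))`. -/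
def TakesForm {m : ℕ} (H : X m → ℝ) (Φ : X m → X m) (f : X m → ℝ) (A : Set (E m))
    (N : X m → ℝ) : Prop :=
  ∀ x ∈ cyl A, ∀ e : ℝ, N x + e = H (extendMap Φ f (x, e)).1 + (extendMap Φ f (x, e)).2

end

end NearlyIntegrable

/-! The proof is a single averaging step at finite regularity. Put W = H₁ − Z. Convolution with
Fejér kernels of order L in all n angles and in time replaces W by a trigonometric polynomial S in
(θ, t), with coefficients depending on p. As W is C⁴, the error is O(L^(-1/2)) in C³
(`exists_fourier_decomposition`), so that L of order δ⁻² makes it a small multiple of δ.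

The homological equation ∇H₀·∂_θ G + ∂_t G = −S is solved harmonic by harmonic, dividing by 2π(k·∇H₀
+ k_t). Harmonics with k^f = k^t = 0 vanish because W has zero average over the fast angle and time.
For the others, near 𝒟, the divisor is at least s = K₀βε^(1/4): the fast part is at least
3Kβε^(1/4), and the slow part takes away at most Kβε^(1/4) (`eventually_le_abs_divisor`). Where
divisors are small, 1/z is replaced by a bounded smooth function; hence G is defined and controlled
everywhere, but solves the equation only near 𝒟 (`exists_homological_solution`). Its size is A ~
L^(n+1)/s, each p-derivative costs a factor Λ ~ L/s, and the first θ-derivative costs nothing.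

The generating function θ·P + εG(θ, P, t) defines Φ̃, which is symplectic by symmetry of the Hessian
(`isCoordChange_generating`). The new remainder consists of W − S, of increments of H₁ and Z of C²
size εAΛ³, and of the second-order Taylor remainder of H₀ divided by ε, of size (εAΛ)²/ε
(`exists_coordChange_of_homological`). Both of the last sizes are a power of L times ε/s⁴, and ε/s⁴
= δ^(4n+12)/c⁸. This is what dictates the exponent 1/4 and the power of δ in β (`scale_relation`,
`small_quantities`).

The bound s ≤ 1 is automatic when 𝒟 is nonempty; when 𝒟 is empty the identity map suffices. A cutoff
in p reduces everything to Hamiltonians defined for all momenta (`exists_globalization`). -/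

namespace NearlyIntegrable

noncomputable section

open MeasureTheory Filter Topology

universe u

/-! ### Calculus of derivative bounds of the form A Λ^j. -/

section DerivBound

variable {V F G K : Type*} [NormedAddCommGroup V] [NormedSpace ℝ V]
  [NormedAddCommGroup F] [NormedSpace ℝ F] [NormedAddCommGroup G] [NormedSpace ℝ G]
  [NormedAddCommGroup K] [NormedSpace ℝ K]

/-- `f` is of class `C^r` and its derivatives of order `j ≤ r` are bounded by `A * Λ ^ j`. -/
def DerivBound (r : ℕ) (f : V → F) (A Λ : ℝ) : Prop :=
  ContDiff ℝ r f ∧ ∀ j ≤ r, ∀ x, ‖iteratedFDeriv ℝ j f x‖ ≤ A * Λ ^ j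

namespace DerivBound

variable {r : ℕ} {f g : V → F} {A A' Λ Λ' : ℝ}

theorem norm_le (h : DerivBound r f A Λ) (x : V) : ‖f x‖ ≤ A := by
  simpa using h.2 0 (Nat.zero_le _) x

theorem nonneg (h : DerivBound r f A Λ) : 0 ≤ A := (norm_nonneg _).trans (h.norm_le 0)

theorem norm_fderiv_le (h : DerivBound (r + 1) f A Λ) (x : V) : ‖fderiv ℝ f x‖ ≤ A * Λ := by
  simpa [norm_iteratedFDeriv_one] using h.2 1 (by omega) x

theorem mono (h : DerivBound r f A Λ) (hA : A ≤ A') (h0 : 0 ≤ Λ) (hΛ : Λ ≤ Λ') :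
    DerivBound r f A' Λ' :=
  ⟨h.1, fun j hj x => (h.2 j hj x).trans (mul_le_mul hA (pow_le_pow_left₀ h0 hΛ j)
    (pow_nonneg h0 j) (h.nonneg.trans hA))⟩

theorem mono_const (h : DerivBound r f A Λ) (hA : A ≤ A') (h0 : 0 ≤ Λ) : DerivBound r f A' Λ :=
  h.mono hA h0 le_rfl

theorem mono_order {r' : ℕ} (h : DerivBound r f A Λ) (hr : r' ≤ r) : DerivBound r' f A Λ :=
  ⟨h.1.of_le (by exact_mod_cast hr), fun j hj x => h.2 j (hj.trans hr) x⟩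

theorem of_le_one (h : DerivBound r f A Λ) (h1 : 1 ≤ Λ) : DerivBound r f (A * Λ ^ r) 1 :=
  ⟨h.1, fun j hj x => (h.2 j hj x).trans (by
    rw [one_pow, mul_one]
    exact mul_le_mul_of_nonneg_left (pow_le_pow_right₀ h1 hj) h.nonneg)⟩

theorem of_two_mul (h : DerivBound r f A (2 * Λ)) (h0 : 0 ≤ Λ) : DerivBound r f (2 ^ r * A) Λ :=
  ⟨h.1, fun j hj x => (h.2 j hj x).trans (by
    rw [mul_pow, mul_comm (2 ^ r) A, mul_assoc]
    refine mul_le_mul_of_nonneg_left (mul_le_mul_of_nonneg_right ?_ (pow_nonneg h0 j)) h.nonneg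
    exact pow_le_pow_right₀ one_le_two hj)⟩

theorem zero (hA : 0 ≤ A) (h0 : 0 ≤ Λ) : DerivBound r (fun _ : V => (0 : F)) A Λ :=
  ⟨contDiff_const, fun j _ x => by
    have : iteratedFDeriv ℝ j (fun _ : V => (0 : F)) x = 0 := by
      simp
    rw [this, norm_zero]; positivity⟩

theorem add (hf : DerivBound r f A Λ) (hg : DerivBound r g A' Λ) :
    DerivBound r (fun x => f x + g x) (A + A') Λ :=
  ⟨hf.1.add hg.1, fun j hj x => by
    have hj' : (j : WithTop ℕ∞) ≤ r := by exact_mod_cast hj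
    rw [fun_iteratedFDeriv_add_apply (hf.1.of_le hj').contDiffAt (hg.1.of_le hj').contDiffAt,
      add_mul]
    exact (norm_add_le _ _).trans (add_le_add (hf.2 j hj x) (hg.2 j hj x))⟩

theorem clm (hf : DerivBound r f A Λ) (L : F →L[ℝ] G) :
    DerivBound r (fun x => L (f x)) (‖L‖ * A) Λ :=
  ⟨L.contDiff.comp hf.1, fun j hj x => by
    have hj' : (j : WithTop ℕ∞) ≤ r := by exact_mod_cast hj
    rw [mul_assoc]
    exact (L.norm_iteratedFDeriv_comp_left hf.1.contDiffAt hj').trans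
      (mul_le_mul_of_nonneg_left (hf.2 j hj x) (norm_nonneg _))⟩

theorem clm_of_le_one (hf : DerivBound r f A Λ) (h0 : 0 ≤ Λ) {L : F →L[ℝ] G} (hL : ‖L‖ ≤ 1) :
    DerivBound r (fun x => L (f x)) A Λ :=
  (hf.clm L).mono_const (mul_le_of_le_one_left hf.nonneg hL) h0

theorem const_smul (hf : DerivBound r f A Λ) (c : ℝ) :
    DerivBound r (fun x => c • f x) (|c| * A) Λ :=
  ⟨contDiff_const.smul hf.1, fun j hj x => by
    have hj' : (j : WithTop ℕ∞) ≤ r := by exact_mod_cast hj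
    have := iteratedFDeriv_const_smul_apply' (a := c) (hf.1.of_le hj').contDiffAt (x := x)
    rw [this, norm_smul, mul_assoc]
    exact mul_le_mul_of_nonneg_left (hf.2 j hj x) (norm_nonneg _)⟩

theorem neg (hf : DerivBound r f A Λ) : DerivBound r (fun x => - f x) A Λ := by
  simpa using hf.const_smul (-1)

theorem sub (hf : DerivBound r f A Λ) (hg : DerivBound r g A' Λ) :
    DerivBound r (fun x => f x - g x) (A + A') Λ := by
  simpa [sub_eq_add_neg] using hf.add hg.neg

theorem sum {ι : Type*} (s : Finset ι) {f : ι → V → F} {A : ι → ℝ} (h0 : 0 ≤ Λ)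
    (h : ∀ i ∈ s, DerivBound r (f i) (A i) Λ) :
    DerivBound r (fun x => ∑ i ∈ s, f i x) (∑ i ∈ s, A i) Λ := by
  classical
  induction s using Finset.induction_on with
  | empty => simpa using zero (le_refl 0) h0
  | insert a s ha ih =>
    simp only [Finset.sum_insert ha]
    exact (h a (by simp)).add (ih fun i hi => h i (by simp [hi]))

/-- Leibniz rule: with a common Λ every term of order j carries the same power Λ^j, and the binomial
coefficients add up to 2^j ≤ 2^r. -/
theorem bilin {f : V → F} {g : V → G} (hf : DerivBound r f A Λ) (hg : DerivBound r g A' Λ)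
    (h0 : 0 ≤ Λ) (B : F →L[ℝ] G →L[ℝ] K) (hB : ‖B‖ ≤ 1) :
    DerivBound r (fun x => B (f x) (g x)) (2 ^ r * (A * A')) Λ :=
  ⟨(B.contDiff.comp hf.1).clm_apply hg.1, fun j hj x => by
    have hj' : (j : WithTop ℕ∞) ≤ r := by exact_mod_cast hj
    refine (B.norm_iteratedFDeriv_le_of_bilinear_of_le_one hf.1 hg.1 x hj' hB).trans ?_
    have key : ∀ i ∈ Finset.range (j + 1), (j.choose i : ℝ) * ‖iteratedFDeriv ℝ i f x‖ *
        ‖iteratedFDeriv ℝ (j - i) g x‖ ≤ (j.choose i : ℝ) * (A * A' * Λ ^ j) := by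
      intro i hi
      have hij : i ≤ j := by simpa [Nat.lt_succ_iff] using hi
      rw [mul_assoc]
      refine mul_le_mul_of_nonneg_left ?_ (Nat.cast_nonneg _)
      refine (mul_le_mul (hf.2 i (hij.trans hj) x) (hg.2 (j - i) (by omega) x) (norm_nonneg _)
        (mul_nonneg hf.nonneg (pow_nonneg h0 i))).trans (le_of_eq ?_)
      rw [show Λ ^ j = Λ ^ i * Λ ^ (j - i) by rw [← pow_add]; congr 1; omega]
      ring
    refine (Finset.sum_le_sum key).trans ?_
    rw [← Finset.sum_mul]
    have h2 : (∑ i ∈ Finset.range (j + 1), (j.choose i : ℝ)) = 2 ^ j := by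
      exact_mod_cast Nat.sum_range_choose j
    rw [h2, ← mul_assoc]
    refine mul_le_mul_of_nonneg_right (mul_le_mul_of_nonneg_right ?_
      (mul_nonneg hf.nonneg hg.nonneg)) (pow_nonneg h0 j)
    exact pow_le_pow_right₀ one_le_two hj⟩

theorem fderiv (hf : DerivBound (r + 1) f A Λ) : DerivBound r (fderiv ℝ f) (A * Λ) Λ :=
  ⟨hf.1.fderiv_right (by norm_cast), fun j hj x => by
    rw [norm_iteratedFDeriv_fderiv]
    exact (hf.2 (j + 1) (by omega) x).trans (le_of_eq (by ring))⟩

theorem of_fderiv (hd : Differentiable ℝ f) (h : ∀ x, ‖f x‖ ≤ A)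
    (hf : DerivBound r (_root_.fderiv ℝ f) (A * Λ) Λ) : DerivBound (r + 1) f A Λ := by
  refine ⟨?_, fun j hj x => ?_⟩
  · have : ContDiff ℝ ((r : WithTop ℕ∞) + 1) f := contDiff_succ_iff_fderiv.2 ⟨hd, by simp, hf.1⟩
    exact_mod_cast this
  · cases j with
    | zero => simpa using h x
    | succ j =>
      rw [← norm_iteratedFDeriv_fderiv]
      exact (hf.2 j (by omega) x).trans (le_of_eq (by ring))

theorem of_norm_le (hc : Continuous f) (h : ∀ x, ‖f x‖ ≤ A) : DerivBound 0 f A Λ :=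
  ⟨contDiff_zero.2 hc, fun j hj x => by
    obtain rfl : j = 0 := by omega
    simpa using h x⟩

/-- Only derivatives of order at least 1 of the inner map enter Faà di Bruno's formula, so the inner
map may be unbounded, such as a perturbation of the identity. -/
theorem comp {φ : F → G} {f : V → F} (hφ : DerivBound r φ A 1) (hf : ContDiff ℝ r f)
    (hfb : ∀ j, 1 ≤ j → j ≤ r → ∀ x, ‖iteratedFDeriv ℝ j f x‖ ≤ Λ ^ j) (h0 : 0 ≤ Λ) :
    DerivBound r (fun x => φ (f x)) (r.factorial * A) Λ :=
  ⟨hφ.1.comp hf, fun j hj x => by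
    have hj' : (j : WithTop ℕ∞) ≤ r := by exact_mod_cast hj
    refine (norm_iteratedFDeriv_comp_le hφ.1 hf hj' x (C := A) (D := Λ) (fun i hi => ?_)
      fun i h1 h2 => hfb i h1 (h2.trans hj) x).trans ?_
    · simpa using hφ.2 i (hi.trans hj) (f x)
    · refine mul_le_mul_of_nonneg_right (mul_le_mul_of_nonneg_right ?_ hφ.nonneg)
        (pow_nonneg h0 j)
      exact_mod_cast Nat.factorial_le hj⟩

theorem comp_id_add {φ : V → G} {ξ : V → V} {σ : ℝ} (hφ : DerivBound r φ A 1)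
    (hξ : DerivBound r ξ σ Λ) (hσ : σ ≤ 1) (h1 : 1 ≤ Λ) :
    DerivBound r (fun x => φ (x + ξ x)) (2 ^ r * (r.factorial * A)) Λ := by
  have h0 : 0 ≤ Λ := zero_le_one.trans h1
  refine (hφ.comp (f := fun x => x + ξ x) (contDiff_id.add hξ.1) (fun j hj hjr x => ?_)
    (by positivity : 0 ≤ 2 * Λ)).of_two_mul h0
  have hj' : (j : WithTop ℕ∞) ≤ r := by exact_mod_cast hjr
  have hadd : iteratedFDeriv ℝ j (fun x => x + ξ x) x =
      iteratedFDeriv ℝ j (fun x : V => x) x + iteratedFDeriv ℝ j ξ x :=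
    fun_iteratedFDeriv_add_apply contDiffAt_id (hξ.1.of_le hj').contDiffAt
  have hid : ‖iteratedFDeriv ℝ j (fun x : V => x) x‖ ≤ 1 := by
    obtain ⟨k, rfl⟩ : ∃ k, j = k + 1 := ⟨j - 1, by omega⟩
    rw [← norm_iteratedFDeriv_fderiv]
    rw [show _root_.fderiv ℝ (fun x : V => x) = fun _ => ContinuousLinearMap.id ℝ V from
      funext fun _ => fderiv_fun_id]
    cases k with
    | zero => simpa using ContinuousLinearMap.norm_id_le
    | succ k => simp [iteratedFDeriv_succ_const]
  rw [hadd]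
  refine (norm_add_le _ _).trans ((add_le_add hid (hξ.2 j hjr x)).trans ?_)
  have hΛ : 1 ≤ Λ ^ j := one_le_pow₀ h1
  have h2 : (2 : ℝ) ≤ 2 ^ j := by simpa using pow_le_pow_right₀ (one_le_two (α := ℝ)) hj
  rw [mul_pow]
  nlinarith [mul_le_mul_of_nonneg_right hσ (pow_nonneg h0 j)]

end DerivBound

end DerivBound

/-! ### Increments and Taylor remainders along a variable displacement. -/

section Increments

variable {V : Type u} [NormedAddCommGroup V] [NormedSpace ℝ V]

theorem hasFDerivAt_comp_id_add {F : Type*} [NormedAddCommGroup F] [NormedSpace ℝ F]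
    {f : V → F} {ξ : V → V} {x : V} (hf : Differentiable ℝ f) (hξ : DifferentiableAt ℝ ξ x) :
    HasFDerivAt (fun x => f (x + ξ x))
      ((fderiv ℝ f (x + ξ x)).comp (ContinuousLinearMap.id ℝ V + fderiv ℝ ξ x)) x :=
  (hf (x + ξ x)).hasFDerivAt.comp x ((hasFDerivAt_id x).add hξ.hasFDerivAt)

theorem norm_increment_le {F : Type*} [NormedAddCommGroup F] [NormedSpace ℝ F] {f : V → F} {B : ℝ}
    (hf : Differentiable ℝ f) (hB : ∀ x, ‖fderiv ℝ f x‖ ≤ B) (x v : V) :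
    ‖f (x + v) - f x‖ ≤ B * ‖v‖ := by
  simpa using convex_univ.norm_image_sub_le_of_norm_fderiv_le (𝕜 := ℝ) (fun y _ => hf y)
    (fun y _ => hB y) (mem_univ x) (mem_univ (x + v))

theorem norm_increment_sub_fderiv_le {F : Type*} [NormedAddCommGroup F] [NormedSpace ℝ F]
    {f : V → F} {B : ℝ} (hf : ContDiff ℝ 2 f) (hB : ∀ x, ‖fderiv ℝ (fderiv ℝ f) x‖ ≤ B)
    (x v : V) : ‖f (x + v) - f x - fderiv ℝ f x v‖ ≤ B * ‖v‖ ^ 2 := by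
  have hf1 : Differentiable ℝ f := hf.differentiable (by norm_num)
  have hf2 : Differentiable ℝ (fderiv ℝ f) :=
    (hf.fderiv_right (m := 1) (by norm_num)).differentiable (by norm_num)
  have hB0 : 0 ≤ B := (norm_nonneg (fderiv ℝ (fderiv ℝ f) x)).trans (hB x)
  have := (convex_segment x (x + v)).norm_image_sub_le_of_norm_fderiv_le' (𝕜 := ℝ)
    (f := f) (φ := fderiv ℝ f x) (C := B * ‖v‖) (fun y _ => hf1 y)
    (fun y hy => ?_) (left_mem_segment ℝ _ _) (right_mem_segment ℝ _ _)
  · simpa [pow_two, mul_assoc] using this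
  · have h1 := norm_increment_le hf2 hB x (y - x)
    rw [add_sub_cancel] at h1
    refine h1.trans (mul_le_mul_of_nonneg_left ?_ hB0)
    obtain ⟨t, ht, rfl⟩ := (segment_eq_image' ℝ x (x + v)) ▸ hy
    simp only [add_sub_cancel_left, norm_smul, Real.norm_eq_abs, abs_of_nonneg ht.1]
    exact mul_le_of_le_one_left (norm_nonneg _) ht.2

/-- Induction on the order: the derivative of f(x + ξ) − f(x) is the same increment for Df plus Df(x
+ ξ) ∘ Dξ. The target space is quantified after C, in the universe of V, so that the induction
hypothesis applies to Df with values in V →L F. -/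
theorem exists_derivBound_increment (r : ℕ) : ∃ C : ℝ, 0 ≤ C ∧
    ∀ {F : Type u} [NormedAddCommGroup F] [NormedSpace ℝ F] {f : V → F} {ξ : V → V} {B σ Λ : ℝ},
      DerivBound (r + 1) f B 1 → DerivBound r ξ σ Λ → σ ≤ 1 → 1 ≤ Λ →
      DerivBound r (fun x => f (x + ξ x) - f x) (C * (B * σ)) Λ := by
  induction r with
  | zero =>
    refine ⟨1, zero_le_one, fun {F} _ _ {f ξ B σ Λ} hf hξ hσ hΛ => ?_⟩
    have hfd : Differentiable ℝ f := hf.1.differentiable (by simp)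
    refine .of_norm_le ?_ fun x => ?_
    · have := hξ.1.continuous
      have := hf.1.continuous
      fun_prop
    · rw [one_mul]
      refine (norm_increment_le hfd (fun y => by simpa using hf.norm_fderiv_le y) x (ξ x)).trans ?_
      exact mul_le_mul_of_nonneg_left (hξ.norm_le x) hf.nonneg
  | succ r ih =>
    obtain ⟨C, hC, ih⟩ := ih
    refine ⟨1 + C + 2 ^ r * (2 ^ r * r.factorial), by positivity,
      fun {F} _ _ {f ξ B σ Λ} hf hξ hσ hΛ => ?_⟩
    have h0 : 0 ≤ Λ := zero_le_one.trans hΛ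
    have hfd : Differentiable ℝ f := hf.1.differentiable (by simp)
    have hξd : Differentiable ℝ ξ := hξ.1.differentiable (by simp)
    have hD : ∀ x, HasFDerivAt (fun x => f (x + ξ x) - f x)
        ((fderiv ℝ f (x + ξ x) - fderiv ℝ f x) +
          ContinuousLinearMap.compL ℝ V V F (fderiv ℝ f (x + ξ x)) (fderiv ℝ ξ x)) x := by
      intro x
      refine ((hasFDerivAt_comp_id_add hfd (hξd x)).sub (hfd x).hasFDerivAt).congr_fderiv ?_
      ext v
      simp
      abel
    have hf1 : DerivBound (r + 1) (fderiv ℝ f) B 1 := by simpa using hf.fderiv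
    have hB := hf.nonneg
    have hσ0 := hξ.nonneg
    have h1 := ih hf1 (hξ.mono_order (Nat.le_succ r)) hσ hΛ
    have h2 := ((hf1.mono_order (Nat.le_succ r)).comp_id_add (hξ.mono_order (Nat.le_succ r))
      hσ hΛ).bilin hξ.fderiv h0 (ContinuousLinearMap.compL ℝ V V F)
      (ContinuousLinearMap.norm_compL_le ℝ V V F)
    refine .of_fderiv (fun x => (hD x).differentiableAt) (fun x => ?_) ?_
    · refine (norm_increment_le hfd (fun y => by simpa using hf.norm_fderiv_le y) x (ξ x)).trans ?_
      refine (mul_le_mul_of_nonneg_left (hξ.norm_le x) hf.nonneg).trans ?_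
      refine le_mul_of_one_le_left (by positivity) ?_
      have : 0 ≤ C + 2 ^ r * (2 ^ r * (r.factorial : ℝ)) := by positivity
      linarith
    · rw [show fderiv ℝ (fun x => f (x + ξ x) - f x) = _ from funext fun x => (hD x).fderiv]
      refine (h1.add h2).mono_const ?_ h0
      have e1 : C * (B * σ) ≤ C * (B * σ) * Λ := le_mul_of_one_le_right (by positivity) hΛ
      have e2 : 0 ≤ B * σ * Λ := by positivity
      nlinarith

/-- The derivative of the remainder is the remainder for Df plus (Df(x + ξ) − Df(x)) ∘ Dξ, where the
symmetry of D²f is used; both terms are quadratic in the displacement. -/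
theorem exists_derivBound_increment_sub_fderiv (r : ℕ) : ∃ C : ℝ, 0 ≤ C ∧
    ∀ {F : Type u} [NormedAddCommGroup F] [NormedSpace ℝ F] {f : V → F} {ξ : V → V} {B σ Λ : ℝ},
      DerivBound (r + 2) f B 1 → DerivBound r ξ σ Λ → σ ≤ 1 → 1 ≤ Λ →
      DerivBound r (fun x => f (x + ξ x) - f x - fderiv ℝ f x (ξ x)) (C * (B * σ ^ 2)) Λ := by
  have bound0 : ∀ {r : ℕ} {F : Type u} [NormedAddCommGroup F] [NormedSpace ℝ F] {f : V → F}
      {ξ : V → V} {B σ Λ : ℝ}, DerivBound (r + 2) f B 1 → DerivBound r ξ σ Λ →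
      ∀ x, ‖f (x + ξ x) - f x - fderiv ℝ f x (ξ x)‖ ≤ B * σ ^ 2 := by
    intro r F _ _ f ξ B σ Λ hf hξ x
    refine (norm_increment_sub_fderiv_le (hf.1.of_le (by norm_cast; omega)) (B := B)
      (fun y => by simpa using hf.fderiv.norm_fderiv_le y) x (ξ x)).trans ?_
    exact mul_le_mul_of_nonneg_left (pow_le_pow_left₀ (norm_nonneg _) (hξ.norm_le x) 2) hf.nonneg
  induction r with
  | zero =>
    refine ⟨1, zero_le_one, fun {F} _ _ {f ξ B σ Λ} hf hξ hσ hΛ => ?_⟩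
    refine .of_norm_le ?_ fun x => ?_
    · have := hξ.1.continuous
      have := hf.1.continuous
      have := hf.fderiv.1.continuous
      fun_prop
    · rw [one_mul]
      exact bound0 hf hξ x
  | succ r ih =>
    obtain ⟨C, hC, ih⟩ := ih
    obtain ⟨C', hC', hinc⟩ := exists_derivBound_increment (V := V) r
    refine ⟨1 + C + 2 ^ r * C', by positivity, fun {F} _ _ {f ξ B σ Λ} hf hξ hσ hΛ => ?_⟩
    have h0 : 0 ≤ Λ := zero_le_one.trans hΛ
    have hf1 : DerivBound (r + 2) (fderiv ℝ f) B 1 := by simpa using hf.fderiv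
    have hfd : Differentiable ℝ f := hf.1.differentiable (by simp)
    have hfd1 : Differentiable ℝ (fderiv ℝ f) := hf1.1.differentiable (by simp)
    have hξd : Differentiable ℝ ξ := hξ.1.differentiable (by simp)
    have hD : ∀ x, HasFDerivAt (fun x => f (x + ξ x) - f x - fderiv ℝ f x (ξ x))
        ((fderiv ℝ f (x + ξ x) - fderiv ℝ f x - fderiv ℝ (fderiv ℝ f) x (ξ x)) +
          ContinuousLinearMap.compL ℝ V V F (fderiv ℝ f (x + ξ x) - fderiv ℝ f x)
            (fderiv ℝ ξ x)) x := by
      intro x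
      refine (((hasFDerivAt_comp_id_add hfd (hξd x)).sub (hfd x).hasFDerivAt).sub
        ((hfd1 x).hasFDerivAt.clm_apply (hξd x).hasFDerivAt)).congr_fderiv ?_
      ext v
      have hsymm : fderiv ℝ (fderiv ℝ f) x v (ξ x) = fderiv ℝ (fderiv ℝ f) x (ξ x) v :=
        (hf.1.contDiffAt.isSymmSndFDerivAt (by simp)).eq v (ξ x)
      simp [hsymm]
      abel
    have hB := hf.nonneg
    have hσ0 := hξ.nonneg
    have h1 := ih hf1 (hξ.mono_order (Nat.le_succ r)) hσ hΛ
    have h2 := (hinc (hf1.mono_order (Nat.le_succ _)) (hξ.mono_order (Nat.le_succ r))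
      hσ hΛ).bilin hξ.fderiv h0 (ContinuousLinearMap.compL ℝ V V F)
      (ContinuousLinearMap.norm_compL_le ℝ V V F)
    refine .of_fderiv (fun x => (hD x).differentiableAt) (fun x => ?_) ?_
    · refine (bound0 hf hξ x).trans (le_mul_of_one_le_left (by positivity) ?_)
      have : 0 ≤ C + 2 ^ r * C' := by positivity
      linarith
    · rw [show fderiv ℝ (fun x => f (x + ξ x) - f x - fderiv ℝ f x (ξ x)) = _ from
        funext fun x => (hD x).fderiv]
      refine (h1.add h2).mono_const ?_ h0
      have e1 : C * (B * σ ^ 2) ≤ C * (B * σ ^ 2) * Λ := le_mul_of_one_le_right (by positivity) hΛ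
      have e2 : 0 ≤ B * σ ^ 2 * Λ := by positivity
      nlinarith

end Increments

/-! ### Differentiation under the integral sign to finite order. -/

section ParametricIntegral

variable {V F : Type*} [NormedAddCommGroup V] [NormedSpace ℝ V]
  [NormedAddCommGroup F] [NormedSpace ℝ F]

theorem hasFDerivAt_intervalIntegral_of_bound {f : ℝ → V → F} {f' : ℝ → V → V →L[ℝ] F}
    {b : ℝ → ℝ} (hc : ∀ x, Continuous fun y => f y x) (hc' : ∀ x, Continuous fun y => f' y x)
    (hd : ∀ y x, HasFDerivAt (f y) (f' y x) x) (hb : Continuous b)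
    (hfb : ∀ y ∈ Icc (0 : ℝ) 1, ∀ x, ‖f' y x‖ ≤ b y) (x : V) :
    HasFDerivAt (fun x => ∫ y in (0 : ℝ)..1, f y x) (∫ y in (0 : ℝ)..1, f' y x) x := by
  refine _root_.hasFDerivAt_integral_of_dominated_of_fderiv_le'' (μ := volume)
    (F := fun x y => f y x) (F' := fun x y => f' y x) (bound := b) (s := univ) univ_mem
    (Eventually.of_forall fun x => (hc x).aestronglyMeasurable)
    ((hc x).intervalIntegrable 0 1) (hc' x).aestronglyMeasurable ?_
    (hb.intervalIntegrable 0 1) (Eventually.of_forall fun y x _ => hd y x)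
  rw [ae_restrict_iff' measurableSet_uIoc]
  refine Eventually.of_forall fun y hy x _ => hfb y ?_ x
  rw [uIoc_of_le zero_le_one] at hy
  exact ⟨hy.1.le, hy.2⟩

theorem continuous_intervalIntegral_of_bound {V : Type*} [NormedAddCommGroup V] {f : ℝ → V → F} {b : ℝ → ℝ}
    (hc : ∀ x, Continuous fun y => f y x) (hd : ∀ y, Continuous (f y)) (hb : Continuous b)
    (hfb : ∀ y ∈ Icc (0 : ℝ) 1, ∀ x, ‖f y x‖ ≤ b y) :
    Continuous fun x => ∫ y in (0 : ℝ)..1, f y x := by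
  refine intervalIntegral.continuous_of_dominated_interval (bound := b)
    (fun x => (hc x).aestronglyMeasurable) (fun x => ?_) (hb.intervalIntegrable 0 1)
    (Eventually.of_forall fun y _ => hd y)
  refine Eventually.of_forall fun y hy => ?_
  rw [uIoc_of_le zero_le_one] at hy
  exact hfb y ⟨hy.1.le, hy.2⟩ x

variable [CompleteSpace F]

theorem hasFDerivAt_intervalIntegral_curryLeft {j : ℕ} {f : ℝ → V → V [×j]→L[ℝ] F}
    {f' : ℝ → V → V [×j.succ]→L[ℝ] F} {b : ℝ → ℝ} (hc : ∀ x, Continuous fun y => f y x)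
    (hc' : ∀ x, Continuous fun y => f' y x) (hd : ∀ y x, HasFDerivAt (f y) (f' y x).curryLeft x)
    (hb : Continuous b) (hfb : ∀ y ∈ Icc (0 : ℝ) 1, ∀ x, ‖f' y x‖ ≤ b y) (x : V) :
    HasFDerivAt (fun x => ∫ y in (0 : ℝ)..1, f y x) (∫ y in (0 : ℝ)..1, f' y x).curryLeft x := by
  have h1 : ∀ x, Continuous fun y => (f' y x).curryLeft := fun x =>
    (continuousMultilinearCurryLeftEquiv ℝ (fun _ : Fin j.succ => V) F).continuous.comp (hc' x)
  have h2 : ∀ y ∈ Icc (0 : ℝ) 1, ∀ x, ‖(f' y x).curryLeft‖ ≤ b y := fun y hy x =>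
    (ContinuousMultilinearMap.curryLeft_norm (f' y x)).le.trans (hfb y hy x)
  have h3 := hasFDerivAt_intervalIntegral_of_bound hc h1 hd hb h2 x
  have h4 : ∫ y in (0 : ℝ)..1, (f' y x).curryLeft = (∫ y in (0 : ℝ)..1, f' y x).curryLeft := by
    let e : (V [×j.succ]→L[ℝ] F) →L[ℝ] (V →L[ℝ] V [×j]→L[ℝ] F) :=
      { toFun := fun q : V [×j.succ]→L[ℝ] F => ContinuousMultilinearMap.curryLeft q
        map_add' := fun _ _ => rfl
        map_smul' := fun _ _ => rfl
        cont := (continuousMultilinearCurryLeftEquiv ℝ (fun _ : Fin j.succ => V) F).continuous }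
    exact ContinuousLinearMap.intervalIntegral_comp_comm (𝕜 := ℝ) (E := V [×j.succ]→L[ℝ] F)
      (F := V →L[ℝ] V [×j]→L[ℝ] F) e ((hc' x).intervalIntegrable (μ := volume) 0 1)
  rwa [h4] at h3

/-- Integrating the Taylor series of the integrand term by term gives a Taylor series of the
integral, whose terms inherit the dominating function. -/
theorem derivBound_intervalIntegral {r : ℕ} {f : ℝ → V → F} {b : ℝ → ℝ}
    (hf : ∀ y, ContDiff ℝ r (f y))
    (hc : ∀ j ≤ r, ∀ x, Continuous fun y => iteratedFDeriv ℝ j (f y) x)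
    (hb : Continuous b)
    (hfb : ∀ y ∈ Icc (0 : ℝ) 1, ∀ j ≤ r, ∀ x, ‖iteratedFDeriv ℝ j (f y) x‖ ≤ b y) :
    DerivBound r (fun x => ∫ y in (0 : ℝ)..1, f y x) (∫ y in (0 : ℝ)..1, b y) 1 := by
  have hT : HasFTaylorSeriesUpTo r (fun x => ∫ y in (0 : ℝ)..1, f y x)
      (fun x j => ∫ y in (0 : ℝ)..1, iteratedFDeriv ℝ j (f y) x) := by
    refine ⟨fun x => ?_, fun j hj x => ?_, fun j hj => ?_⟩
    · exact ((continuousMultilinearCurryFin0 ℝ V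
        F).toContinuousLinearEquiv.toContinuousLinearMap.intervalIntegral_comp_comm
        ((hc 0 (Nat.zero_le _) x).intervalIntegrable (μ := volume) 0 1)).symm
    · have hj' : j < r := by exact_mod_cast hj
      exact hasFDerivAt_intervalIntegral_curryLeft (hc j hj'.le) (hc (j + 1) hj')
        (fun y x => (hf y).ftaylorSeries.fderiv j (by exact_mod_cast hj') x) hb
        (fun y hy x => hfb y hy (j + 1) hj' x) x
    · have hj' : j ≤ r := by exact_mod_cast hj
      exact continuous_intervalIntegral_of_bound (hc j hj')
        (fun y => (hf y).continuous_iteratedFDeriv (by exact_mod_cast hj')) hb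
        fun y hy => hfb y hy j hj'
  refine ⟨hT.contDiff, fun j hj x => ?_⟩
  rw [← hT.eq_iteratedFDeriv (by exact_mod_cast hj) x, one_pow, mul_one]
  exact intervalIntegral.norm_integral_le_of_norm_le zero_le_one
    (Eventually.of_forall fun y hy => hfb y ⟨hy.1.le, hy.2⟩ j hj x) (hb.intervalIntegrable 0 1)

end ParametricIntegral

/-! ### Characters, weighted averages along segments, and the Fejér kernel. -/

section LineAverage

variable {V : Type*} [NormedAddCommGroup V] [NormedSpace ℝ V]

/-- The character `y ↦ exp (2π i k y)` of `ℝ / ℤ`. -/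
def echar (k : ℤ) (y : ℝ) : ℂ := Complex.exp (2 * Real.pi * k * y * Complex.I)

theorem continuous_echar (k : ℤ) : Continuous (echar k) := by
  unfold echar; fun_prop

theorem norm_echar (k : ℤ) (y : ℝ) : ‖echar k y‖ = 1 := by
  have : (2 * Real.pi * k * y * Complex.I : ℂ) = ((2 * Real.pi * k * y : ℝ) : ℂ) * Complex.I := by
    push_cast; ring
  rw [echar, this, Complex.norm_exp_ofReal_mul_I]

theorem echar_add (k : ℤ) (y z : ℝ) : echar k (y + z) = echar k y * echar k z := by
  simp only [echar, ← Complex.exp_add]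
  congr 1; push_cast; ring

theorem echar_add_int (k l : ℤ) (y : ℝ) : echar (k + l) y = echar k y * echar l y := by
  simp only [echar, ← Complex.exp_add]
  congr 1; push_cast; ring

@[simp] theorem echar_zero_left (y : ℝ) : echar 0 y = 1 := by simp [echar]

theorem echar_one_right (k : ℤ) : echar k 1 = 1 := by
  rw [echar, Complex.exp_eq_one_iff]
  exact ⟨k, by push_cast; ring⟩

theorem conj_echar (k : ℤ) (y : ℝ) : (starRingEnd ℂ) (echar k y) = echar (-k) y := by
  simp only [echar, ← Complex.exp_conj]
  congr 1
  rw [map_mul, map_mul, map_mul, map_mul, Complex.conj_I, Complex.conj_ofReal, Complex.conj_ofReal,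
    map_intCast, map_ofNat]
  push_cast; ring

theorem integral_echar (k : ℤ) : ∫ y in (0 : ℝ)..1, echar k y = if k = 0 then 1 else 0 := by
  split_ifs with h
  · simp [h]
  · have hc : (2 * Real.pi * k * Complex.I : ℂ) ≠ 0 := by
      simp [Real.pi_ne_zero, h]
    have := integral_exp_mul_complex (a := 0) (b := 1) hc
    have e : ∀ y : ℝ, echar k y = Complex.exp (2 * Real.pi * k * Complex.I * y) := fun y => by
      rw [echar]; congr 1; ring
    simp only [e, this]
    have h1 := echar_one_right k
    rw [e] at h1
    simp at *
    simp [h1]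

/-- The average of `g` with weight `w` along the segments `[x, x + v]`. -/
def lineAverage (v : V) (w : ℝ → ℂ) (g : V → ℂ) (x : V) : ℂ :=
  ∫ y in (0 : ℝ)..1, w y * g (x + y • v)

theorem iteratedFDeriv_translate_smul {r : ℕ} {g : V → ℂ} (hg : ContDiff ℝ r g) (c : ℂ) (u : V)
    (x : V) :
    iteratedFDeriv ℝ r (fun x => c * g (x + u)) x = c • iteratedFDeriv ℝ r g (x + u) := by
  have h1 : ContDiff ℝ r fun x => g (x + u) := hg.comp (contDiff_id.add contDiff_const)
  have := iteratedFDeriv_const_smul_apply' (a := c) h1.contDiffAt (x := x)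
  simp only [smul_eq_mul] at this
  rw [this, iteratedFDeriv_comp_add_right]

theorem DerivBound.lineAverage {r : ℕ} {g : V → ℂ} {B : ℝ} (hg : DerivBound r g B 1) (v : V)
    {w : ℝ → ℂ} (hw : Continuous w) :
    DerivBound r (lineAverage v w g) (∫ y in (0 : ℝ)..1, ‖w y‖ * B) 1 := by
  have hD : ∀ j ≤ r, ∀ (y : ℝ) x, iteratedFDeriv ℝ j (fun x => w y * g (x + y • v)) x =
      w y • iteratedFDeriv ℝ j g (x + y • v) := fun j hj y x =>
    iteratedFDeriv_translate_smul (hg.1.of_le (by exact_mod_cast hj)) _ _ _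
  refine derivBound_intervalIntegral (f := fun y x => w y * g (x + y • v)) (fun y => ?_)
    (fun j hj x => ?_) (by fun_prop) fun y _ j hj x => ?_
  · exact contDiff_const.mul (hg.1.comp (contDiff_id.add contDiff_const))
  · simp only [hD j hj]
    have := hg.1.continuous_iteratedFDeriv (m := j) (by exact_mod_cast hj)
    fun_prop
  · rw [hD j hj, norm_smul]
    exact mul_le_mul_of_nonneg_left (by simpa using hg.2 j hj (x + y • v)) (norm_nonneg _)

theorem DerivBound.lineAverage_echar {r : ℕ} {g : V → ℂ} {B : ℝ} (hg : DerivBound r g B 1) (v : V)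
    (k : ℤ) : DerivBound r (NearlyIntegrable.lineAverage v (echar k) g) B 1 := by
  simpa [norm_echar] using hg.lineAverage v (continuous_echar k)

theorem lineAverage_translate {g : V → ℂ} {u : V} {c : ℂ} (h : ∀ x, g (x + u) = c * g x) (v : V)
    (w : ℝ → ℂ) (x : V) : lineAverage v w g (x + u) = c * lineAverage v w g x := by
  simp only [lineAverage, ← intervalIntegral.integral_const_mul]
  congr 1 with y
  rw [show x + u + y • v = x + y • v + u by abel, h]
  ring

/-- Fubini. It lets the vanishing of the fast average survive every later projection onto a
harmonic. -/
theorem lineAverage_comm {g : V → ℂ} (hg : Continuous g) (v v' : V) {w w' : ℝ → ℂ}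
    (hw : Continuous w) (hw' : Continuous w') (x : V) :
    lineAverage v w (lineAverage v' w' g) x = lineAverage v' w' (lineAverage v w g) x := by
  simp only [lineAverage, intervalIntegral.integral_of_le zero_le_one]
  simp only [← integral_const_mul]
  rw [integral_integral_swap]
  · congr 1 with y
    congr 1 with z
    rw [show x + z • v + y • v' = x + y • v' + z • v by abel]
    ring
  · rw [Measure.prod_restrict]
    refine (ContinuousOn.integrableOn_compact (K := Icc 0 1 ×ˢ Icc 0 1)
      (isCompact_Icc.prod isCompact_Icc) (Continuous.continuousOn ?_)).mono_set (prod_mono Ioc_subset_Icc_self Ioc_subset_Icc_self)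
    simp only [Function.uncurry_def]
    fun_prop

/-- Averaging against a character projects onto one harmonic: shifting the integration variable over
a full period brings out the eigenvalue, with frequency −k. -/
theorem lineAverage_echar_translate {g : V → ℂ} {v : V} (h : ∀ x, g (x + v) = g x) (k : ℤ) (x : V)
    (a : ℝ) : lineAverage v (echar k) g (x + a • v) = echar (-k) a * lineAverage v (echar k) g x := by
  have hp : Function.Periodic (fun y : ℝ => echar k y * g (x + y • v)) 1 := fun y => by
    simp only [echar_add, echar_one_right, mul_one, add_smul, one_smul, ← add_assoc, h]
  have h1 : ∀ y : ℝ, echar k y * g (x + a • v + y • v) =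
      echar (-k) a * (echar k (y + a) * g (x + (y + a) • v)) := fun y => by
    have : echar (-k) a * echar k a = 1 := by
      rw [← echar_add_int]; simp
    rw [echar_add, show x + (y + a) • v = x + a • v + y • v by rw [add_smul]; abel]
    linear_combination (-(echar k y) * g (x + a • v + y • v)) * this
  simp only [lineAverage, h1, intervalIntegral.integral_const_mul]
  rw [intervalIntegral.integral_comp_add_right fun y => echar k y * g (x + y • v)]
  have := hp.intervalIntegral_add_eq a 0
  simp only [zero_add] at this ⊢
  rw [add_comm 1 a, this]

/-- The Fejér kernel, as the squared norm of the Dirichlet sum. -/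
def fejer (L : ℕ) (y : ℝ) : ℝ := (L : ℝ)⁻¹ * ‖∑ a : Fin L, echar (a : ℕ) y‖ ^ 2

theorem continuous_fejer (L : ℕ) : Continuous (fejer L) := by
  have : ∀ k, Continuous (echar k) := continuous_echar
  unfold fejer; fun_prop

theorem fejer_nonneg (L : ℕ) (y : ℝ) : 0 ≤ fejer L y := by unfold fejer; positivity

theorem fejer_eq_sum (L : ℕ) (y : ℝ) : (fejer L y : ℂ) =
    ∑ q : Fin L × Fin L, (L : ℂ)⁻¹ * echar ((q.1 : ℕ) - (q.2 : ℕ) : ℤ) y := by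
  rw [fejer, ← Finset.mul_sum]
  push_cast
  rw [← Complex.mul_conj', map_sum, Finset.sum_mul_sum, Fintype.sum_prod_type]
  simp only [conj_echar, ← echar_add_int, ← sub_eq_add_neg]

theorem integral_fejer {L : ℕ} (hL : 1 ≤ L) : ∫ y in (0 : ℝ)..1, fejer L y = 1 := by
  have h : ∫ y in (0 : ℝ)..1, (fejer L y : ℂ) = 1 := by
    simp only [fejer_eq_sum]
    have hc : ∀ q : Fin L × Fin L, IntervalIntegrable
        (fun y => (L : ℂ)⁻¹ * echar ((q.1 : ℕ) - (q.2 : ℕ) : ℤ) y) volume 0 1 := fun q =>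
      (continuous_const.mul (continuous_echar _)).intervalIntegrable _ _
    have h0 : ∀ a b : Fin L, (((a : ℕ) : ℤ) - ((b : ℕ) : ℤ) = 0) = (a = b) := fun a b => by
      rw [sub_eq_zero, Nat.cast_inj, Fin.val_inj]
    have hL0 : (L : ℂ) ≠ 0 := by exact_mod_cast (by omega : L ≠ 0)
    rw [intervalIntegral.integral_finsetSum fun q _ => hc q]
    simp only [intervalIntegral.integral_const_mul, integral_echar, Fintype.sum_prod_type, h0]
    simp [hL0]
  rw [intervalIntegral.integral_ofReal] at h
  exact_mod_cast h

/-- The Dirichlet sum is geometric: multiplied by `echar 1 y - 1`, of modulus 2|sin πy|, it becomes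
a difference of two unit numbers. -/
theorem fejer_mul_sin_sq_le {L : ℕ} (y : ℝ) :
    fejer L y * Real.sin (Real.pi * y) ^ 2 ≤ (L : ℝ)⁻¹ := by
  have h1 : (∑ a : Fin L, echar (a : ℕ) y) * (echar 1 y - 1) = echar L y - 1 := by
    have : ∀ a : ℕ, echar (a : ℕ) y = echar 1 y ^ a := fun a => by
      induction a with
      | zero => simp
      | succ a ih => push_cast; rw [echar_add_int, ih, pow_succ]
    simp only [this]
    rw [Fin.sum_univ_eq_sum_range fun a => echar 1 y ^ a, geom_sum_mul]
  have h2 : ‖echar 1 y - 1‖ = 2 * |Real.sin (Real.pi * y)| := by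
    have := Complex.norm_exp_I_mul_ofReal_sub_one (2 * Real.pi * y)
    have e : echar 1 y = Complex.exp (Complex.I * ((2 * Real.pi * y : ℝ) : ℂ)) := by
      rw [echar]; congr 1; push_cast; ring
    rw [e, this, show 2 * Real.pi * y / 2 = Real.pi * y by ring]
    simp
  have h3 : ‖∑ a : Fin L, echar (a : ℕ) y‖ * (2 * |Real.sin (Real.pi * y)|) ≤ 2 := by
    rw [← h2, ← norm_mul, h1]
    refine (norm_sub_le _ _).trans ?_
    rw [norm_echar]; norm_num
  have h4 : (‖∑ a : Fin L, echar (a : ℕ) y‖ * |Real.sin (Real.pi * y)|) ^ 2 ≤ 1 :=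
    pow_le_one₀ (by positivity) (by linarith)
  rw [mul_pow, sq_abs] at h4
  rw [fejer, mul_assoc]
  exact mul_le_of_le_one_right (by positivity) h4

theorem min_le_sin_pi_mul {y : ℝ} (hy : y ∈ Icc (0 : ℝ) 1) :
    min y (1 - y) ≤ Real.sin (Real.pi * y) := by
  have key : ∀ z, 0 ≤ z → z ≤ 1 / 2 → z ≤ Real.sin (Real.pi * z) := fun z h0 h1 => by
    have := Real.mul_le_sin (x := Real.pi * z) (by positivity)
      (by nlinarith [Real.pi_pos])
    have e : 2 / Real.pi * (Real.pi * z) = 2 * z := by field_simp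
    linarith
  rcases le_total y (1 / 2) with h | h
  · exact (min_le_left _ _).trans (key y hy.1 h)
  · refine (min_le_right _ _).trans ((key (1 - y) (by linarith [hy.2]) (by linarith)).trans ?_)
    rw [show Real.pi * (1 - y) = Real.pi - Real.pi * y by ring, Real.sin_pi_sub]

theorem lineAverage_fejer_eq_sum {g : V → ℂ} (hg : Continuous g) (L : ℕ) (v : V) (x : V) :
    lineAverage v (fun y => (fejer L y : ℂ)) g x =
      ∑ q : Fin L × Fin L, (L : ℂ)⁻¹ *
        lineAverage v (echar ((q.1 : ℕ) - (q.2 : ℕ) : ℤ)) g x := by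
  simp only [lineAverage, fejer_eq_sum, Finset.sum_mul, ← intervalIntegral.integral_const_mul]
  rw [intervalIntegral.integral_finsetSum]
  · simp only [mul_assoc]
  · intro q _
    have := continuous_echar ((q.1 : ℕ) - (q.2 : ℕ) : ℤ)
    exact Continuous.intervalIntegrable (by fun_prop) _ _

/-- A positive kernel of mass one does not increase the bounds; this keeps them uniform in L through
the successive convolutions. -/
theorem DerivBound.lineAverage_fejer {r : ℕ} {g : V → ℂ} {B : ℝ} (hg : DerivBound r g B 1) (v : V)
    {L : ℕ} (hL : 1 ≤ L) :
    DerivBound r (NearlyIntegrable.lineAverage v (fun y => (fejer L y : ℂ)) g) B 1 := by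
  have := hg.lineAverage v (w := fun y => (fejer L y : ℂ))
    (Complex.continuous_ofReal.comp (continuous_fejer L))
  simpa [abs_of_nonneg (fejer_nonneg L _), integral_fejer hL] using this

/-- One derivative is traded for the rate L^(-1/2). By periodicity the increment over y v is at most
B min(y, 1 − y), and this distance has small mean for the Fejér kernel, since F_L(y) sin²(πy) ≤ 1/L.
-/
theorem DerivBound.sub_lineAverage_fejer {r : ℕ} {g : V → ℂ} {B : ℝ}
    (hg : DerivBound (r + 1) g B 1) {v : V} (hv : ‖v‖ ≤ 1) (hper : ∀ x, g (x + v) = g x)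
    {L : ℕ} (hL : 1 ≤ L) :
    DerivBound r (fun x => g x - NearlyIntegrable.lineAverage v (fun y => (fejer L y : ℂ)) g x)
      (2 * B / √L) 1 := by
  have hL0 : (0 : ℝ) < L := by exact_mod_cast hL
  have hs : 0 < √(L : ℝ) := Real.sqrt_pos.2 hL0
  have hB := hg.nonneg
  set b : ℝ → ℝ := fun y => B * (fejer L y * (1 / √L) +
    √L * (fejer L y * Real.sin (Real.pi * y) ^ 2)) with hb
  have hbc : Continuous b := by
    have := continuous_fejer L
    fun_prop
  have hD : ∀ j ≤ r, ∀ (y : ℝ) x, iteratedFDeriv ℝ j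
      (fun x => (fejer L y : ℂ) * (g x - g (x + y • v))) x =
      (fejer L y : ℂ) • (iteratedFDeriv ℝ j g x - iteratedFDeriv ℝ j g (x + y • v)) := by
    intro j hj y x
    have hgj : ContDiff ℝ j g := hg.1.of_le (by norm_cast; omega)
    have hgt : ContDiff ℝ j fun x => g (x + y • v) := hgj.comp (contDiff_id.add contDiff_const)
    have h1 := iteratedFDeriv_const_smul_apply' (a := (fejer L y : ℂ))
      (hgj.sub hgt).contDiffAt (x := x)
    simp only [smul_eq_mul] at h1
    have h2 := fun_iteratedFDeriv_sub_apply hgj.contDiffAt hgt.contDiffAt (x := x)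
    rw [h1, h2, iteratedFDeriv_comp_add_right]
  have hinc : ∀ j ≤ r, ∀ x u, ‖iteratedFDeriv ℝ j g (x + u) - iteratedFDeriv ℝ j g x‖ ≤
      B * ‖u‖ := by
    intro j hj x u
    refine norm_increment_le (hg.1.differentiable_iteratedFDeriv (by norm_cast; omega))
      (fun y => ?_) x u
    rw [norm_fderiv_iteratedFDeriv]
    simpa using hg.2 (j + 1) (by omega) y
  have hperj : ∀ j x, iteratedFDeriv ℝ j g (x + v) = iteratedFDeriv ℝ j g x := by
    intro j x
    rw [← iteratedFDeriv_comp_add_right]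
    simp only [hper]
  have key := derivBound_intervalIntegral (r := r) (b := b)
    (f := fun y x => (fejer L y : ℂ) * (g x - g (x + y • v)))
    (fun y => ?_) (fun j hj x => ?_) hbc fun y hy j hj x => ?_
  · have e : (fun x => g x - NearlyIntegrable.lineAverage v (fun y => (fejer L y : ℂ)) g x) =
        fun x => ∫ y in (0 : ℝ)..1, (fejer L y : ℂ) * (g x - g (x + y • v)) := by
      ext x
      have hF := continuous_fejer L
      have hgc := hg.1.continuous
      simp only [mul_sub]
      rw [intervalIntegral.integral_sub
        (Continuous.intervalIntegrable (by fun_prop) _ _)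
        (Continuous.intervalIntegrable (by fun_prop) _ _), intervalIntegral.integral_mul_const,
        intervalIntegral.integral_ofReal, integral_fejer hL]
      simp [NearlyIntegrable.lineAverage]
    rw [e]
    refine key.mono_const ?_ zero_le_one
    have hF := continuous_fejer L
    rw [hb, intervalIntegral.integral_const_mul, intervalIntegral.integral_add
      (Continuous.intervalIntegrable (by fun_prop) _ _)
      (Continuous.intervalIntegrable (by fun_prop) _ _), intervalIntegral.integral_mul_const,
      intervalIntegral.integral_const_mul, integral_fejer hL]
    have h1 : ∫ y in (0 : ℝ)..1, fejer L y * Real.sin (Real.pi * y) ^ 2 ≤ (L : ℝ)⁻¹ := by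
      have := intervalIntegral.integral_mono_on (a := 0) (b := 1) zero_le_one
        (Continuous.intervalIntegrable (μ := volume) (by fun_prop) _ _)
        (intervalIntegrable_const (c := (L : ℝ)⁻¹)) fun y _ => fejer_mul_sin_sq_le (L := L) y
      simpa using this
    have h2 : √L * (L : ℝ)⁻¹ = 1 / √L := by
      have := Real.mul_self_sqrt hL0.le
      field_simp
      nlinarith
    calc B * (1 * (1 / √L) + √L * _) ≤ B * (1 * (1 / √L) + √L * (L : ℝ)⁻¹) := by gcongr
      _ = 2 * B / √L := by rw [h2]; ring
  · exact contDiff_const.mul ((hg.1.of_le (by norm_cast; omega)).sub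
      ((hg.1.of_le (by norm_cast; omega)).comp (contDiff_id.add contDiff_const)))
  · simp only [hD j hj]
    have := hg.1.continuous_iteratedFDeriv (m := j) (by norm_cast; omega)
    have := continuous_fejer L
    fun_prop
  · rw [hD j hj, norm_smul, Complex.norm_real, Real.norm_eq_abs, abs_of_nonneg (fejer_nonneg L y)]
    have h1 : ‖iteratedFDeriv ℝ j g x - iteratedFDeriv ℝ j g (x + y • v)‖ ≤
        B * min y (1 - y) := by
      rw [mul_min_of_nonneg _ _ hB]
      refine le_min ?_ ?_
      · rw [norm_sub_rev]
        refine (hinc j hj x _).trans (mul_le_mul_of_nonneg_left ?_ hB)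
        rw [norm_smul, Real.norm_eq_abs, abs_of_nonneg hy.1]
        exact mul_le_of_le_one_right hy.1 hv
      · rw [← hperj]
        rw [show x + v = x + y • v + (1 - y) • v by rw [sub_smul, one_smul]; abel]
        refine (hinc j hj _ _).trans (mul_le_mul_of_nonneg_left ?_ hB)
        rw [norm_smul, Real.norm_eq_abs, abs_of_nonneg (by linarith [hy.2])]
        exact mul_le_of_le_one_right (by linarith [hy.2]) hv
    -- Bounding t linearly by 1/√L + √L t² makes the estimate on F_L sin² usable; the weight √L
    -- balances the two contributions.
    have h2 : min y (1 - y) ≤ 1 / √L + √L * Real.sin (Real.pi * y) ^ 2 := by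
      refine (min_le_sin_pi_mul hy).trans ?_
      set t := Real.sin (Real.pi * y)
      rw [div_add' _ _ _ hs.ne', le_div_iff₀ hs]
      nlinarith [sq_nonneg (√L * t - 1), sq_nonneg (√L * t)]
    refine (mul_le_mul_of_nonneg_left (h1.trans (mul_le_mul_of_nonneg_left h2 hB))
      (fejer_nonneg L y)).trans (le_of_eq ?_)
    rw [hb]; ring

end LineAverage

/-! ### Decomposition into finitely many harmonics. -/

variable {V : Type*} [NormedAddCommGroup V] [NormedSpace ℝ V]

/-- A smooth function, periodic in finitely many directions, is approximated by a sum of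
boundedly many components which are eigenfunctions of the translations in these directions. -/
theorem exists_fourier_decomposition {J : Type*} [DecidableEq J] {v : J → V} (hv : ∀ j, ‖v j‖ ≤ 1)
    {Γ : Set V} (hΓ : ∀ j, v j ∈ Γ) {W : V → ℂ} {B : ℝ} {r : ℕ} (hW : DerivBound (r + 1) W B 1)
    (hper : ∀ u ∈ Γ, ∀ x, W (x + u) = W x) {L : ℕ} (hL : 1 ≤ L) {v₁ v₂ : V}
    (hz : ∀ x, lineAverage v₁ (echar 0) (lineAverage v₂ (echar 0) W) x = 0) (s : Finset J) :
    ∃ (ι : Type) (_ : Fintype ι) (g : ι → V → ℂ) (k : ι → J → ℤ),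
      (∀ i, DerivBound (r + 1) (g i) (B / (L : ℝ) ^ s.card) 1) ∧
      Fintype.card ι = L ^ (2 * s.card) ∧
      (∀ i, ∀ u ∈ Γ, ∀ x, g i (x + u) = g i x) ∧
      (∀ i, ∀ j ∈ s, ∀ (a : ℝ) x, g i (x + a • v j) = echar (-k i j) a * g i x) ∧
      (∀ i j, |k i j| ≤ L) ∧
      (∀ i x, lineAverage v₁ (echar 0) (lineAverage v₂ (echar 0) (g i)) x = 0) ∧
      DerivBound (r + 1) (fun x => ∑ i, g i x) B 1 ∧
      DerivBound r (fun x => W x - ∑ i, g i x) (s.card * (2 * B / √L)) 1 := by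
  have hL0 : (0 : ℝ) < L := by exact_mod_cast hL
  induction s using Finset.induction_on with
  | empty =>
    refine ⟨Unit, inferInstance, fun _ => W, fun _ _ => 0, ?_⟩
    refine ⟨fun _ => by simpa using hW, by simp, fun _ => hper, by simp, by simp, fun _ => hz,
      by simpa using hW, ?_⟩
    simpa using DerivBound.zero le_rfl zero_le_one
  | insert j s hj ih =>
    obtain ⟨ι, hι, g, k, hg, hcard, hgp, hge, hk, hgz, hS, hWS⟩ := ih
    let κ : Fin L × Fin L → ℤ := fun q => (q.1 : ℕ) - (q.2 : ℕ)
    -- Each new direction splits every component into L² pieces, one per pair of indices of the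
    -- squared Dirichlet sum, each with weight 1/L. Equal frequencies are not grouped together.
    let g' : ι × (Fin L × Fin L) → V → ℂ := fun i x =>
      (L : ℂ)⁻¹ * lineAverage (v j) (echar (κ i.2)) (g i.1) x
    have hgc : ∀ i, Continuous (g i) := fun i => (hg i).1.continuous
    have hgc' : ∀ i (k : ℤ), Continuous (lineAverage (v j) (echar k) (g i)) := fun i k =>
      ((hg i).lineAverage_echar _ _).1.continuous
    have hsum : ∀ x, ∑ i, g' i x =
        lineAverage (v j) (fun y => (fejer L y : ℂ)) (fun x => ∑ i, g i x) x := by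
      intro x
      rw [lineAverage_fejer_eq_sum hS.1.continuous, Fintype.sum_prod_type, Finset.sum_comm]
      refine Finset.sum_congr rfl fun q _ => ?_
      rw [← Finset.mul_sum]
      congr 1
      simp only [lineAverage, Finset.mul_sum]
      rw [intervalIntegral.integral_finsetSum]
      intro i _
      have := hgc i
      have := continuous_echar (κ q)
      exact Continuous.intervalIntegrable (by fun_prop) _ _
    refine ⟨ι × (Fin L × Fin L), inferInstance, g', fun i => Function.update (k i.1) j (κ i.2),
      fun i => ?_, ?_, fun i u hu x => ?_, fun i j' hj' a x => ?_, fun i j' => ?_, fun i x => ?_,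
      ?_, ?_⟩
    · have h := ((hg i.1).lineAverage_echar (v j) (κ i.2)).clm
        ((L : ℂ)⁻¹ • ContinuousLinearMap.id ℝ ℂ)
      refine DerivBound.mono_const (f := g' i) h ?_ zero_le_one
      have : ‖(L : ℂ)⁻¹ • ContinuousLinearMap.id ℝ ℂ‖ ≤ (L : ℝ)⁻¹ := by
        rw [norm_smul]
        refine (mul_le_mul_of_nonneg_left ContinuousLinearMap.norm_id_le (norm_nonneg _)).trans ?_
        simp
      refine (mul_le_mul_of_nonneg_right this (hg i.1).nonneg).trans (le_of_eq ?_)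
      rw [Finset.card_insert_of_notMem hj, pow_succ]
      field_simp
    · rw [Fintype.card_prod, hcard, Fintype.card_prod, Fintype.card_fin,
        Finset.card_insert_of_notMem hj]
      ring
    · have := lineAverage_translate (c := 1) (g := g i.1) (u := u)
        (by simpa using hgp i.1 u hu) (v j) (echar (κ i.2)) x
      simp [g', this]
    · by_cases h : j' = j
      · subst h
        have := lineAverage_echar_translate (hgp i.1 _ (hΓ j')) (κ i.2) x a
        simp only [g', this, Function.update_self]
        ring
      · have hjs : j' ∈ s := (Finset.mem_insert.1 hj').resolve_left h
        have := lineAverage_translate (hge i.1 j' hjs a) (v j) (echar (κ i.2)) x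
        simp only [g', this, Function.update_of_ne h]
        ring
    · by_cases h : j' = j
      · subst h
        have h1 := i.2.1.isLt
        have h2 := i.2.2.isLt
        simp only [Function.update_self, κ, abs_le]
        omega
      · simpa [Function.update_of_ne h] using hk i.1 j'
    · have e1 : ∀ (v : V) (f : V → ℂ) x, lineAverage v (echar 0) (fun x => (L : ℂ)⁻¹ * f x) x =
          (L : ℂ)⁻¹ * lineAverage v (echar 0) f x := by
        intro v f x
        simp only [lineAverage, ← intervalIntegral.integral_const_mul]
        congr 1 with y
        ring
      have e2 : lineAverage v₂ (echar 0) (lineAverage (v j) (echar (κ i.2)) (g i.1)) =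
          lineAverage (v j) (echar (κ i.2)) (lineAverage v₂ (echar 0) (g i.1)) := by
        ext x
        exact lineAverage_comm (hgc i.1) _ _ (continuous_echar _) (continuous_echar _) x
      have e3 := lineAverage_comm (((hg i.1).lineAverage_echar v₂ 0).1.continuous) v₁ (v j)
        (continuous_echar 0) (continuous_echar (κ i.2)) x
      have e4 : lineAverage v₂ (echar 0) (g' i) = fun x => (L : ℂ)⁻¹ *
          lineAverage v₂ (echar 0) (lineAverage (v j) (echar (κ i.2)) (g i.1)) x := by
        ext x
        exact e1 _ _ x
      rw [e4, e1, e2, e3]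
      simp [lineAverage.eq_1 (v j), hgz i.1]
    · simp only [hsum]
      exact hS.lineAverage_fejer (v j) hL
    · have h1 := hS.sub_lineAverage_fejer (v := v j) (hv j)
        (fun x => Finset.sum_congr rfl fun i _ => hgp i _ (hΓ j) x) hL
      have := hWS.add h1
      rw [Finset.card_insert_of_notMem hj]
      push_cast
      rw [add_mul, one_mul]
      simpa [hsum] using this

/-! ### Regularized small divisors and the homological equation. -/

theorem DerivBound.comp_clm {V W F : Type*} [NormedAddCommGroup V] [NormedSpace ℝ V]
    [NormedAddCommGroup W] [NormedSpace ℝ W] [NormedAddCommGroup F] [NormedSpace ℝ F]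
    {r : ℕ} {f : W → F} {A Λ : ℝ} (hf : DerivBound r f A Λ) (T : V →L[ℝ] W) (hT : ‖T‖ ≤ 1) :
    DerivBound r (fun x => f (T x)) A Λ := by
  refine ⟨hf.1.comp T.contDiff, fun j hj x => ?_⟩
  have h := T.iteratedFDeriv_comp_right hf.1 x (i := j) (by exact_mod_cast hj)
  rw [show (fun x => f (T x)) = f ∘ T from rfl, h]
  refine (ContinuousMultilinearMap.norm_compContinuousLinearMap_le _ _).trans ?_
  refine (mul_le_of_le_one_right (norm_nonneg _) ?_).trans (hf.2 j hj (T x))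
  simpa using pow_le_one₀ (norm_nonneg _) hT

/-- A smooth regularization of `z ↦ 1 / (2π z)` with bounded derivatives. -/
theorem exists_smooth_inverse (r : ℕ) : ∃ (φ : ℝ → ℝ) (C : ℝ), DerivBound r φ C 1 ∧
    ∀ z, 1 ≤ |z| → φ z * (2 * Real.pi * z) = 1 := by
  let χ : ContDiffBump (0 : ℝ) := ⟨1 / 2, 1, by norm_num, by norm_num⟩
  let φ : ℝ → ℝ := fun z => (2 * Real.pi)⁻¹ * ((1 - χ z) * z⁻¹)
  have hχ0 : ∀ z, 1 ≤ |z| → χ z = 0 := fun z hz => χ.zero_of_le_dist (by simpa using hz)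
  have hφ1 : ∀ z, 1 ≤ |z| → φ z = (2 * Real.pi)⁻¹ * z⁻¹ := fun z hz => by simp [φ, hχ0 z hz]
  have hφc : ContDiff ℝ r φ := by
    rw [contDiff_iff_contDiffAt]
    intro z
    by_cases hz : z = 0
    · subst hz
      refine (contDiffAt_const (c := (0 : ℝ))).congr_of_eventuallyEq ?_
      filter_upwards [χ.eventuallyEq_one] with z hz
      simp only [Pi.one_apply] at hz
      simp [φ, hz]
    · exact contDiffAt_const.mul ((contDiffAt_const.sub χ.contDiffAt).mul (contDiffAt_inv ℝ hz))
  have hcpt : ∀ j ≤ r, ∃ C, ∀ z ∈ Icc (-2 : ℝ) 2, ‖iteratedFDeriv ℝ j φ z‖ ≤ C := fun j hj =>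
    isCompact_Icc.exists_bound_of_continuousOn
      (hφc.continuous_iteratedFDeriv (m := j) (by exact_mod_cast hj)).continuousOn
  choose! C hC using hcpt
  have hC0 : ∀ j ≤ r, 0 ≤ C j := fun j hj => (norm_nonneg _).trans (hC j hj 0 (by norm_num))
  refine ⟨φ, ∑ j ∈ Finset.range (r + 1), (C j + (2 * Real.pi)⁻¹ * j.factorial),
    ⟨hφc, fun j hj z => ?_⟩, fun z hz => ?_⟩
  · rw [one_pow, mul_one]
    have hle : C j + (2 * Real.pi)⁻¹ * j.factorial ≤
        ∑ j ∈ Finset.range (r + 1), (C j + (2 * Real.pi)⁻¹ * j.factorial) :=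
      Finset.single_le_sum (f := fun j : ℕ => C j + (2 * Real.pi)⁻¹ * (j.factorial : ℝ))
        (fun i hi => by
          have := hC0 i (by simpa [Nat.lt_succ_iff] using hi)
          positivity) (by simpa [Nat.lt_succ_iff] using hj)
    refine le_trans ?_ hle
    have hp : 0 ≤ (2 * Real.pi)⁻¹ * (j.factorial : ℝ) := by positivity
    rcases le_or_gt |z| 2 with h | h
    · exact (hC j hj z (abs_le.1 h)).trans (by linarith)
    · have hev : φ =ᶠ[𝓝 z] fun z => (2 * Real.pi)⁻¹ * z⁻¹ := by
        filter_upwards [(continuous_abs.isOpen_preimage _ isOpen_Ioi).mem_nhds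
          (show z ∈ abs ⁻¹' Ioi (1 : ℝ) from lt_trans (by norm_num) h)] with y hy
        exact hφ1 y (le_of_lt hy)
      have hz : z ≠ 0 := fun h0 => by simp [h0] at h; linarith
      rw [(Filter.EventuallyEq.iteratedFDeriv ℝ hev j).eq_of_nhds]
      have h1 := iteratedFDeriv_const_smul_apply' (a := (2 * Real.pi)⁻¹) (i := j) (𝕜 := ℝ)
        (f := fun z : ℝ => z⁻¹) (contDiffAt_inv ℝ hz)
      simp only [smul_eq_mul] at h1
      rw [h1, norm_smul, norm_iteratedFDeriv_eq_norm_iteratedDeriv, iteratedDeriv_eq_iterate,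
        iter_deriv_inv, norm_mul, norm_mul, norm_pow, norm_neg, norm_one, one_pow, one_mul,
        Real.norm_of_nonneg (by positivity : (0 : ℝ) ≤ (2 * Real.pi)⁻¹), norm_zpow]
      have h2 : ‖z‖ ^ (-1 - j : ℤ) ≤ 1 := by
        refine zpow_le_one_of_nonpos₀ ?_ (by omega)
        rw [Real.norm_eq_abs]; linarith
      have h3 : ‖(j.factorial : ℝ)‖ = j.factorial := Real.norm_of_nonneg (by positivity)
      rw [h3]
      have := hC0 j hj
      have h4 : (2 * Real.pi)⁻¹ * ((j.factorial : ℝ) * ‖z‖ ^ (-1 - j : ℤ)) ≤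
          (2 * Real.pi)⁻¹ * ((j.factorial : ℝ) * 1) := by gcongr
      linarith
  · have hz0 : z ≠ 0 := fun h0 => by simp [h0] at hz; linarith
    rw [hφ1 z hz]
    field_simp

/-- The directions of the angles `θᵢ` and of the time. -/
def angleDir (m : ℕ) : Fin (m + 1) ⊕ Unit → X m
  | Sum.inl i => (EuclideanSpace.single i 1, 0, 0)
  | Sum.inr _ => (0, 0, 1)

theorem norm_angleDir (m : ℕ) (j : Fin (m + 1) ⊕ Unit) : ‖angleDir m j‖ ≤ 1 := by
  rcases j with i | i <;> simp [angleDir, Prod.norm_def]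

theorem angleDir_momentum (m : ℕ) (j : Fin (m + 1) ⊕ Unit) : (angleDir m j).2.1 = 0 := by
  rcases j with i | i <;> rfl

theorem angleDir_mem_range_deck (m : ℕ) (j : Fin (m + 1) ⊕ Unit) :
    angleDir m j ∈ range fun q : (Fin (m + 1) → ℤ) × ℤ => deck (m := m) q.1 q.2 := by
  rcases j with i | i
  · refine ⟨(Pi.single i 1, 0), ?_⟩
    simp only [deck, angleDir, Int.cast_zero, Prod.mk.injEq, and_true]
    ext j
    by_cases h : j = i
    · subst h; simp
    · simp [h]
  · refine ⟨(0, 1), ?_⟩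
    simp only [deck, angleDir, Int.cast_one, Prod.mk.injEq, and_true]
    ext j
    simp

/-- The projection to the momenta. -/
def momentum (m : ℕ) : X m →L[ℝ] E m :=
  (ContinuousLinearMap.fst ℝ (E m) ℝ).comp (ContinuousLinearMap.snd ℝ (E m) (E m × ℝ))

@[simp] theorem momentum_apply (m : ℕ) (x : X m) : momentum m x = x.2.1 := rfl

theorem norm_momentum_le (m : ℕ) : ‖momentum m‖ ≤ 1 :=
  ContinuousLinearMap.opNorm_le_bound _ zero_le_one fun x => by
    rw [one_mul]
    exact (norm_fst_le x.2).trans (norm_snd_le x)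

/-- The divisor `∑ kᵢ ∂ᵢ H₀ + k_t` associated to the harmonic `k`. -/
def divisor {m : ℕ} (H₀ : E m → ℝ) (k : Fin (m + 1) ⊕ Unit → ℤ) (p : E m) : ℝ :=
  ∑ i, k (Sum.inl i) * fderiv ℝ H₀ p (EuclideanSpace.single i 1) + k (Sum.inr ())

/-- The constant k^t is subtracted because only the p-dependent part matters for derivatives;
`derivBound_comp_divisor` puts the constant back. -/
theorem derivBound_divisor {m r : ℕ} {H₀ : E m → ℝ} {M : ℝ} (hH₀ : DerivBound (r + 1) H₀ M 1)
    {L : ℝ} {k : Fin (m + 1) ⊕ Unit → ℤ} (hk : ∀ j, ((|k j| : ℤ) : ℝ) ≤ L) :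
    DerivBound r (fun p => divisor H₀ k p - k (Sum.inr ())) ((m + 1) * L * M) 1 := by
  have h1 : DerivBound r (fderiv ℝ H₀) M 1 := by simpa using hH₀.fderiv
  have h2 := DerivBound.sum (r := r) (Λ := 1) (Finset.univ : Finset (Fin (m + 1)))
    (f := fun i p => (k (Sum.inl i) : ℝ) • fderiv ℝ H₀ p (EuclideanSpace.single i 1))
    (A := fun _ => L * M) zero_le_one fun i _ => ?_
  · simpa [divisor, mul_assoc] using h2
  · have h3 := h1.clm_of_le_one zero_le_one (L := ContinuousLinearMap.apply ℝ ℝ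
      (EuclideanSpace.single i 1 : E m)) (ContinuousLinearMap.opNorm_le_bound _ zero_le_one
        fun T => by simpa using T.le_opNorm (EuclideanSpace.single i 1 : E m))
    refine (h3.const_smul (k (Sum.inl i))).mono_const ?_ zero_le_one
    have := hk (Sum.inl i)
    push_cast at this
    exact mul_le_mul_of_nonneg_right this h1.nonneg

theorem fderiv_apply_of_translate {V : Type*} [NormedAddCommGroup V] [NormedSpace ℝ V]
    {g : V → ℂ} {v : V} {k : ℤ} {x : V} (hg : DifferentiableAt ℝ g x)
    (h : ∀ a : ℝ, g (x + a • v) = echar (-k) a * g x) :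
    fderiv ℝ g x v = (-2 * Real.pi * k * Complex.I) * g x := by
  have h1 : HasDerivAt (fun a : ℝ => g (x + a • v)) (fderiv ℝ g x v) 0 := by
    have hl : HasDerivAt (fun a : ℝ => x + a • v) v 0 := by
      simpa using ((hasDerivAt_id (0 : ℝ)).smul_const v).const_add x
    have hg' : HasFDerivAt g (fderiv ℝ g x) (x + (0 : ℝ) • v) := by simpa using hg.hasFDerivAt
    exact hg'.comp_hasDerivAt (0 : ℝ) hl
  have h2 : HasDerivAt (fun a : ℝ => echar (-k) a * g x)
      ((-2 * Real.pi * k * Complex.I) * g x) 0 := by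
    have hl : HasDerivAt (fun a : ℝ => (2 * Real.pi * ((-k : ℤ) : ℂ) * (a : ℂ) * Complex.I))
        (-2 * Real.pi * k * Complex.I) 0 := by
      have := (((hasDerivAt_id (0 : ℝ)).ofReal_comp).const_mul
        (2 * Real.pi * ((-k : ℤ) : ℂ))).mul_const Complex.I
      refine this.congr_deriv ?_
      push_cast; ring
    have := (hl.cexp).mul_const (g x)
    simpa [echar] using this
  simp only [h] at h1
  exact h1.unique h2

theorem lineAverage_zero_of_invariant {V : Type*} [NormedAddCommGroup V] [NormedSpace ℝ V]
    {g : V → ℂ} {v : V} (h : ∀ (a : ℝ) x, g (x + a • v) = g x) :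
    lineAverage v (echar 0) g = g := by
  ext x
  simp [lineAverage, h]

/-- The rescaled function φ(·/s)/s is the inverse of 2π times the divisor beyond the threshold s,
yet stays of order 1/s everywhere. Each derivative in p produces one factor D(divisor)/s, hence the
scale (m + 1)LM/s. -/
theorem derivBound_comp_divisor {m r : ℕ} {φ : ℝ → ℝ} {C : ℝ} (hφ : DerivBound r φ C 1)
    {H₀ : E m → ℝ} {M : ℝ} (hM : 1 ≤ M) (hH₀ : DerivBound (r + 1) H₀ M 1) {L : ℝ} (hL : 1 ≤ L)
    {s : ℝ} (hs : 0 < s) (hs1 : s ≤ 1) {k : Fin (m + 1) ⊕ Unit → ℤ}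
    (hk : ∀ j, ((|k j| : ℤ) : ℝ) ≤ L) :
    DerivBound r (fun p => s⁻¹ * φ (s⁻¹ * divisor H₀ k p)) (r.factorial * C / s)
      ((m + 1) * L * M / s) := by
  have hD := derivBound_divisor hH₀ hk
  have hs' : 1 ≤ s⁻¹ := (one_le_inv₀ hs).2 hs1
  have hΛ1 : 1 ≤ (m + 1) * L * M := by
    have : (1 : ℝ) ≤ m + 1 := by linarith [(Nat.cast_nonneg m : (0 : ℝ) ≤ m)]
    have h1 : 1 * 1 ≤ (m + 1) * L := mul_le_mul this hL zero_le_one (by positivity)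
    nlinarith
  set Λ := (m + 1) * L * M / s with hΛdef
  have hΛ : 1 ≤ Λ := by
    rw [hΛdef, div_eq_mul_inv]
    nlinarith
  have hf : ∀ p, s⁻¹ * divisor H₀ k p =
      s⁻¹ • (divisor H₀ k p - k (Sum.inr ())) + s⁻¹ * k (Sum.inr ()) := fun p => by
    simp only [smul_eq_mul]; ring
  have hD' := hD.const_smul s⁻¹
  have hc : ContDiff ℝ r fun p => s⁻¹ * divisor H₀ k p := by
    simp only [hf]
    exact hD'.1.add contDiff_const
  have h1 := hφ.comp (f := fun p => s⁻¹ * divisor H₀ k p) (Λ := Λ) hc (fun j h1 hj p => ?_)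
    (zero_le_one.trans hΛ)
  · have h2 := h1.const_smul s⁻¹
    refine DerivBound.mono_const h2 (le_of_eq ?_) (zero_le_one.trans hΛ)
    rw [abs_of_pos (inv_pos.2 hs)]
    field_simp
  · simp only [hf]
    rw [fun_iteratedFDeriv_add_apply (hD'.1.of_le (by exact_mod_cast hj)).contDiffAt
      contDiffAt_const, iteratedFDeriv_const_of_ne (by omega)]
    have h3 := hD'.2 j hj p
    rw [Pi.zero_apply, add_zero]
    rw [abs_of_pos (inv_pos.2 hs), one_pow, mul_one] at h3
    refine h3.trans (le_trans (le_of_eq ?_) (le_self_pow₀ hΛ (by omega)))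
    rw [hΛdef]; field_simp

/-- Solution of the homological equation for a mollification `S` of `W`, up to resonances. -/
theorem exists_homological_solution (m : ℕ) : ∃ C : ℝ, 1 ≤ C ∧ ∀ (M B s : ℝ) (L : ℕ)
    (H₀ : E m → ℝ) (W : X m → ℝ), 1 ≤ M → 0 < s → s ≤ 1 → 1 ≤ L →
    DerivBound 4 H₀ M 1 → DerivBound 4 W B 1 → PeriodicOn W univ →
    (∀ x, lineAverage (angleDir m (Sum.inl (Fin.last m))) (echar 0)
      (lineAverage (angleDir m (Sum.inr ())) (echar 0) fun x => (W x : ℂ)) x = 0) →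
    ∃ G S : X m → ℝ,
      DerivBound 3 G (C * B * (L : ℝ) ^ (m + 2) / s) ((m + 1) * L * M / s) ∧
      (∀ i, DerivBound 3 (fun x => fderiv ℝ G x (angleDir m (Sum.inl i)))
        (C * B * (L : ℝ) ^ (m + 2) / s) ((m + 1) * L * M / s)) ∧
      PeriodicOn G univ ∧
      DerivBound 3 (fun x => W x - S x) (C * B / √L) 1 ∧
      ∀ x, (∀ k : Fin (m + 1) ⊕ Unit → ℤ, (∀ j, |k j| ≤ L) →
          (k (Sum.inl (Fin.last m)) ≠ 0 ∨ k (Sum.inr ()) ≠ 0) → s ≤ |divisor H₀ k x.2.1|) →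
        ∑ i, fderiv ℝ H₀ x.2.1 (EuclideanSpace.single i 1) *
          fderiv ℝ G x (angleDir m (Sum.inl i)) + fderiv ℝ G x (angleDir m (Sum.inr ())) =
          - S x := by
  obtain ⟨φ, Cφ, hφ, hφ1⟩ := exists_smooth_inverse 3
  have hCφ := hφ.nonneg
  -- Here 48 = 2³ · 3!, from the Leibniz rule and the composition with φ, while 2(m + 2) collects
  -- the Fejér errors of the m + 2 directions.
  refine ⟨1 + 48 * Cφ + 2 * (m + 2), by linarith [(Nat.cast_nonneg m : (0 : ℝ) ≤ m)], ?_⟩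
  intro M B s L H₀ W hM hs hs1 hL hH₀ hW hWp hz
  have hB := hW.nonneg
  have hL1 : (1 : ℝ) ≤ L := by exact_mod_cast hL
  have hL0 : (0 : ℝ) < L := zero_lt_one.trans_le hL1
  have hWc : DerivBound 4 (fun x => (W x : ℂ)) B 1 :=
    hW.clm_of_le_one zero_le_one (L := Complex.ofRealCLM) (by simp)
  obtain ⟨ι, _, g, k, hg, hcard, hgp, hge, hk, hgz, -, hWS⟩ := exists_fourier_decomposition
    (norm_angleDir m) (angleDir_mem_range_deck m) (r := 3) hWc
    (by rintro u ⟨q, rfl⟩ x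
        simp only
        rw [hWp x (by simp [cyl]) q.1 q.2]) hL hz Finset.univ
  have hJ : (Finset.univ : Finset (Fin (m + 1) ⊕ Unit)).card = m + 2 := by
    simp
  rw [hJ] at hg hcard hWS
  set Λ := (m + 1) * L * M / s with hΛdef
  have hΛ : 1 ≤ Λ := by
    have h1 : (1 : ℝ) ≤ m + 1 := by linarith [(Nat.cast_nonneg m : (0 : ℝ) ≤ m)]
    rw [hΛdef, le_div_iff₀ hs, one_mul]
    refine hs1.trans ?_
    have : 1 * 1 ≤ (m + 1) * (L : ℝ) := mul_le_mul h1 hL1 zero_le_one (by positivity)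
    nlinarith
  have h0 : 0 ≤ Λ := zero_le_one.trans hΛ
  let ψ : ι → X m → ℝ := fun i x => s⁻¹ * φ (s⁻¹ * divisor H₀ (k i) x.2.1)
  have hψ : ∀ i, DerivBound 3 (ψ i) (6 * Cφ / s) Λ := fun i => by
    have h1 := (derivBound_comp_divisor hφ hM hH₀ hL1 hs hs1 (k := k i)
      fun j => by exact_mod_cast hk i j).comp_clm (momentum m) (norm_momentum_le m)
    exact h1
  have hψd : ∀ i x j, fderiv ℝ (ψ i) x (angleDir m j) = 0 := by
    intro i x j
    have h1 := derivBound_comp_divisor hφ hM hH₀ hL1 hs hs1 (k := k i)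
      fun j => by exact_mod_cast hk i j
    have h2 := ((h1.1.differentiable (by simp) x.2.1).hasFDerivAt.comp x
      (momentum m).hasFDerivAt).fderiv
    rw [show ψ i = (fun p => s⁻¹ * φ (s⁻¹ * divisor H₀ (k i) p)) ∘ momentum m from rfl, h2]
    simp [angleDir_momentum]
  -- Differentiating an eigenfunction multiplies it by −2πi k, so the imaginary part has derivative
  -- −2πk times the real part. This gives a real G whose equation has right-hand side −Σ Re gᵢ.
  let γ : ι → X m → ℝ := fun i x => (g i x).im
  have hγ : ∀ i, DerivBound 4 (γ i) (B / (L : ℝ) ^ (m + 2)) 1 := fun i =>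
    (hg i).clm_of_le_one zero_le_one (L := Complex.imCLM) (by simp)
  have hγd : ∀ i x j, fderiv ℝ (γ i) x (angleDir m j) = -(2 * Real.pi * k i j * (g i x).re) := by
    intro i x j
    have hd : DifferentiableAt ℝ (g i) x := (hg i).1.differentiable (by simp) x
    have h1 : fderiv ℝ (γ i) x = Complex.imCLM.comp (fderiv ℝ (g i) x) :=
      (Complex.imCLM.hasFDerivAt.comp x hd.hasFDerivAt).fderiv
    rw [h1, ContinuousLinearMap.comp_apply,
      fderiv_apply_of_translate hd fun a => hge i j (Finset.mem_univ j) a x]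
    simp
  have hbound : ∀ f : ι → X m → ℝ, (∀ i, DerivBound 3 (f i) (B / (L : ℝ) ^ (m + 2)) 1) →
      DerivBound 3 (fun x => ∑ i, ψ i x * f i x)
        ((1 + 48 * Cφ + 2 * (m + 2)) * B * (L : ℝ) ^ (m + 2) / s) Λ := by
    intro f hf
    have h1 := DerivBound.sum Finset.univ h0 fun i (_ : i ∈ Finset.univ) =>
      (hψ i).bilin ((hf i).mono le_rfl zero_le_one hΛ) h0 (ContinuousLinearMap.mul ℝ ℝ)
        (ContinuousLinearMap.opNorm_mul_le ℝ ℝ)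
    refine DerivBound.mono_const h1 ?_ h0
    -- There are L^(2(m+2)) components, each bounded by B L^(-(m+2)): their sum costs L^(m+2).
    rw [Finset.sum_const, Finset.card_univ, hcard, nsmul_eq_mul, pow_mul, pow_two, mul_pow]
    push_cast
    have : (L : ℝ) ^ (m + 2) * (L : ℝ) ^ (m + 2) *
        (2 ^ 3 * (6 * Cφ / s * (B / (L : ℝ) ^ (m + 2)))) =
        48 * Cφ * (B * (L : ℝ) ^ (m + 2) / s) := by
      field_simp; ring
    have hX : 0 ≤ B * (L : ℝ) ^ (m + 2) / s := by positivity
    rw [this, mul_assoc (1 + 48 * Cφ + 2 * ((m : ℝ) + 2)),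
      mul_div_assoc (1 + 48 * Cφ + 2 * ((m : ℝ) + 2))]
    refine mul_le_mul_of_nonneg_right ?_ hX
    linarith [(Nat.cast_nonneg m : (0 : ℝ) ≤ m)]
  let G : X m → ℝ := fun x => ∑ i, ψ i x * γ i x
  have hGd : ∀ x j, fderiv ℝ G x (angleDir m j) =
      ∑ i, ψ i x * fderiv ℝ (γ i) x (angleDir m j) := by
    intro x j
    have h1 : HasFDerivAt G (∑ i, (ψ i x • fderiv ℝ (γ i) x + γ i x • fderiv ℝ (ψ i) x)) x :=
      HasFDerivAt.fun_sum fun i _ =>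
        ((hψ i).1.differentiable (by simp) x).hasFDerivAt.mul
          ((hγ i).1.differentiable (by simp) x).hasFDerivAt
    rw [h1.fderiv, _root_.sum_apply]
    simp [hψd]
  refine ⟨G, fun x => ∑ i, (g i x).re, ?_, fun i => ?_, fun x _ q l => ?_, ?_, fun x hx => ?_⟩
  · exact hbound γ fun i => (hγ i).mono_order (by norm_num)
  · simp only [hGd]
    refine hbound _ fun i' => ?_
    have h1 := ((hγ i').fderiv (r := 3)).clm_of_le_one zero_le_one
      (L := ContinuousLinearMap.apply ℝ ℝ (angleDir m (Sum.inl i)))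
      (ContinuousLinearMap.opNorm_le_bound _ zero_le_one fun T => by
        rw [one_mul]
        exact (T.le_opNorm _).trans (mul_le_of_le_one_right (norm_nonneg _) (norm_angleDir m _)))
    simpa using h1
  · have hp : (x + deck q l).2.1 = x.2.1 := by simp [deck]
    simp only [G, ψ, γ, hp]
    refine Finset.sum_congr rfl fun i _ => ?_
    rw [hgp i _ ⟨(q, l), rfl⟩ x]
  · have h1 := hWS.clm_of_le_one zero_le_one (L := Complex.reCLM) (by simp)
    simp only [Complex.reCLM_apply, Complex.sub_re, Complex.ofReal_re, Complex.re_sum] at h1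
    refine h1.mono_const ?_ zero_le_one
    rw [mul_div_assoc, mul_div_assoc, ← mul_assoc]
    refine mul_le_mul_of_nonneg_right ?_ (by positivity)
    push_cast
    linarith
  · simp only [hGd, Finset.mul_sum]
    rw [Finset.sum_comm, ← Finset.sum_add_distrib, ← Finset.sum_neg_distrib]
    refine Finset.sum_congr rfl fun i _ => ?_
    by_cases hki : k i (Sum.inl (Fin.last m)) ≠ 0 ∨ k i (Sum.inr ()) ≠ 0
    · have h1 := hx (k i) (hk i) hki
      have h2 := hφ1 (s⁻¹ * divisor H₀ (k i) x.2.1) (by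
        rw [abs_mul, abs_of_pos (inv_pos.2 hs), inv_mul_eq_div, le_div_iff₀ hs, one_mul]
        exact h1)
      have h3 : ∑ j, fderiv ℝ H₀ x.2.1 (EuclideanSpace.single j 1) *
          (ψ i x * fderiv ℝ (γ i) x (angleDir m (Sum.inl j))) +
          ψ i x * fderiv ℝ (γ i) x (angleDir m (Sum.inr ())) =
          -(ψ i x * (2 * Real.pi) * divisor H₀ (k i) x.2.1) * (g i x).re := by
        simp only [hγd, divisor, mul_add, Finset.mul_sum, neg_add, add_mul, Finset.sum_mul,
          ← Finset.sum_neg_distrib]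
        congr 1
        · refine Finset.sum_congr rfl fun j _ => ?_
          ring
        · ring
      rw [h3]
      simp only [ψ]
      linear_combination (-(g i x).re) * h2
    · push Not at hki
      -- A harmonic independent of the fast angle and of time equals its own average over them,
      -- which vanishes.
      have hinv : ∀ j, k i j = 0 → ∀ (a : ℝ) x, g i (x + a • angleDir m j) = g i x := by
        intro j hj a x
        rw [hge i j (Finset.mem_univ j), hj]
        simp
      have hzero : g i x = 0 := by
        have := hgz i x
        rwa [lineAverage_zero_of_invariant (hinv _ hki.2),
          lineAverage_zero_of_invariant (hinv _ hki.1)] at this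
      simp [hγd, hzero]

/-! ### Inverting a perturbation of the identity. -/

section Inverse

variable {V : Type*} [NormedAddCommGroup V] [NormedSpace ℝ V]

theorem injective_id_add_of_norm_fderiv_lt_one {κ : V → V} {σ : ℝ} (hd : Differentiable ℝ κ)
    (hσ : ∀ x, ‖fderiv ℝ κ x‖ ≤ σ) (h1 : σ < 1) : Function.Injective fun x => x + κ x := by
  intro x y hxy
  simp only at hxy
  have h := norm_increment_le hd hσ y (x - y)
  rw [add_sub_cancel, show κ x - κ y = y - x by
    rw [sub_eq_sub_iff_add_eq_add, add_comm, hxy, add_comm], norm_sub_rev] at h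
  have h0 : ‖x - y‖ = 0 := by nlinarith [norm_nonneg (x - y)]
  exact sub_eq_zero.1 (norm_eq_zero.1 h0)

/-- A perturbation of the identity with small derivatives is a diffeomorphism, and its inverse is
a perturbation of the identity with small derivatives. -/
theorem exists_inverse_id_add [CompleteSpace V] {η : V → V} {q : ℝ} (hη : DerivBound 2 η q 1)
    (hq : q ≤ 1 / 2) : ∃ ζ : V → V, DerivBound 2 ζ (8 * q) 1 ∧ (∀ y, ζ y = -η (y + ζ y)) ∧
      ∀ x, ζ (x + η x) = -η x := by
  have hq0 := hη.nonneg
  have hηd : Differentiable ℝ η := hη.1.differentiable (by simp)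
  have hη1 : DerivBound 1 (fderiv ℝ η) q 1 := by simpa using hη.fderiv
  have hηn : ∀ x, ‖fderiv ℝ η x‖ ≤ q := hη1.norm_le
  have hηdd : Differentiable ℝ (fderiv ℝ η) := hη1.1.differentiable (by simp)
  have hηnn : ∀ x, ‖fderiv ℝ (fderiv ℝ η) x‖ ≤ q := fun x => by
    simpa using hη1.norm_fderiv_le x
  -- As η is 1/2-Lipschitz, the map is within 1/2 of the identity as a linear approximation, which
  -- yields a global homeomorphism.
  have happ : ApproximatesLinearOn (fun x => x + η x)
      ((ContinuousLinearEquiv.refl ℝ V : V ≃L[ℝ] V) : V →L[ℝ] V) univ (1 / 2) := by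
    intro x _ y _
    have h := norm_increment_le hηd hηn y (x - y)
    rw [add_sub_cancel] at h
    have e : x + η x - (y + η y) - ((ContinuousLinearEquiv.refl ℝ V : V ≃L[ℝ] V) : V →L[ℝ] V)
        (x - y) = η x - η y := by
      simp only [ContinuousLinearEquiv.coe_refl, ContinuousLinearMap.id_apply]
      abel
    rw [e]
    refine h.trans (mul_le_mul_of_nonneg_right ?_ (norm_nonneg _))
    simpa using hq
  have hc : Subsingleton V ∨ (1 / 2 : ℝ≥0) <
      ‖((ContinuousLinearEquiv.refl ℝ V : V ≃L[ℝ] V).symm : V →L[ℝ] V)‖₊⁻¹ := by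
    rcases subsingleton_or_nontrivial V with h | h
    · exact Or.inl h
    · right
      have : ‖((ContinuousLinearEquiv.refl ℝ V : V ≃L[ℝ] V).symm : V →L[ℝ] V)‖₊ = 1 := by
        ext
        exact ContinuousLinearMap.norm_id
      rw [this, inv_one]
      exact NNReal.half_lt_self one_ne_zero
  let h : V ≃ₜ V := happ.toHomeomorph _ hc
  have hh : ∀ x, h x = x + η x := fun x => rfl
  have hunit : ∀ x, IsUnit (1 - -fderiv ℝ η x) := fun x =>
    isUnit_one_sub_of_norm_lt_one (by rw [norm_neg]; linarith [hηn x])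
  have hsymm : ContDiff ℝ 2 h.symm := by
    refine h.contDiff_symm (f₀' := fun x => ContinuousLinearEquiv.ofUnit (hunit x).unit)
      (fun x => ?_) (contDiff_id.add hη.1)
    have e : ((ContinuousLinearEquiv.ofUnit (hunit x).unit : V ≃L[ℝ] V) : V →L[ℝ] V) =
        ContinuousLinearMap.id ℝ V + fderiv ℝ η x := by
      ext v
      change (1 - -fderiv ℝ η x) v = _
      simp
    rw [e]
    exact (hasFDerivAt_id x).add (hηd x).hasFDerivAt
  let ζ : V → V := fun y => h.symm y - y
  have hinv : ∀ y, y + ζ y = h.symm y := fun y => by simp [ζ]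
  have hζ1 : ∀ y, ζ y = -η (y + ζ y) := fun y => by
    have := hh (h.symm y)
    rw [h.apply_symm_apply] at this
    rw [hinv]
    simp only [ζ]
    rw [eq_neg_iff_add_eq_zero]
    nth_rewrite 2 [this]
    abel
  have hζ2 : ∀ x, ζ (x + η x) = -η x := fun x => by
    simp only [ζ, ← hh, h.symm_apply_apply]
    rw [hh]; abel
  have hζc : ContDiff ℝ 2 ζ := hsymm.sub contDiff_id
  have hζd : Differentiable ℝ ζ := hζc.differentiable (by simp)
  have hζdd : Differentiable ℝ (fderiv ℝ ζ) :=
    (hζc.fderiv_right (m := 1) (by norm_num)).differentiable (by simp)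
  have hD1 : ∀ y, fderiv ℝ ζ y =
      -((fderiv ℝ η (y + ζ y)).comp (ContinuousLinearMap.id ℝ V + fderiv ℝ ζ y)) := by
    intro y
    have h1 := (hasFDerivAt_comp_id_add hηd (hζd y)).neg
    rw [show (-fun x => η (x + ζ x)) = ζ from funext fun y => (hζ1 y).symm] at h1
    exact h1.fderiv
  have hidn : ‖ContinuousLinearMap.id ℝ V‖ ≤ 1 := ContinuousLinearMap.norm_id_le
  have hsum : ∀ y, ‖ContinuousLinearMap.id ℝ V + fderiv ℝ ζ y‖ ≤ 1 + ‖fderiv ℝ ζ y‖ := fun y =>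
    (norm_add_le _ _).trans (by linarith)
  have hb1 : ∀ y, ‖fderiv ℝ ζ y‖ ≤ 2 * q := by
    intro y
    have h1 : ‖fderiv ℝ ζ y‖ ≤ q * (1 + ‖fderiv ℝ ζ y‖) := by
      nth_rewrite 1 [hD1 y]
      rw [norm_neg]
      exact (ContinuousLinearMap.opNorm_comp_le _ _).trans
        (mul_le_mul (hηn _) (hsum y) (norm_nonneg _) hq0)
    nlinarith [norm_nonneg (fderiv ℝ ζ y)]
  have hb2 : ∀ y, ‖fderiv ℝ (fderiv ℝ ζ) y‖ ≤ 8 * q := by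
    intro y
    let T := ContinuousLinearMap.compL ℝ V V V
    have hT : ‖T‖ ≤ 1 := ContinuousLinearMap.norm_compL_le ℝ V V V
    have h1 := (hasFDerivAt_comp_id_add hηdd (hζd y))
    have h2 : HasFDerivAt (fun y => ContinuousLinearMap.id ℝ V + fderiv ℝ ζ y)
        (fderiv ℝ (fderiv ℝ ζ) y) y := (hζdd y).hasFDerivAt.const_add _
    have h3 := (T.hasFDerivAt_of_bilinear h1 h2).neg
    have e : (-fun y => T (fderiv ℝ η (y + ζ y)) (ContinuousLinearMap.id ℝ V + fderiv ℝ ζ y)) =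
        fderiv ℝ ζ := by
      ext1 y
      exact (hD1 y).symm
    rw [e] at h3
    have hs2 : ‖ContinuousLinearMap.id ℝ V + fderiv ℝ ζ y‖ ≤ 2 :=
      (hsum y).trans (by linarith [hb1 y])
    have hn := norm_nonneg (fderiv ℝ (fderiv ℝ ζ) y)
    -- Differentiating twice the relation ζ = −η ∘ (id + ζ); since q ≤ 1/2 the first term is
    -- absorbed on the left, leaving 8q.
    have h4 : ‖fderiv ℝ (fderiv ℝ ζ) y‖ ≤ q * ‖fderiv ℝ (fderiv ℝ ζ) y‖ + q * 2 * 2 := by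
      nth_rewrite 1 [h3.fderiv]
      rw [norm_neg]
      refine (norm_add_le _ _).trans (add_le_add ?_ ?_)
      · refine (ContinuousLinearMap.le_opNorm₂ _ _ _).trans ?_
        refine mul_le_mul_of_nonneg_right ?_ hn
        refine (mul_le_mul (ContinuousLinearMap.norm_precompR_le V T) (hηn _) (norm_nonneg _)
          (norm_nonneg _)).trans ?_
        nlinarith [norm_nonneg T]
      · refine (ContinuousLinearMap.le_opNorm₂ _ _ _).trans ?_
        refine mul_le_mul ?_ hs2 (norm_nonneg _) (by positivity)
        have h5 : ‖(fderiv ℝ (fderiv ℝ η) (y + ζ y)).comp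
            (ContinuousLinearMap.id ℝ V + fderiv ℝ ζ y)‖ ≤ q * 2 :=
          (ContinuousLinearMap.opNorm_comp_le _ _).trans
            (mul_le_mul (hηnn _) hs2 (norm_nonneg _) hq0)
        refine (mul_le_mul (ContinuousLinearMap.norm_precompL_le V T) h5 (norm_nonneg _)
          (norm_nonneg _)).trans ?_
        nlinarith [norm_nonneg T]
    nlinarith
  refine ⟨ζ, ⟨hζc, fun j hj y => ?_⟩, hζ1, hζ2⟩
  rw [one_pow, mul_one]
  interval_cases j
  · rw [norm_iteratedFDeriv_zero, hζ1 y, norm_neg]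
    linarith [hη.norm_le (y + ζ y)]
  · rw [norm_iteratedFDeriv_one]
    linarith [hb1 y]
  · rw [← norm_iteratedFDeriv_fderiv, norm_iteratedFDeriv_one]
    exact hb2 y

end Inverse

/-! ### Canonical transformations from generating functions. -/

/-- The directions of the momenta. -/
def momDir (m : ℕ) (i : Fin (m + 1)) : X m := (0, EuclideanSpace.single i 1, 0)

theorem norm_momDir (m : ℕ) (i : Fin (m + 1)) : ‖momDir m i‖ ≤ 1 := by
  simp [momDir, Prod.norm_def]

/-- The vector of `ℝⁿ` whose coordinates are the values of a linear form on given vectors. -/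
def partialGrad {m : ℕ} (b : Fin (m + 1) → X m) : (X m →L[ℝ] ℝ) →L[ℝ] E m :=
  ∑ i, (ContinuousLinearMap.apply ℝ ℝ (b i)).smulRight (EuclideanSpace.single i 1)

theorem partialGrad_apply {m : ℕ} (b : Fin (m + 1) → X m) (T : X m →L[ℝ] ℝ) :
    partialGrad b T = ∑ i, T (b i) • (EuclideanSpace.single i 1 : E m) := by
  rw [partialGrad, _root_.sum_apply]
  rfl

theorem norm_apply_le_of_norm_le_one {V : Type*} [NormedAddCommGroup V] [NormedSpace ℝ V] {v : V}
    (hv : ‖v‖ ≤ 1) : ‖ContinuousLinearMap.apply ℝ ℝ v‖ ≤ 1 :=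
  ContinuousLinearMap.opNorm_le_bound _ zero_le_one fun T => by
    rw [one_mul]
    exact (T.le_opNorm _).trans (mul_le_of_le_one_right (norm_nonneg _) hv)

theorem norm_partialGrad_le {m : ℕ} {b : Fin (m + 1) → X m} (hb : ∀ i, ‖b i‖ ≤ 1) :
    ‖partialGrad b‖ ≤ m + 1 := by
  refine ContinuousLinearMap.opNorm_le_bound _ (by positivity) fun T => ?_
  rw [partialGrad_apply]
  refine (norm_sum_le _ _).trans ((Finset.sum_le_sum fun i _ => ?_ :
    _ ≤ ∑ _i : Fin (m + 1), ‖T‖).trans ?_)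
  · rw [norm_smul, PiLp.norm_single, norm_one, mul_one]
    exact (T.le_opNorm _).trans (mul_le_of_le_one_right (norm_nonneg _) (hb i))
  · simp

theorem inner_partialGrad {m : ℕ} (b : Fin (m + 1) → X m) (T : X m →L[ℝ] ℝ) (u : E m) :
    inner ℝ u (partialGrad b T) = T (∑ i, u i • b i) := by
  rw [partialGrad_apply, inner_sum, map_sum]
  refine Finset.sum_congr rfl fun i _ => ?_
  rw [inner_smul_right, EuclideanSpace.inner_single_right, map_smul]
  simp [mul_comm]

theorem sum_smul_single {m : ℕ} (u : E m) :
    ∑ i, u i • (EuclideanSpace.single i 1 : E m) = u := by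
  simpa using (EuclideanSpace.basisFun (Fin (m + 1)) ℝ).sum_repr u

theorem sum_smul_angleDir {m : ℕ} (u : E m) :
    ∑ i, u i • angleDir m (Sum.inl i) = (u, 0, 0) := by
  have h : ∀ i, angleDir m (Sum.inl i) = ContinuousLinearMap.inl ℝ (E m) (E m × ℝ)
      (EuclideanSpace.single i 1) := fun i => rfl
  simp only [h, ← map_smul, ← map_sum, sum_smul_single]
  rfl

theorem sum_smul_momDir {m : ℕ} (u : E m) : ∑ i, u i • momDir m i = (0, u, 0) := by
  have h : ∀ i, momDir m i = ((ContinuousLinearMap.inr ℝ (E m) (E m × ℝ)).comp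
      (ContinuousLinearMap.inl ℝ (E m) ℝ)) (EuclideanSpace.single i 1) := fun i => rfl
  simp only [h, ← map_smul, ← map_sum, sum_smul_single]
  rfl

/-- The map `T ↦ (∂_p T, 0, 0)`. -/
def angleShift (m : ℕ) : (X m →L[ℝ] ℝ) →L[ℝ] X m :=
  (ContinuousLinearMap.inl ℝ (E m) (E m × ℝ)).comp (partialGrad (momDir m))

/-- The map `T ↦ (0, ∂_θ T, 0)`. -/
def momentumShift (m : ℕ) : (X m →L[ℝ] ℝ) →L[ℝ] X m :=
  ((ContinuousLinearMap.inr ℝ (E m) (E m × ℝ)).comp (ContinuousLinearMap.inl ℝ (E m) ℝ)).comp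
    (partialGrad fun i => angleDir m (Sum.inl i))

theorem angleShift_apply {m : ℕ} (T : X m →L[ℝ] ℝ) :
    angleShift m T = (partialGrad (momDir m) T, 0, 0) := rfl

theorem momentumShift_apply {m : ℕ} (T : X m →L[ℝ] ℝ) :
    momentumShift m T = (0, partialGrad (fun i => angleDir m (Sum.inl i)) T, 0) := rfl

theorem norm_angleShift_le (m : ℕ) : ‖angleShift m‖ ≤ m + 1 := by
  refine (ContinuousLinearMap.opNorm_comp_le _ _).trans
    ((mul_le_of_le_one_left (norm_nonneg _) ?_).trans (norm_partialGrad_le (norm_momDir m)))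
  exact ContinuousLinearMap.norm_inl_le_one ℝ _ _

/-- The infinitesimal form of the generating function method. In the mixed variables (θ, P, t), v
and w are tangent vectors and T, T' their images under the Hessian of g. The old and new coordinates
pull the symplectic form back to forms differing by T w − T' v, zero by symmetry. -/
theorem symplForm_generating {m : ℕ} {T T' : X m →L[ℝ] ℝ} {v w : X m} {a b : ℝ}
    (h : T w = T' v) :
    symplForm (v + momentumShift m T, a + T (angleDir m (Sum.inr ())))
        (w + momentumShift m T', b + T' (angleDir m (Sum.inr ()))) =
      symplForm (v + angleShift m T, a) (w + angleShift m T', b) := by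
  have dec : ∀ (S : X m →L[ℝ] ℝ) (u : X m), S u = S (u.1, 0, 0) + S (0, u.2.1, 0) +
      u.2.2 * S (angleDir m (Sum.inr ())) := by
    intro S u
    rw [← smul_eq_mul, ← map_smul, ← map_add, ← map_add]
    congr 1
    simp [angleDir]
  have e1 := dec T w
  have e2 := dec T' v
  simp only [symplForm, angleShift_apply, momentumShift_apply, Prod.fst_add, Prod.snd_add,
    inner_add_left, inner_add_right, add_zero]
  rw [real_inner_comm (w.1) (partialGrad _ T), real_inner_comm w.2.1 (partialGrad _ T)]
  simp only [inner_partialGrad, sum_smul_angleDir, sum_smul_momDir]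
  linear_combination e1 - e2 - h

theorem uniqueDiffOn_cyl_B (m : ℕ) : UniqueDiffOn ℝ (cyl (B m)) :=
  uniqueDiffOn_univ.prod ((uniqueDiffOn_convex (convex_closedBall _ _) (by
    rw [interior_closedBall _ one_ne_zero]
    exact ⟨0, by simp⟩)).prod uniqueDiffOn_univ)

theorem fderiv_periodic {V F : Type*} [NormedAddCommGroup V] [NormedSpace ℝ V]
    [NormedAddCommGroup F] [NormedSpace ℝ F] {g : V → F} {u : V} (h : ∀ x, g (x + u) = g x)
    (x : V) : fderiv ℝ g (x + u) = fderiv ℝ g x := by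
  rw [← fderiv_comp_add_right]
  simp only [h]

/-- The canonical transformation with generating function `θ · P + g(θ, P, t)`. -/
theorem isCoordChange_generating {m : ℕ} {U : Set (E m)} {ρ : ℝ}
    (hρ : ∀ p ∈ B m, ∀ v : E m, ‖v‖ ≤ ρ → p + v ∈ U) {g : X m → ℝ} (hg : ContDiff ℝ 3 g)
    (hgp : PeriodicOn g univ) {ζ : X m → X m} (hζ : ContDiff ℝ 2 ζ)
    (hζ1 : ∀ y, ζ y = -angleShift m (fderiv ℝ g (y + ζ y)))
    (hζ2 : ∀ x, ζ (x + angleShift m (fderiv ℝ g x)) = -angleShift m (fderiv ℝ g x))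
    {Φ : X m → X m} (hΦ : ∀ y, Φ y = y + (ζ y + momentumShift m (fderiv ℝ g (y + ζ y))))
    (hΦρ : ∀ y, ‖Φ y - y‖ ≤ ρ) (hΦi : Function.Injective Φ) {f : X m → ℝ}
    (hf : ∀ y, f y = fderiv ℝ g (y + ζ y) (angleDir m (Sum.inr ()))) :
    IsCoordChange Φ f (B m) U := by
  have hg1 : ContDiff ℝ 2 (fderiv ℝ g) := hg.fderiv_right (by norm_num)
  have hinv : ContDiff ℝ 2 fun y => y + ζ y := contDiff_id.add hζ
  have hgi : ContDiff ℝ 2 fun y => fderiv ℝ g (y + ζ y) := hg1.comp hinv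
  have hΦc : ContDiff ℝ 2 Φ := by
    rw [show Φ = _ from funext hΦ]
    exact contDiff_id.add (hζ.add ((momentumShift m).contDiff.comp hgi))
  have hfc : ContDiff ℝ 2 f := by
    rw [show f = _ from funext hf]
    exact (ContinuousLinearMap.apply ℝ ℝ (angleDir m (Sum.inr ()))).contDiff.comp hgi
  have hzero : ∀ y, (ζ y).2 = 0 := fun y => by rw [hζ1, angleShift_apply]; simp
  have hg2 : ∀ (x u : X m), (∀ x, g (x + u) = g x) → fderiv ℝ g (x + u) = fderiv ℝ g x :=
    fun x u h => fderiv_periodic h x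
  have hper : ∀ (k : Fin (m + 1) → ℤ) (l : ℤ) x, g (x + deck k l) = g x := fun k l x =>
    hgp x (by simp [cyl]) k l
  have hζp : ∀ (k : Fin (m + 1) → ℤ) (l : ℤ) y, ζ (y + deck k l) = ζ y := by
    intro k l y
    -- Periodicity of ζ follows from uniqueness of preimages: the translate of y is the image, under
    -- the map being inverted, of the translate of y + ζ(y).
    have h1 : y + deck k l = (y + ζ y + deck k l) +
        angleShift m (fderiv ℝ g (y + ζ y + deck k l)) := by
      rw [hg2 _ _ (hper k l), ← neg_neg (angleShift m _), ← hζ1 y]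
      abel
    rw [h1, hζ2, hg2 _ _ (hper k l), ← hζ1]
  have hgip : ∀ (k : Fin (m + 1) → ℤ) (l : ℤ) y,
      fderiv ℝ g (y + deck k l + ζ (y + deck k l)) = fderiv ℝ g (y + ζ y) := by
    intro k l y
    rw [hζp, add_right_comm, hg2 _ _ (hper k l)]
  refine ⟨hΦc.contDiffOn, hfc.contDiffOn, fun y hy => ?_, hΦi.injOn, fun y _ k l => ?_,
    fun y _ k l => ?_, fun y _ => ?_, fun z hz v w => ?_⟩
  · refine ⟨mem_univ _, ?_, mem_univ _⟩
    have h1 := hρ y.2.1 hy.2.1 ((Φ y - y).2.1)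
      (((norm_fst_le _).trans (norm_snd_le _)).trans (hΦρ y))
    simpa using h1
  · simp only
    rw [hΦ, hΦ, hgip, hζp]
    abel
  · simp only [hf, hgip]
  · simp [hΦ, hzero, momentumShift_apply]
  · have hDD : HasFDerivAt (fderiv ℝ g) (fderiv ℝ (fderiv ℝ g) (z.1 + ζ z.1)) (z.1 + ζ z.1) :=
      (hg1.differentiable (by simp) _).hasFDerivAt
    set D2 := fderiv ℝ (fderiv ℝ g) (z.1 + ζ z.1) with hD2
    set A : X m →L[ℝ] X m := ContinuousLinearMap.id ℝ (X m) + fderiv ℝ ζ z.1 with hA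
    have hζd : HasFDerivAt ζ (fderiv ℝ ζ z.1) z.1 := (hζ.differentiable (by simp) _).hasFDerivAt
    have hid : HasFDerivAt (fun y => y + ζ y) A z.1 := (hasFDerivAt_id z.1).add hζd
    have hgd : HasFDerivAt (fun y => fderiv ℝ g (y + ζ y)) (D2.comp A) z.1 := hDD.comp z.1 hid
    -- A is the derivative of the passage to mixed variables; differentiating the implicit equation
    -- for ζ shows that it inverts the linearized angle change.
    have hrel : ∀ v, A v + angleShift m (D2 (A v)) = v := by
      intro v
      have h1 : HasFDerivAt ζ (-((angleShift m).comp (D2.comp A))) z.1 := by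
        have h2 := ((angleShift m).hasFDerivAt.comp z.1 hgd).neg
        exact h2.congr_of_eventuallyEq (Eventually.of_forall hζ1)
      have h3 := hζd.unique h1
      rw [hA, _root_.add_apply, ContinuousLinearMap.id_apply]
      nth_rewrite 1 [h3]
      simp [hA]
      abel
    have hΦd : HasFDerivAt Φ (A + (momentumShift m).comp (D2.comp A)) z.1 := by
      have h1 := hid.add ((momentumShift m).hasFDerivAt.comp z.1 hgd)
      refine h1.congr_of_eventuallyEq (Eventually.of_forall fun y => ?_)
      simp [hΦ, add_assoc]
    have hfd : HasFDerivAt f ((ContinuousLinearMap.apply ℝ ℝ (angleDir m (Sum.inr ()))).comp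
        (D2.comp A)) z.1 := by
      have h1 := (ContinuousLinearMap.apply ℝ ℝ (angleDir m (Sum.inr ()))).hasFDerivAt.comp z.1 hgd
      exact h1.congr_of_eventuallyEq (Eventually.of_forall hf)
    have hfst : HasFDerivAt (Prod.fst : X m × ℝ → X m) (ContinuousLinearMap.fst ℝ (X m) ℝ) z :=
      hasFDerivAt_fst
    have hext : HasFDerivAt (extendMap Φ f)
        (((A + (momentumShift m).comp (D2.comp A)).comp (ContinuousLinearMap.fst ℝ (X m) ℝ)).prod
          (ContinuousLinearMap.snd ℝ (X m) ℝ +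
            ((ContinuousLinearMap.apply ℝ ℝ (angleDir m (Sum.inr ()))).comp (D2.comp A)).comp
              (ContinuousLinearMap.fst ℝ (X m) ℝ))) z :=
      (hΦd.comp z hfst).prodMk (hasFDerivAt_snd.add (hfd.comp z hfst))
    have huniq : UniqueDiffWithinAt ℝ (cyl (B m) ×ˢ univ : Set (X m × ℝ)) z :=
      ((uniqueDiffOn_cyl_B m).prod uniqueDiffOn_univ) z hz
    rw [hext.hasFDerivWithinAt.fderivWithin huniq]
    have hsymm : D2 (A v.1) (A w.1) = D2 (A w.1) (A v.1) :=
      (hg.contDiffAt.isSymmSndFDerivAt (by simp; norm_cast)).eq _ _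
    have key := symplForm_generating (a := v.2) (b := w.2) hsymm
    rw [hrel, hrel] at key
    exact key

/-! ### The averaging step with quantitative estimates. -/

/-- Expand H₀ to second order and H₁ to order zero along the momentum displacement. The terms of
order ε are ∇H₀·∂_θ G + ∂_t G + H₁, and the homological equation turns them into Z + (H₁ − Z − S).
The map and all bounds are global; only the final identity needs the equation at the momentum of y.
-/
theorem exists_coordChange_of_homological (m : ℕ) : ∃ C : ℝ, 1 ≤ C ∧
    ∀ (M B A Λ ε μ ρ : ℝ) (U : Set (E m)) (H₀ : E m → ℝ) (H₁ Z G S : X m → ℝ),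
    DerivBound 4 H₀ M 1 → DerivBound 4 H₁ B 1 → DerivBound 4 Z B 1 →
    DerivBound 3 G A Λ → (∀ i, DerivBound 3 (fun x => fderiv ℝ G x (angleDir m (Sum.inl i))) A Λ) →
    PeriodicOn G univ → DerivBound 3 (fun x => H₁ x - Z x - S x) μ 1 → 1 ≤ Λ → 0 < ε →
    C * (ε * A * Λ ^ 3) ≤ 1 → C * (ε * A * Λ) ≤ ρ →
    (∀ p ∈ NearlyIntegrable.B m, ∀ v : E m, ‖v‖ ≤ ρ → p + v ∈ U) →
    ∃ (Φ : X m → X m) (f R : X m → ℝ), IsCoordChange Φ f (NearlyIntegrable.B m) U ∧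
      (∀ y, ‖(Φ y - y, f y)‖ ≤ C * (ε * A * Λ)) ∧
      DerivBound 2 (fun y => (Φ y - y, f y)) (C * (ε * A * Λ ^ 3)) 1 ∧
      DerivBound 2 R (C * (μ + B * (ε * A * Λ ^ 3) + M * ((ε * A * Λ) ^ 2 / ε))) 1 ∧
      ∀ y, (∀ x : X m, x.2.1 = y.2.1 →
          ∑ i, fderiv ℝ H₀ x.2.1 (EuclideanSpace.single i 1) *
            fderiv ℝ G x (angleDir m (Sum.inl i)) + fderiv ℝ G x (angleDir m (Sum.inr ())) =
            - S x) →
        H₀ (Φ y).2.1 + ε * H₁ (Φ y) + f y = H₀ y.2.1 + ε * Z y + ε * R y := by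
  obtain ⟨CΔ, hCΔ, hΔ⟩ := exists_derivBound_increment (V := X m) 2
  obtain ⟨CQ, hCQ, hQ⟩ := exists_derivBound_increment_sub_fderiv (V := X m) 2
  have hn : (1 : ℝ) ≤ m + 1 := by linarith [(Nat.cast_nonneg m : (0 : ℝ) ≤ m)]
  set n : ℝ := m + 1 with hndef
  -- The factor 8 = 2² · 2! comes from composing with id + ζ. The term 32n makes the displacement a
  -- contraction, and 16 CΔ n covers the increments of both H₁ and Z.
  refine ⟨32 * n + 16 * CΔ * n + 8 * CQ * n ^ 2 + 8, by
    have h1 := mul_nonneg hCΔ (zero_le_one.trans hn)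
    have h2 := mul_nonneg hCQ (sq_nonneg n)
    linarith, ?_⟩
  set C := 32 * n + 16 * CΔ * n + 8 * CQ * n ^ 2 + 8 with hC
  have hCn : 0 ≤ CΔ * n := by positivity
  have hCn2 : 0 ≤ CQ * n ^ 2 := by positivity
  have hC1 : 32 * n ≤ C := by rw [hC]; linarith
  intro M B A Λ ε μ ρ U H₀ H₁ Z G S hH₀ hH₁ hZ hG hGθ hGp hμ hΛ hε hsmall hρsmall hρ
  have h0 : 0 ≤ Λ := zero_le_one.trans hΛ
  have hA := hG.nonneg
  have hB := hH₁.nonneg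
  have hM := hH₀.nonneg
  set a := ε * A with ha
  have ha0 : 0 ≤ a := by positivity
  have hΛ3 : 1 ≤ Λ ^ 3 := one_le_pow₀ hΛ
  have hΛ2 : 1 ≤ Λ ^ 2 := one_le_pow₀ hΛ
  have haΛ : a ≤ a * Λ := le_mul_of_one_le_right ha0 hΛ
  have haΛ2 : a * Λ ≤ a * Λ ^ 3 := by
    have : Λ ≤ Λ ^ 3 := le_self_pow₀ hΛ (by norm_num)
    exact mul_le_mul_of_nonneg_left this ha0
  have haΛ3 : a * Λ ^ 2 ≤ a * Λ ^ 3 :=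
    mul_le_mul_of_nonneg_left (pow_le_pow_right₀ hΛ (by norm_num)) ha0
  have hna : 32 * (n * (a * Λ ^ 3)) ≤ 1 := by
    have : 32 * n * (a * Λ ^ 3) ≤ C * (a * Λ ^ 3) := mul_le_mul_of_nonneg_right hC1 (by positivity)
    linarith
  let g : X m → ℝ := fun x => ε * G x
  have hg : DerivBound 3 g a Λ := by
    have := hG.const_smul ε
    rwa [abs_of_pos hε] at this
  have hgd : ∀ x, fderiv ℝ g x = ε • fderiv ℝ G x := fun x =>
    fderiv_const_mul (hG.1.differentiable (by simp) x) ε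
  have hg1 : DerivBound 2 (fderiv ℝ g) (a * Λ) Λ := hg.fderiv
  let η : X m → X m := fun x => angleShift m (fderiv ℝ g x)
  let ξ : X m → X m := fun x => momentumShift m (fderiv ℝ g x)
  let τ : X m → ℝ := fun x => fderiv ℝ g x (angleDir m (Sum.inr ()))
  have hη' : DerivBound 2 η (n * (a * Λ)) Λ :=
    (hg1.clm (angleShift m)).mono_const
      (mul_le_mul_of_nonneg_right (norm_angleShift_le m) (by positivity)) h0
  have hη : DerivBound 2 η (n * (a * Λ ^ 3)) 1 :=
    (hη'.of_le_one hΛ).mono_const (le_of_eq (by ring)) zero_le_one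
  have hτ : DerivBound 2 τ (a * Λ ^ 3) 1 :=
    ((hg1.clm_of_le_one h0 (norm_apply_le_of_norm_le_one
      (norm_angleDir m (Sum.inr ())))).of_le_one hΛ).mono_const (le_of_eq (by ring)) zero_le_one
  -- The separate bounds on θ-derivatives of G save a factor Λ here. Without it the quadratic
  -- remainder of H₀ would involve ε/s⁶ instead of ε/s⁴.
  have hξ : DerivBound 2 ξ (n * a) Λ := by
    have h1 := DerivBound.sum (r := 2) (Λ := Λ) (Finset.univ : Finset (Fin (m + 1)))
      (f := fun i x => ContinuousLinearMap.toSpanSingleton ℝ (momDir m i)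
        (ε • fderiv ℝ G x (angleDir m (Sum.inl i)))) (A := fun _ => a) h0 fun i _ => ?_
    · have e : ξ = fun x => ∑ i, ContinuousLinearMap.toSpanSingleton ℝ (momDir m i)
          (ε • fderiv ℝ G x (angleDir m (Sum.inl i))) := by
        ext1 x
        simp only [ξ, momentumShift_apply, hgd]
        have := sum_smul_momDir (partialGrad (fun i => angleDir m (Sum.inl i)) (ε • fderiv ℝ G x))
        rw [← this]
        refine Finset.sum_congr rfl fun i _ => ?_
        rw [ContinuousLinearMap.toSpanSingleton_apply, partialGrad_apply]
        congr 1
        simp [Pi.single_apply]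
      rw [e]
      exact h1.mono_const (by simp [hndef]) h0
    · have h2 := (((hGθ i).mono_order (by norm_num : 2 ≤ 3)).const_smul ε).clm_of_le_one h0
        (L := ContinuousLinearMap.toSpanSingleton ℝ (momDir m i))
        (by rw [ContinuousLinearMap.norm_toSpanSingleton]; exact norm_momDir m i)
      rwa [abs_of_pos hε] at h2
  have hξ' : DerivBound 2 ξ (n * (a * Λ ^ 2)) 1 :=
    (hξ.of_le_one hΛ).mono_const (le_of_eq (by ring)) zero_le_one
  obtain ⟨ζ, hζ, hζ1, hζ2⟩ := exists_inverse_id_add hη (by linarith)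
  have hζ8 : 8 * (n * (a * Λ ^ 3)) ≤ 1 := by
    have : 0 ≤ n * (a * Λ ^ 3) := by positivity
    linarith
  let κ : X m → X m := fun y => ζ y + ξ (y + ζ y)
  have hκ : DerivBound 2 κ (16 * (n * (a * Λ ^ 3))) 1 := by
    refine (hζ.add (hξ'.comp_id_add hζ hζ8 le_rfl)).mono_const ?_ zero_le_one
    have : n * (a * Λ ^ 2) ≤ n * (a * Λ ^ 3) := mul_le_mul_of_nonneg_left haΛ3 (by positivity)
    norm_num [Nat.factorial]
    linarith
  let Φ : X m → X m := fun y => y + κ y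
  let f : X m → ℝ := fun y => τ (y + ζ y)
  have hf : DerivBound 2 f (8 * (a * Λ ^ 3)) 1 := by
    refine (hτ.comp_id_add hζ hζ8 le_rfl).mono_const ?_ zero_le_one
    norm_num [Nat.factorial]
    linarith
  have hΦsub : ∀ y, Φ y - y = κ y := fun y => add_sub_cancel_left y (κ y)
  have hκn : ∀ y, ‖κ y‖ ≤ C * (a * Λ) := by
    intro y
    have h1 : ‖ζ y‖ ≤ n * (a * Λ) := by
      rw [hζ1, norm_neg]
      exact hη'.norm_le _
    have h2 : ‖ξ (y + ζ y)‖ ≤ n * a := hξ.norm_le _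
    have h3 : n * a ≤ n * (a * Λ) := mul_le_mul_of_nonneg_left haΛ (by positivity)
    have h4 : 32 * n * (a * Λ) ≤ C * (a * Λ) := mul_le_mul_of_nonneg_right hC1 (by positivity)
    have h5 : 0 ≤ n * (a * Λ) := by positivity
    refine (norm_add_le _ _).trans ?_
    linarith
  have hfn : ∀ y, ‖f y‖ ≤ C * (a * Λ) := by
    intro y
    have h1 : ‖f y‖ ≤ a * Λ := by
      refine ((fderiv ℝ g (y + ζ y)).le_opNorm _).trans ?_
      refine (mul_le_of_le_one_right (norm_nonneg _) (norm_angleDir m _)).trans (hg1.norm_le _)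
    have h4 : 32 * n * (a * Λ) ≤ C * (a * Λ) := mul_le_mul_of_nonneg_right hC1 (by positivity)
    have h5 : 1 * (a * Λ) ≤ n * (a * Λ) := mul_le_mul_of_nonneg_right hn (by positivity)
    have h6 : 0 ≤ a * Λ := by positivity
    linarith
  have hΦi : Function.Injective Φ :=
    injective_id_add_of_norm_fderiv_lt_one (hκ.1.differentiable (by simp))
      (fun y => (hκ.mono_order (by norm_num : 1 ≤ 2)).norm_fderiv_le y) (by linarith)
  have hcc : IsCoordChange Φ f (NearlyIntegrable.B m) U :=
    isCoordChange_generating hρ hg.1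
      (fun x hx k l => by simp only [g, hGp x hx k l]) hζ.1 hζ1 hζ2 (fun y => rfl)
      (fun y => by rw [hΦsub]; exact (hκn y).trans hρsmall) hΦi fun y => rfl
  let F : X m → ℝ := fun x => H₀ x.2.1
  have hF : DerivBound 4 F M 1 := hH₀.comp_clm (momentum m) (norm_momentum_le m)
  have hna1 : n * a ≤ 1 := by
    have : n * a ≤ n * (a * Λ ^ 3) :=
      mul_le_mul_of_nonneg_left (haΛ.trans haΛ2) (by positivity)
    linarith
  -- The remainder in mixed variables; `R` below transports it to the new angles, where Z must also
  -- be re-evaluated.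
  let T : X m → ℝ := fun x => ε⁻¹ * (F (x + ξ x) - F x - fderiv ℝ F x (ξ x)) +
    (H₁ (x + ξ x) - H₁ x) + (H₁ x - Z x - S x)
  have hT : DerivBound 2 T (ε⁻¹ * (CQ * (M * (n * a) ^ 2)) * Λ ^ 2 +
      CΔ * (B * (n * a)) * Λ ^ 2 + μ) 1 := by
    have h1 := ((hQ hF hξ hna1 hΛ).const_smul ε⁻¹).of_le_one hΛ
    rw [abs_of_pos (inv_pos.2 hε)] at h1
    have h2 := (hΔ (hH₁.mono_order (by norm_num)) hξ hna1 hΛ).of_le_one hΛ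
    exact (h1.add h2).add (hμ.mono_order (by norm_num))
  let R : X m → ℝ := fun y => T (y + ζ y) + (Z (y + ζ y) - Z y)
  have hR : DerivBound 2 R (C * (μ + B * (a * Λ ^ 3) + M * ((a * Λ) ^ 2 / ε))) 1 := by
    have h1 := hT.comp_id_add hζ hζ8 le_rfl
    have h2 := hΔ (hZ.mono_order (by norm_num : 3 ≤ 4)) hζ hζ8 le_rfl
    refine (h1.add h2).mono_const ?_ zero_le_one
    norm_num [Nat.factorial]
    have hμ0 := hμ.nonneg
    have e1 : ε⁻¹ * (CQ * (M * (n * a) ^ 2)) * Λ ^ 2 =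
        CQ * n ^ 2 * (M * ((a * Λ) ^ 2 / ε)) := by field_simp
    have e2 : CΔ * (B * (n * a)) * Λ ^ 2 ≤ CΔ * n * (B * (a * Λ ^ 3)) := by
      rw [show CΔ * (B * (n * a)) * Λ ^ 2 = CΔ * n * (B * (a * Λ ^ 2)) by ring]
      gcongr
    have e3 : CΔ * (B * (8 * (n * (a * Λ ^ 3)))) = 8 * (CΔ * n * (B * (a * Λ ^ 3))) := by ring
    have p1 : 0 ≤ B * (a * Λ ^ 3) := by positivity
    have p2 : 0 ≤ M * ((a * Λ) ^ 2 / ε) := by positivity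
    have k1 : 8 * μ ≤ C * μ := mul_le_mul_of_nonneg_right (by rw [hC]; linarith) hμ0
    have k2 : (16 * CΔ * n) * (B * (a * Λ ^ 3)) ≤ C * (B * (a * Λ ^ 3)) :=
      mul_le_mul_of_nonneg_right (by rw [hC]; linarith) p1
    have k3 : (8 * CQ * n ^ 2) * (M * ((a * Λ) ^ 2 / ε)) ≤ C * (M * ((a * Λ) ^ 2 / ε)) :=
      mul_le_mul_of_nonneg_right (by rw [hC]; linarith) p2
    rw [e1, e3]
    linarith
  refine ⟨Φ, f, R, hcc, fun y => ?_, ?_, hR, fun y hy => ?_⟩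
  · rw [hΦsub, Prod.norm_def]
    exact max_le (hκn y) (hfn y)
  · have h1 := (hκ.clm_of_le_one zero_le_one (ContinuousLinearMap.norm_inl_le_one ℝ (X m) ℝ)).add
      (hf.clm_of_le_one zero_le_one (ContinuousLinearMap.norm_inr_le_one ℝ (X m) ℝ))
    have e : (fun y => (Φ y - y, f y)) = fun y => ContinuousLinearMap.inl ℝ (X m) ℝ (κ y) +
        ContinuousLinearMap.inr ℝ (X m) ℝ (f y) := by
      ext1 y
      simp [hΦsub]
    rw [e]
    refine h1.mono_const ?_ zero_le_one
    have k1 : 32 * n * (a * Λ ^ 3) ≤ C * (a * Λ ^ 3) :=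
      mul_le_mul_of_nonneg_right hC1 (by positivity)
    have k2 : 1 * (a * Λ ^ 3) ≤ n * (a * Λ ^ 3) := mul_le_mul_of_nonneg_right hn (by positivity)
    have k3 : 0 ≤ a * Λ ^ 3 := by positivity
    linarith
  · set x := y + ζ y with hx
    have hxp : x.2.1 = y.2.1 := by
      have : (ζ y).2 = 0 := by rw [hζ1]; simp [η, angleShift_apply]
      simp [hx, this]
    have hΦx : Φ y = x + ξ x := by simp only [Φ, κ, hx]; abel
    have hFd : fderiv ℝ F x (ξ x) = ε * ∑ i, fderiv ℝ H₀ x.2.1 (EuclideanSpace.single i 1) *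
        fderiv ℝ G x (angleDir m (Sum.inl i)) := by
      have h1 : fderiv ℝ F x = (fderiv ℝ H₀ x.2.1).comp (momentum m) :=
        ((hH₀.1.differentiable (by simp) x.2.1).hasFDerivAt.comp x
          (momentum m).hasFDerivAt).fderiv
      rw [h1, ContinuousLinearMap.comp_apply]
      simp only [ξ, momentumShift_apply, momentum_apply, partialGrad_apply, map_sum, map_smul, hgd]
      rw [Finset.mul_sum, Finset.smul_sum]
      refine Finset.sum_congr rfl fun i _ => ?_
      simp only [smul_eq_mul]
      ring
    have hfd : f y = ε * fderiv ℝ G x (angleDir m (Sum.inr ())) := by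
      simp only [f, τ, ← hx, hgd]
      simp
    have hhom := hy x hxp
    have hFx : F x = H₀ y.2.1 := by simp only [F, hxp]
    have hRy : ε * R y = (F (x + ξ x) - F x - fderiv ℝ F x (ξ x)) +
        ε * ((H₁ (x + ξ x) - H₁ x) + (H₁ x - Z x - S x) + (Z x - Z y)) := by
      simp only [R, T, ← hx]
      field_simp
      ring
    rw [hRy, hFd, hfd, hΦx, ← hFx]
    change F (x + ξ x) + _ + _ = _
    linear_combination ε * hhom

/-! ### Coordinate C^r norms, operator norms and cutoffs. -/

section Norms

variable {V F ι : Type*} [NormedAddCommGroup V] [NormedSpace ℝ V] [NormedAddCommGroup F]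
  [NormedSpace ℝ F]

/-- Equality near each point of S within D is required, because derivatives are taken within D and S
may be thin. -/
theorem cNorm_le_of_derivBound {b : ι → V} (hb : ∀ i, ‖b i‖ ≤ 1) {r : ℕ} {D S : Set V}
    (hD : UniqueDiffOn ℝ D) (hS : S ⊆ D) {f h : V → F} {A : ℝ} (hh : DerivBound r h A 1)
    (hfh : ∀ x ∈ S, f =ᶠ[𝓝[D] x] h) : cNorm b r D S f ≤ ENNReal.ofReal A := by
  refine iSup_le fun k => iSup_le fun hk => iSup_le fun x => iSup_le fun hx => iSup_le fun j => ?_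
  have hk' : (k : WithTop ℕ∞) ≤ r := by exact_mod_cast hk
  rw [(hfh x hx).iteratedFDerivWithin_eq ((hfh x hx).self_of_nhdsWithin (hS hx)),
    iteratedFDerivWithin_eq_iteratedFDeriv hD (hh.1.of_le hk').contDiffAt (hS hx),
    ← ofReal_norm]
  refine ENNReal.ofReal_le_ofReal ?_
  refine ((iteratedFDeriv ℝ k h x).le_opNorm _).trans ?_
  have h1 := hh.2 k hk x
  rw [one_pow, mul_one] at h1
  exact (mul_le_of_le_one_right (norm_nonneg _)
    (Finset.prod_le_one (fun _ _ => norm_nonneg _) fun i _ => hb (j i))).trans h1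

/-- Expanding every argument in coordinates writes T as a sum of (card ι)^k terms, which converts
bounds on partial derivatives into operator norm bounds. -/
theorem norm_multilinear_le_of_coordinates [Fintype ι] {b : ι → V} {l : ι → V → ℝ}
    (hl : ∀ i v, |l i v| ≤ ‖v‖) (hlb : ∀ v, ∑ i, l i v • b i = v) {k : ℕ} (T : V [×k]→L[ℝ] F)
    {C : ℝ} (hT : ∀ j : Fin k → ι, ‖T fun a => b (j a)‖ ≤ C) (hC : 0 ≤ C) :
    ‖T‖ ≤ (Fintype.card ι : ℝ) ^ k * C := by
  classical
  refine ContinuousMultilinearMap.opNorm_le_bound (by positivity) fun v => ?_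
  have h1 : T v = ∑ j : Fin k → ι, (∏ a, l (j a) (v a)) • T fun a => b (j a) := by
    have h2 : v = fun a => ∑ i, l i (v a) • b i := funext fun a => (hlb (v a)).symm
    conv_lhs => rw [h2]
    rw [ContinuousMultilinearMap.map_sum]
    refine Finset.sum_congr rfl fun j _ => ?_
    exact T.map_smul_univ (fun a => l (j a) (v a)) fun a => b (j a)
  rw [h1]
  refine (norm_sum_le _ _).trans ((Finset.sum_le_sum fun j _ =>
    (?_ : _ ≤ C * ∏ a, ‖v a‖)).trans (le_of_eq ?_))
  · rw [norm_smul, mul_comm, norm_prod]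
    exact mul_le_mul (hT j) (Finset.prod_le_prod (fun _ _ => norm_nonneg _) fun a _ => hl _ _)
      (Finset.prod_nonneg fun _ _ => norm_nonneg _) hC
  · simp; ring

theorem norm_iteratedFDerivWithin_le_of_cNorm_le [Fintype ι] {b : ι → V} {l : ι → V → ℝ}
    (hl : ∀ i v, |l i v| ≤ ‖v‖) (hlb : ∀ v, ∑ i, l i v • b i = v) (hι : 1 ≤ Fintype.card ι)
    {r : ℕ} {D : Set V} {f : V → F} {M : ℝ≥0} (h : cNorm b r D D f ≤ M) {k : ℕ} (hk : k ≤ r)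
    {x : V} (hx : x ∈ D) :
    ‖iteratedFDerivWithin ℝ k f D x‖ ≤ (Fintype.card ι : ℝ) ^ r * M := by
  refine (norm_multilinear_le_of_coordinates hl hlb (C := M) _ (fun j => ?_) M.2).trans ?_
  · have h1 : ‖iteratedFDerivWithin ℝ k f D x fun i => b (j i)‖ₑ ≤ M := by
      refine le_trans ?_ h
      exact le_iSup_of_le k (le_iSup_of_le hk (le_iSup_of_le x (le_iSup_of_le hx
        (le_iSup_of_le j le_rfl))))
    rw [enorm_eq_nnnorm, ENNReal.coe_le_coe] at h1
    exact h1
  · exact mul_le_mul_of_nonneg_right (pow_le_pow_right₀ (by exact_mod_cast hι) hk) M.2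

theorem exists_derivBound_of_hasCompactSupport {r : ℕ} {f : V → F} (hf : ContDiff ℝ r f)
    (hs : HasCompactSupport f) : ∃ C, DerivBound r f C 1 := by
  have h : ∀ j ≤ r, ∃ C, ∀ x, ‖iteratedFDeriv ℝ j f x‖ ≤ C := fun j hj =>
    (hs.iteratedFDeriv j).exists_bound_of_continuous
      (hf.continuous_iteratedFDeriv (by exact_mod_cast hj))
  choose! C hC using h
  have hC0 : ∀ j ≤ r, 0 ≤ C j := fun j hj => (norm_nonneg _).trans (hC j hj 0)
  refine ⟨∑ j ∈ Finset.range (r + 1), C j, hf, fun j hj x => ?_⟩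
  rw [one_pow, mul_one]
  exact (hC j hj x).trans (Finset.single_le_sum (f := C)
    (fun i hi => hC0 i (by simpa [Nat.lt_succ_iff] using hi)) (by simpa [Nat.lt_succ_iff] using hj))

/-- Inside Ω this is the Leibniz rule; at a point outside, the product vanishes in a neighbourhood
because the support of χ lies in Ω. -/
theorem derivBound_cutoff_mul {r : ℕ} {Ω : Set V} (hΩ : IsOpen Ω) {χ f : V → ℝ} {C M : ℝ}
    (hχ : DerivBound r χ C 1) (hs : tsupport χ ⊆ Ω) (hf : ContDiffOn ℝ r f Ω)
    (hM : 0 ≤ M) (hfM : ∀ j ≤ r, ∀ x ∈ Ω, ‖iteratedFDerivWithin ℝ j f Ω x‖ ≤ M) :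
    DerivBound r (fun x => χ x * f x) (2 ^ r * (C * M)) 1 := by
  have hz : ∀ x ∉ Ω, (fun x => χ x * f x) =ᶠ[𝓝 x] fun _ => 0 := fun x hx => by
    have h1 : χ =ᶠ[𝓝 x] 0 := notMem_tsupport_iff_eventuallyEq.1 fun h => hx (hs h)
    filter_upwards [h1] with y hy
    simp [hy]
  have hC := hχ.nonneg
  refine ⟨contDiff_iff_contDiffAt.2 fun x => ?_, fun j hj x => ?_⟩
  · by_cases hx : x ∈ Ω
    · exact hχ.1.contDiffAt.mul (hf.contDiffAt (hΩ.mem_nhds hx))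
    · exact contDiffAt_const.congr_of_eventuallyEq (hz x hx)
  · rw [one_pow, mul_one]
    by_cases hx : x ∈ Ω
    · have hj' : (j : WithTop ℕ∞) ≤ r := by exact_mod_cast hj
      rw [← iteratedFDerivWithin_of_isOpen j hΩ hx]
      refine (norm_iteratedFDerivWithin_mul_le hχ.1.contDiffOn hf hΩ.uniqueDiffOn hx hj').trans ?_
      have h2 : (∑ i ∈ Finset.range (j + 1), (j.choose i : ℝ)) = 2 ^ j := by
        exact_mod_cast Nat.sum_range_choose j
      refine (Finset.sum_le_sum fun i hi => (?_ : _ ≤ (j.choose i : ℝ) * (C * M))).trans ?_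
      · have hij : i ≤ j := by simpa [Nat.lt_succ_iff] using hi
        rw [mul_assoc]
        refine mul_le_mul_of_nonneg_left ?_ (Nat.cast_nonneg _)
        have h1 := hχ.2 i (hij.trans hj) x
        rw [one_pow, mul_one] at h1
        rw [iteratedFDerivWithin_of_isOpen i hΩ hx]
        exact mul_le_mul h1 (hfM (j - i) (by omega) x hx) (norm_nonneg _) hC
      · rw [← Finset.sum_mul, h2]
        exact mul_le_mul_of_nonneg_right (pow_le_pow_right₀ one_le_two hj) (by positivity)
    · rw [(Filter.EventuallyEq.iteratedFDeriv ℝ (hz x hx) j).eq_of_nhds]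
      have : iteratedFDeriv ℝ j (fun _ : V => (0 : ℝ)) x = 0 := by simp
      rw [this, norm_zero]
      positivity

end Norms

theorem norm_dirX_le (m : ℕ) (i) : ‖dirX m i‖ ≤ 1 := by
  rcases i with i | i | i <;> simp [dirX, Prod.norm_def]

/-- The coordinates with respect to `dirX m`. -/
def coordX (m : ℕ) : Fin (m + 1) ⊕ Fin (m + 1) ⊕ Unit → X m → ℝ
  | Sum.inl i => fun x => x.1 i
  | Sum.inr (Sum.inl i) => fun x => x.2.1 i
  | Sum.inr (Sum.inr _) => fun x => x.2.2

theorem abs_coordX_le (m : ℕ) (i) (x : X m) : |coordX m i x| ≤ ‖x‖ := by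
  rcases i with i | i | i
  · exact (PiLp.norm_apply_le x.1 i).trans (norm_fst_le x)
  · exact (PiLp.norm_apply_le x.2.1 i).trans ((norm_fst_le x.2).trans (norm_snd_le x))
  · exact (norm_snd_le x.2).trans (norm_snd_le x)

theorem sum_coordX (m : ℕ) (x : X m) : ∑ i, coordX m i x • dirX m i = x := by
  have h1 := sum_smul_angleDir x.1
  have h2 := sum_smul_momDir x.2.1
  simp only [angleDir, momDir] at h1 h2
  simp only [Fintype.sum_sum_type, coordX, dirX, h1, h2]
  ext <;> simp

/-! ### The average over the fast angle and time. -/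

/-- The average over the fast angle and the time. -/
def fastAverage {m : ℕ} (H : X m → ℝ) (x : X m) : ℝ :=
  ∫ a in (0 : ℝ)..1, ∫ t in (0 : ℝ)..1,
    H (x + a • angleDir m (Sum.inl (Fin.last m)) + t • angleDir m (Sum.inr ()))

section FastAverage

variable {m : ℕ} {H : X m → ℝ}

theorem lineAverage_eq_fastAverage (H : X m → ℝ) :
    lineAverage (angleDir m (Sum.inl (Fin.last m))) (echar 0)
      (lineAverage (angleDir m (Sum.inr ())) (echar 0) fun x => (H x : ℂ)) =
      fun x => (fastAverage H x : ℂ) := by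
  ext x
  simp only [lineAverage, fastAverage, echar_zero_left, one_mul, intervalIntegral.integral_ofReal]

theorem derivBound_fastAverage {r : ℕ} {B : ℝ} (hH : DerivBound r H B 1) :
    DerivBound r (fastAverage H) B 1 := by
  have hHc : DerivBound r (fun x => (H x : ℂ)) B 1 :=
    hH.clm_of_le_one zero_le_one (L := Complex.ofRealCLM) (by simp)
  have h1 := ((hHc.lineAverage_echar (angleDir m (Sum.inr ())) 0).lineAverage_echar
    (angleDir m (Sum.inl (Fin.last m))) 0).clm_of_le_one zero_le_one (L := Complex.reCLM) (by simp)
  rw [lineAverage_eq_fastAverage] at h1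
  simpa using h1

theorem fastAverage_translate {u : X m} (h : ∀ x, H (x + u) = H x) (x : X m) :
    fastAverage H (x + u) = fastAverage H x := by
  simp only [fastAverage, add_right_comm x u, add_right_comm _ u, h]

/-- The average is invariant under real translations in both directions, hence equal to its own
average. -/
theorem lineAverage_sub_fastAverage (hH : Continuous H) (hZ : Continuous (fastAverage H))
    (h1 : ∀ x, H (x + angleDir m (Sum.inl (Fin.last m))) = H x)
    (h2 : ∀ x, H (x + angleDir m (Sum.inr ())) = H x) (x : X m) :
    lineAverage (angleDir m (Sum.inl (Fin.last m))) (echar 0)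
      (lineAverage (angleDir m (Sum.inr ())) (echar 0)
        fun x => ((H x - fastAverage H x : ℝ) : ℂ)) x = 0 := by
  set v₁ := angleDir m (Sum.inl (Fin.last m))
  set v₂ := angleDir m (Sum.inr ())
  let Hc : X m → ℂ := fun x => (H x : ℂ)
  let Zc : X m → ℂ := fun x => (fastAverage H x : ℂ)
  have hZc : lineAverage v₁ (echar 0) (lineAverage v₂ (echar 0) Hc) = Zc :=
    lineAverage_eq_fastAverage H
  have hHcc : Continuous Hc := Complex.continuous_ofReal.comp hH
  have hZcc : Continuous Zc := Complex.continuous_ofReal.comp hZ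
  have hHc1 : ∀ x, Hc (x + v₁) = Hc x := fun x => by simp only [Hc, h1]
  have hHc2 : ∀ x, Hc (x + v₂) = Hc x := fun x => by simp only [Hc, h2]
  have hZ1 : ∀ (a : ℝ) x, Zc (x + a • v₁) = Zc x := fun a x => by
    rw [← hZc]
    have := lineAverage_echar_translate (g := lineAverage v₂ (echar 0) Hc) (v := v₁)
      (fun x => by simpa using lineAverage_translate (c := 1) (by simpa using hHc1) v₂ (echar 0) x)
      0 x a
    simpa using this
  have hZ2 : ∀ (a : ℝ) x, Zc (x + a • v₂) = Zc x := fun a x => by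
    rw [← hZc]
    have := lineAverage_translate (g := lineAverage v₂ (echar 0) Hc) (u := a • v₂) (c := 1)
      (fun x => by simpa using lineAverage_echar_translate hHc2 0 x a) v₁ (echar 0) x
    simpa using this
  have hsub : ∀ (v : X m) {f g : X m → ℂ}, Continuous f → Continuous g →
      lineAverage v (echar 0) (fun x => f x - g x) =
        fun x => lineAverage v (echar 0) f x - lineAverage v (echar 0) g x := by
    intro v f g hf hg
    ext x
    simp only [lineAverage, echar_zero_left, one_mul]
    exact intervalIntegral.integral_sub (Continuous.intervalIntegrable (by fun_prop) _ _)
      (Continuous.intervalIntegrable (by fun_prop) _ _)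
  have e : (fun x => ((H x - fastAverage H x : ℝ) : ℂ)) = fun x => Hc x - Zc x := by
    ext x; simp [Hc, Zc]
  have hc2 : Continuous (lineAverage v₂ (echar 0) Hc) := by
    refine intervalIntegral.continuous_parametric_intervalIntegral_of_continuous' ?_ 0 1
    have := continuous_echar 0
    simp only [Function.uncurry_def]
    fun_prop
  rw [e, hsub v₂ hHcc hZcc, lineAverage_zero_of_invariant hZ2, hsub v₁ hc2 hZcc,
    lineAverage_zero_of_invariant hZ1, hZc]
  exact sub_self _

end FastAverage

/-! ### Lower bounds for the divisors near the nonresonant set. -/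

theorem gradient_apply_eq_fderiv {m : ℕ} {H : E m → ℝ} (p : E m) (i : Fin (m + 1)) :
    (∇ H p) i = fderiv ℝ H p (EuclideanSpace.single i 1) := by
  have h1 : inner ℝ (∇ H p) (EuclideanSpace.single i 1 : E m) =
      fderiv ℝ H p (EuclideanSpace.single i 1) := by
    rw [gradient, InnerProductSpace.toDual_symm_apply]
  rw [← h1, EuclideanSpace.inner_single_right]
  simp

/-- At p the fast part is at least 3Ks and the slow part at most mLs ≤ Ks, leaving 2Ks > K₀s. The
strict margin and the finiteness of the set of frequencies extend the bound to a neighbourhood,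
which is needed to control derivatives of the remainder. -/
theorem eventually_le_abs_divisor {m : ℕ} {H₀ : E m → ℝ} (hH₀ : ContDiff ℝ 1 H₀) {K K₀ s : ℝ}
    {L : ℕ} (hL : 1 ≤ L) (hs : 0 < s) (hLK : (m + 1) * (L : ℝ) ≤ K₀) (hK : K₀ ≤ K) {p : E m}
    (hp : p ∈ nonresonant H₀ K s) :
    ∀ᶠ q in 𝓝 p, ∀ k : Fin (m + 1) ⊕ Unit → ℤ, (∀ j, |k j| ≤ L) →
      (k (Sum.inl (Fin.last m)) ≠ 0 ∨ k (Sum.inr ()) ≠ 0) → K₀ * s ≤ |divisor H₀ k q| := by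
  obtain ⟨-, hslow, hres⟩ := hp
  have hL1 : (1 : ℝ) ≤ L := by exact_mod_cast hL
  have hm : (0 : ℝ) ≤ m := Nat.cast_nonneg m
  have hfin : {k : Fin (m + 1) ⊕ Unit → ℤ | ∀ j, |k j| ≤ L}.Finite := by
    refine (Set.finite_Icc (fun _ => -(L : ℤ)) fun _ => (L : ℤ)).subset fun k hk => ?_
    exact ⟨fun j => (abs_le.1 (hk j)).1, fun j => (abs_le.1 (hk j)).2⟩
  have key : ∀ k ∈ {k : Fin (m + 1) ⊕ Unit → ℤ | ∀ j, |k j| ≤ L}, ∀ᶠ q in 𝓝 p,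
      (k (Sum.inl (Fin.last m)) ≠ 0 ∨ k (Sum.inr ()) ≠ 0) → K₀ * s ≤ |divisor H₀ k q| := by
    intro k hk
    by_cases hne : k (Sum.inl (Fin.last m)) ≠ 0 ∨ k (Sum.inr ()) ≠ 0
    swap
    · exact Eventually.of_forall fun q h => absurd h hne
    have hcont : Continuous fun q => |divisor H₀ k q| := by
      have := hH₀.continuous_fderiv (by norm_num)
      unfold divisor
      fun_prop
    have hlt : K₀ * s < |divisor H₀ k p| := by
      have hpos : 0 < max |k (Sum.inl (Fin.last m))| |k (Sum.inr ())| := by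
        rcases hne with h | h
        · exact lt_max_of_lt_left (abs_pos.2 h)
        · exact lt_max_of_lt_right (abs_pos.2 h)
      have hmax : ((max |k (Sum.inl (Fin.last m))| |k (Sum.inr ())| : ℤ) : ℝ) ≤ K := by
        have : ((max |k (Sum.inl (Fin.last m))| |k (Sum.inr ())| : ℤ) : ℝ) ≤ L := by
          exact_mod_cast max_le (hk _) (hk _)
        nlinarith
      have h1 := hres _ _ hpos hmax
      rw [gradient_apply_eq_fderiv] at h1
      have h2 : |∑ i : Fin m, (k (Sum.inl i.castSucc) : ℝ) *
          fderiv ℝ H₀ p (EuclideanSpace.single i.castSucc 1)| ≤ m * (L * s) := by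
        refine (Finset.abs_sum_le_sum_abs _ _).trans
          ((Finset.sum_le_sum fun i _ => (?_ : _ ≤ L * s)).trans (by simp))
        rw [abs_mul]
        refine mul_le_mul (by exact_mod_cast hk _) ?_ (abs_nonneg _) (by positivity)
        rw [← gradient_apply_eq_fderiv]
        exact (PiLp.norm_apply_le (slow (∇ H₀ p)) i).trans hslow
      have h3 : divisor H₀ k p = ∑ i : Fin m, (k (Sum.inl i.castSucc) : ℝ) *
          fderiv ℝ H₀ p (EuclideanSpace.single i.castSucc 1) +
          ((k (Sum.inl (Fin.last m)) : ℝ) * fderiv ℝ H₀ p (EuclideanSpace.single (Fin.last m) 1) +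
            k (Sum.inr ())) := by
        rw [divisor, Fin.sum_univ_castSucc, add_assoc]
      set a := ∑ i : Fin m, (k (Sum.inl i.castSucc) : ℝ) *
          fderiv ℝ H₀ p (EuclideanSpace.single i.castSucc 1)
      set b := (k (Sum.inl (Fin.last m)) : ℝ) *
        fderiv ℝ H₀ p (EuclideanSpace.single (Fin.last m) 1) + k (Sum.inr ())
      have h4 : |b| ≤ |a + b| + |a| := by
        calc |b| = |(a + b) - a| := by ring_nf
          _ ≤ |a + b| + |a| := abs_sub _ _
      rw [h3]
      have h5 : m * (L * s) ≤ K₀ * s := by nlinarith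
      have h6 : K₀ * s ≤ K * s := mul_le_mul_of_nonneg_right hK hs.le
      have h7 : 0 < K * s := mul_pos (by nlinarith) hs
      linarith
    filter_upwards [hcont.continuousAt.eventually (lt_mem_nhds hlt)] with q hq _
    exact hq.le
  filter_upwards [(Filter.eventually_all_finite hfin).2 key] with q hq k hk hne
  exact hq k hk hne

/-! ### Choice of the scales and of the constant c. -/

/-- The relation between the scales of the problem. -/
theorem scale_relation {m : ℕ} {c δ ε s : ℝ} (hc : 0 < c) (hδ : 0 < δ) (hε : 0 < ε)
    (hs : s = c * δ ^ (-2 : ℤ) * (c * δ ^ (-1 - ((m + 1 : ℕ) : ℤ)) * ε ^ (1 / 4 : ℝ))) :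
    ε / s ^ 4 = δ ^ (4 * m + 16) / c ^ 8 := by
  have h1 : (ε ^ (1 / 4 : ℝ)) ^ 4 = ε := by
    rw [← Real.rpow_natCast, ← Real.rpow_mul hε.le]
    norm_num
  have h2 : s = c ^ 2 * (ε ^ (1 / 4 : ℝ)) / δ ^ (m + 4) := by
    have e : δ ^ (-2 : ℤ) * δ ^ (-1 - ((m + 1 : ℕ) : ℤ)) = (δ ^ (m + 4))⁻¹ := by
      rw [← zpow_add₀ hδ.ne', ← zpow_natCast, ← zpow_neg]
      congr 1
      push_cast
      ring
    have e' : ∀ u v w : ℝ, c * u * (c * v * w) = c ^ 2 * w * (u * v) := fun u v w => by ring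
    rw [hs, e', e]
    rfl
  rw [h2, div_pow, mul_pow, h1]
  field_simp
  ring

/-- Both quantities contain exactly ε/s⁴, with L^(m+5) and L^(2m+6). Since Lδ² is bounded, δ^(4m+16)
pays for these powers of L and leaves δ^(2m+6) and δ⁴ respectively. -/
theorem small_quantities {m L : ℕ} {a b c c₁ δ ε s : ℝ} (ha : 0 ≤ a) (hb : 0 ≤ b) (hc : 0 < c)
    (hδ : 0 < δ) (hδ1 : δ < 1) (hε : 0 < ε) (hs : 0 < s)
    (hscale : ε / s ^ 4 = δ ^ (4 * m + 16) / c ^ 8) (hL : L * δ ^ 2 ≤ c₁) :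
    ε * (a * (L : ℝ) ^ (m + 2) / s) * (b * L / s) ^ 3 ≤ a * b ^ 3 * c₁ ^ (m + 5) / c ^ 8 * δ ∧
    (ε * (a * (L : ℝ) ^ (m + 2) / s) * (b * L / s)) ^ 2 / ε ≤
      a ^ 2 * b ^ 2 * c₁ ^ (2 * m + 6) / c ^ 8 * δ := by
  have hL0 : 0 ≤ L * δ ^ 2 := by positivity
  have hc₁ : 0 ≤ c₁ := hL0.trans hL
  constructor
  · calc ε * (a * (L : ℝ) ^ (m + 2) / s) * (b * L / s) ^ 3
        = a * b ^ 3 * (L : ℝ) ^ (m + 5) * (ε / s ^ 4) := by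
          rw [show (L : ℝ) ^ (m + 5) = (L : ℝ) ^ (m + 2) * (L : ℝ) ^ 3 by ring]
          field_simp
      _ = a * b ^ 3 / c ^ 8 * ((L * δ ^ 2) ^ (m + 5) * δ ^ (2 * m + 6)) := by
          rw [hscale, mul_pow, ← pow_mul, show 4 * m + 16 = 2 * (m + 5) + (2 * m + 6) by ring,
            pow_add]
          ring
      _ ≤ a * b ^ 3 / c ^ 8 * (c₁ ^ (m + 5) * δ) := by
          have := pow_le_of_le_one hδ.le hδ1.le (show 2 * m + 6 ≠ 0 by omega)
          gcongr
      _ = _ := by ring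
  · calc (ε * (a * (L : ℝ) ^ (m + 2) / s) * (b * L / s)) ^ 2 / ε
        = a ^ 2 * b ^ 2 * (L : ℝ) ^ (2 * m + 6) * (ε / s ^ 4) := by
          rw [show (L : ℝ) ^ (2 * m + 6) = ((L : ℝ) ^ (m + 2)) ^ 2 * (L : ℝ) ^ 2 by ring]
          field_simp
      _ = a ^ 2 * b ^ 2 / c ^ 8 * ((L * δ ^ 2) ^ (2 * m + 6) * δ ^ 4) := by
          rw [hscale, mul_pow, ← pow_mul, show 4 * m + 16 = 2 * (2 * m + 6) + 4 by ring, pow_add]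
          ring
      _ ≤ a ^ 2 * b ^ 2 / c ^ 8 * (c₁ ^ (2 * m + 6) * δ) := by
          have := pow_le_of_le_one hδ.le hδ1.le (show 4 ≠ 0 by norm_num)
          gcongr
      _ = _ := by ring

theorem sqrt_bound {a c₀ C₂ δ L : ℝ} (hδ : 0 < δ)
    (hc₀ : (2 * C₂ * a) ^ 2 < c₀) (hL : c₀ / δ ^ 2 ≤ L) : C₂ * (a / √L) ≤ δ / 2 := by
  have h1 : 2 * C₂ * a / δ ≤ √L := by
    refine Real.le_sqrt_of_sq_le (le_trans ?_ hL)
    rw [div_pow]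
    gcongr
  have hc0 : 0 < c₀ := (sq_nonneg _).trans_lt hc₀
  have hL0 : 0 < L := lt_of_lt_of_le (by positivity) hL
  have h2 : 0 < √L := Real.sqrt_pos.2 hL0
  rw [div_le_iff₀ hδ] at h1
  rw [← mul_div_assoc, div_le_iff₀ h2]
  linarith

theorem exists_scales (m : ℕ) {M B ρ C₁ C₂ : ℝ} (hM : 1 ≤ M) (hB : 0 ≤ B) (hρ : 0 < ρ)
    (hC₁ : 1 ≤ C₁) (hC₂ : 1 ≤ C₂) : ∃ c : ℝ, 1 ≤ c ∧ ∀ δ ε s : ℝ, 0 < δ → δ < 1 → 0 < ε →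
      0 < s → s ≤ 1 →
      s = c * δ ^ (-2 : ℤ) * (c * δ ^ (-1 - ((m + 1 : ℕ) : ℤ)) * ε ^ (1 / 4 : ℝ)) →
      ∃ L : ℕ, 1 ≤ L ∧ (m + 1) * (L : ℝ) ≤ c * δ ^ (-2 : ℤ) ∧
        ∀ A Λ : ℝ, A = C₁ * (2 * B) * (L : ℝ) ^ (m + 2) / s → Λ = (m + 1) * (L : ℝ) * M / s →
        1 ≤ Λ ∧ C₂ * (ε * A * Λ ^ 3) ≤ δ ∧ C₂ * (ε * A * Λ) ≤ √ε ∧ C₂ * (ε * A * Λ) ≤ ρ ∧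
        C₂ * (C₁ * (2 * B) / √L + B * (ε * A * Λ ^ 3) + M * ((ε * A * Λ) ^ 2 / ε)) ≤ δ := by
  obtain ⟨N, hN⟩ : ∃ N : ℝ, N = m + 1 := ⟨_, rfl⟩
  obtain ⟨a, ha⟩ : ∃ a : ℝ, a = C₁ * (2 * B) := ⟨_, rfl⟩
  obtain ⟨c₀, hc₀⟩ : ∃ c₀ : ℝ, c₀ = 1 + (2 * C₂ * a) ^ 2 := ⟨_, rfl⟩
  obtain ⟨D₁, hD₁⟩ : ∃ D : ℝ, D = a * (N * M) ^ 3 * (2 * c₀) ^ (m + 5) := ⟨_, rfl⟩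
  obtain ⟨D₂, hD₂⟩ : ∃ D : ℝ, D = a ^ 2 * (N * M) ^ 2 * (2 * c₀) ^ (2 * m + 6) := ⟨_, rfl⟩
  have hN1 : 1 ≤ N := by rw [hN]; linarith [(Nat.cast_nonneg m : (0 : ℝ) ≤ m)]
  have hN0 : 0 ≤ N := zero_le_one.trans hN1
  have hM0 : 0 ≤ M := zero_le_one.trans hM
  have hC₂0 : 0 ≤ C₂ := zero_le_one.trans hC₂
  have ha0 : 0 ≤ a := by rw [ha]; positivity
  have hb0 : 0 ≤ N * M := mul_nonneg hN0 hM0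
  have hc₀1 : 1 ≤ c₀ := by rw [hc₀]; linarith [sq_nonneg (2 * C₂ * a)]
  have hc₀0 : 0 ≤ c₀ := zero_le_one.trans hc₀1
  have hD₁0 : 0 ≤ D₁ := by rw [hD₁]; positivity
  have hD₂0 : 0 ≤ D₂ := by rw [hD₂]; positivity
  have t1 : 0 ≤ N * (2 * c₀) := by positivity
  have t2 : 0 ≤ C₂ * D₁ := by positivity
  have t3 : 0 ≤ C₂ * D₁ / ρ := by positivity
  have t4 : 0 ≤ 4 * (C₂ * B * D₁) := by positivity
  have t5 : 0 ≤ 4 * (C₂ * M * D₂) := by positivity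
  have t6 : 0 ≤ C₂ ^ 2 * D₂ := by positivity
  -- Each summand secures one of the inequalities below; as c ≤ c⁸, dividing by c⁸ is at least as
  -- good as dividing by c.
  obtain ⟨c, hc⟩ : ∃ c : ℝ, c = 1 + N * (2 * c₀) + C₂ * D₁ + C₂ * D₁ / ρ + 4 * (C₂ * B * D₁) +
    4 * (C₂ * M * D₂) + C₂ ^ 2 * D₂ := ⟨_, rfl⟩
  have hc1 : 1 ≤ c := by rw [hc]; linarith
  have hc0 : 0 < c := zero_lt_one.trans_le hc1
  have hc8 : c ≤ c ^ 8 := le_self_pow₀ hc1 (by norm_num)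
  have hc8p : 0 < c ^ 8 := by positivity
  refine ⟨c, hc1, ?_⟩
  intro δ ε s hδ hδ1 hε hs0 hs1 hsdef
  have hδ2 : 0 < δ ^ 2 := by positivity
  have hδ21 : δ ^ 2 ≤ 1 := pow_le_one₀ hδ.le hδ1.le
  have hscale : ε / s ^ 4 = δ ^ (4 * m + 16) / c ^ 8 := scale_relation hc0 hδ hε hsdef
  obtain ⟨L, hL⟩ : ∃ L : ℕ, L = ⌈c₀ / δ ^ 2⌉₊ := ⟨_, rfl⟩
  have hLge : c₀ / δ ^ 2 ≤ L := hL ▸ Nat.le_ceil _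
  have hLδ : L * δ ^ 2 ≤ 2 * c₀ := by
    have h1 : (L : ℝ) < c₀ / δ ^ 2 + 1 := hL ▸ Nat.ceil_lt_add_one (by positivity)
    have h2 : (L : ℝ) * δ ^ 2 ≤ (c₀ / δ ^ 2 + 1) * δ ^ 2 :=
      mul_le_mul_of_nonneg_right h1.le hδ2.le
    rw [add_mul, div_mul_cancel₀ _ hδ2.ne'] at h2
    linarith
  have hL1' : (1 : ℝ) ≤ L := by
    refine le_trans ?_ hLge
    rw [le_div_iff₀ hδ2]; linarith
  have hL0 : (0 : ℝ) < L := zero_lt_one.trans_le hL1'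
  refine ⟨L, by exact_mod_cast hL1', ?_, ?_⟩
  · rw [← hN, show c * δ ^ (-2 : ℤ) = c / δ ^ 2 by rw [zpow_neg, div_eq_mul_inv]; norm_cast,
      le_div_iff₀ hδ2, mul_assoc]
    refine (mul_le_mul_of_nonneg_left hLδ hN0).trans ?_
    rw [hc]; linarith
  intro A Λ hA hΛ
  rw [← ha] at hA ⊢
  rw [← hN, mul_right_comm] at hΛ
  obtain ⟨e1, e2⟩ := small_quantities ha0 hb0 hc0 hδ hδ1 hε hs0 hscale hLδ
  rw [← hA, ← hΛ, ← hD₁] at e1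
  rw [← hA, ← hΛ, ← hD₂] at e2
  have hΛ1 : 1 ≤ Λ := by
    rw [hΛ, le_div_iff₀ hs0, one_mul]
    exact hs1.trans (one_le_mul_of_one_le_of_one_le
      (one_le_mul_of_one_le_of_one_le hN1 hM) hL1')
  have hA0 : 0 ≤ A := by rw [hA]; positivity
  obtain ⟨P, hP⟩ : ∃ P : ℝ, P = ε * A * Λ ^ 3 := ⟨_, rfl⟩
  obtain ⟨Q, hQ⟩ : ∃ Q : ℝ, Q = ε * A * Λ := ⟨_, rfl⟩
  have hQ0 : 0 ≤ Q := by rw [hQ]; positivity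
  have hQP : Q ≤ P := by
    rw [hP, hQ]
    exact mul_le_mul_of_nonneg_left (le_self_pow₀ hΛ1 (by norm_num)) (by positivity)
  rw [← hP] at e1 ⊢
  rw [← hQ] at e2 ⊢
  have scaled : ∀ x D y : ℝ, 0 ≤ x → x * D ≤ c * y → 0 ≤ y → x * (D / c ^ 8 * δ) ≤ y * δ := by
    intro x D y hx hxy hy
    rw [← mul_assoc, ← mul_div_assoc]
    refine mul_le_mul_of_nonneg_right ?_ hδ.le
    rw [div_le_iff₀ hc8p]
    exact hxy.trans (by rw [mul_comm]; exact mul_le_mul_of_nonneg_left hc8 hy)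
  have f1 : C₂ * P ≤ 1 * δ := (mul_le_mul_of_nonneg_left e1 hC₂0).trans
    (scaled _ _ _ hC₂0 (by rw [hc]; linarith) zero_le_one)
  have f2 : C₂ * P ≤ ρ * δ := by
    refine (mul_le_mul_of_nonneg_left e1 hC₂0).trans (scaled _ _ _ hC₂0 ?_ hρ.le)
    rw [← div_le_iff₀ hρ, hc]; linarith
  have f3 : (C₂ * B) * P ≤ 1 / 4 * δ := (mul_le_mul_of_nonneg_left e1 (by positivity)).trans
    (scaled _ _ _ (by positivity) (by rw [hc]; linarith) (by norm_num))
  have f4 : (C₂ * M) * (Q ^ 2 / ε) ≤ 1 / 4 * δ :=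
    (mul_le_mul_of_nonneg_left e2 (by positivity)).trans
    (scaled _ _ _ (by positivity) (by rw [hc]; linarith) (by norm_num))
  -- The C⁰ bound √ε on the transformation comes from the quadratic quantity: (C₂Q)² ≤ δε ≤ ε.
  have f5 : C₂ ^ 2 * (Q ^ 2 / ε) ≤ 1 * δ := (mul_le_mul_of_nonneg_left e2 (by positivity)).trans
    (scaled _ _ _ (by positivity) (by rw [hc]; linarith) (by norm_num))
  have f6 : C₂ * (a / √L) ≤ δ / 2 :=
    sqrt_bound hδ (by rw [hc₀]; linarith) hLge
  have hQP' : C₂ * Q ≤ C₂ * P := mul_le_mul_of_nonneg_left hQP hC₂0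
  refine ⟨hΛ1, by linarith, ?_, ?_, ?_⟩
  · refine Real.le_sqrt_of_sq_le ?_
    rw [← mul_div_assoc, div_le_iff₀ hε, ← mul_pow] at f5
    refine f5.trans ?_
    rw [one_mul]
    exact mul_le_of_le_one_left hε.le hδ1.le
  · exact hQP'.trans (f2.trans (mul_le_of_le_one_right hρ.le hδ1.le))
  · linarith

/-! ### The normal form for Hamiltonians defined for all momenta. -/

theorem exists_coordChange_of_nonresonant (m : ℕ) {M B ρ : ℝ} (hM : 1 ≤ M) (hB : 0 ≤ B)
    (hρ : 0 < ρ) : ∃ c : ℝ, 1 ≤ c ∧ ∀ (H₀ : E m → ℝ) (H₁ : X m → ℝ) (δ K ε : ℝ),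
      DerivBound 4 H₀ M 1 → DerivBound 4 H₁ B 1 → PeriodicOn H₁ univ → 0 < δ → δ < 1 →
      c * δ ^ (-2 : ℤ) ≤ K → 0 < ε →
      (nonresonant H₀ K (c * δ ^ (-1 - ((m + 1 : ℕ) : ℤ)) * ε ^ (1 / 4 : ℝ))).Nonempty →
      ∃ (Φ : X m → X m) (f R : X m → ℝ),
        IsCoordChange Φ f (NearlyIntegrable.B m) (Metric.closedBall 0 (1 + ρ)) ∧
        (∀ y, ‖(Φ y - y, f y)‖ ≤ √ε) ∧
        DerivBound 2 (fun y => (Φ y - y, f y)) δ 1 ∧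
        DerivBound 2 R δ 1 ∧
        ∀ p ∈ nonresonant H₀ K (c * δ ^ (-1 - ((m + 1 : ℕ) : ℤ)) * ε ^ (1 / 4 : ℝ)),
          ∀ᶠ q in 𝓝 p, ∀ y : X m, y.2.1 = q →
            H₀ (Φ y).2.1 + ε * H₁ (Φ y) + f y =
              H₀ y.2.1 + ε * fastAverage H₁ y + ε * R y := by
  obtain ⟨C₁, hC₁, hhom⟩ := exists_homological_solution m
  obtain ⟨C₂, hC₂, hcoord⟩ := exists_coordChange_of_homological m
  obtain ⟨c, hc1, hscales⟩ := exists_scales m hM hB hρ hC₁ hC₂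
  have hc0 : 0 < c := zero_lt_one.trans_le hc1
  refine ⟨c, hc1, ?_⟩
  intro H₀ H₁ δ K ε hH₀ hH₁ hper hδ hδ1 hK hε hne
  generalize hσ : c * δ ^ (-1 - ((m + 1 : ℕ) : ℤ)) * ε ^ (1 / 4 : ℝ) = σ at *
  have hσ0 : 0 < σ := by rw [← hσ]; positivity
  generalize hK₀ : c * δ ^ (-2 : ℤ) = K₀ at *
  have hK₀1 : 1 ≤ K₀ := by
    rw [← hK₀, zpow_neg, ← div_eq_mul_inv]
    norm_cast
    rw [le_div_iff₀ (by positivity), one_mul]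
    exact (pow_le_one₀ hδ.le hδ1.le).trans hc1
  have hs0 : 0 < K₀ * σ := by positivity
  have hs1 : K₀ * σ ≤ 1 := by
    obtain ⟨p, hp⟩ := hne
    -- The frequency (0, 1) has divisor 1, so a single nonresonant point already forces 3Kσ ≤ 1.
    have h1 := hp.2.2 0 1 (by norm_num) (by norm_num; linarith)
    norm_num at h1
    have h2 : K₀ * σ ≤ K * σ := mul_le_mul_of_nonneg_right hK hσ0.le
    linarith
  obtain ⟨L, hL1, hLK, hsc⟩ := hscales δ ε (K₀ * σ) hδ hδ1 hε hs0 hs1 (by rw [hK₀, hσ])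
  rw [hK₀] at hLK
  have hZ := derivBound_fastAverage hH₁
  have hW : DerivBound 4 (fun x => H₁ x - fastAverage H₁ x) (2 * B) 1 := by
    simpa [two_mul] using hH₁.sub hZ
  have hdeck : ∀ x (u : X m), (∃ q : (Fin (m + 1) → ℤ) × ℤ, deck q.1 q.2 = u) →
      H₁ (x + u) = H₁ x := by
    rintro x _ ⟨q, rfl⟩
    exact hper x (by simp [cyl]) q.1 q.2
  obtain ⟨G, S, hG, hGθ, hGp, hWS, hGS⟩ := hhom M (2 * B) (K₀ * σ) L H₀
    (fun x => H₁ x - fastAverage H₁ x) hM hs0 hs1 hL1 hH₀ hW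
    (fun x _ k l => by
      simp only
      rw [fastAverage_translate fun x => hdeck x _ ⟨(k, l), rfl⟩, hdeck x _ ⟨(k, l), rfl⟩])
    (lineAverage_sub_fastAverage hH₁.1.continuous hZ.1.continuous
      (fun x => hdeck x _ (angleDir_mem_range_deck m _))
      (fun x => hdeck x _ (angleDir_mem_range_deck m _)))
  obtain ⟨hΛ1, s3, s1, sρ, sR⟩ := hsc _ _ rfl rfl
  obtain ⟨Φ, f, R, h1, h2, h3, h4, h5⟩ := hcoord M B _ _ ε _ ρ (Metric.closedBall 0 (1 + ρ)) H₀ H₁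
    (fastAverage H₁) G S hH₀ hH₁ hZ hG hGθ hGp hWS hΛ1 hε (s3.trans hδ1.le) sρ
    (fun p hp v hv => by
      rw [NearlyIntegrable.B, mem_closedBall_zero_iff] at hp
      rw [mem_closedBall_zero_iff]
      exact (norm_add_le _ _).trans (add_le_add hp hv))
  refine ⟨Φ, f, R, h1, fun y => (h2 y).trans s1, h3.mono_const s3 zero_le_one,
    h4.mono_const sR zero_le_one, fun p hp => ?_⟩
  filter_upwards [eventually_le_abs_divisor (hH₀.1.of_le (by norm_num)) hL1 hσ0 hLK hK hp]
    with q hq y hy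
  refine h5 y fun x hx => ?_
  exact hGS x fun k hk hne => by rw [hx, hy]; exact hq k hk hne

theorem average_congr {m : ℕ} {H H' : X m → ℝ} {p : E m} (h : ∀ x : X m, x.2.1 = p → H x = H' x)
    (θs : EuclideanSpace ℝ (Fin m)) : average H θs p = average H' θs p := by
  simp only [average]
  congr 1 with a
  congr 1 with t
  exact h _ rfl

/-- By periodicity the integrals over a period may start at the fast angle and time of x instead of
at 0. -/
theorem average_eq_fastAverage {m : ℕ} {H : X m → ℝ} (hH : PeriodicOn H univ) (x : X m) :
    average H (slow x.1) x.2.1 = fastAverage H x := by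
  have hdeck : ∀ j y, H (y + angleDir m j) = H y := by
    intro j y
    obtain ⟨q, hq⟩ := angleDir_mem_range_deck m j
    rw [← hq]
    exact hH y (by simp [cyl]) q.1 q.2
  have hint : ∀ (h : ℝ → ℝ), Function.Periodic h 1 → ∀ c : ℝ,
      ∫ a in (0 : ℝ)..1, h (c + a) = ∫ a in (0 : ℝ)..1, h a := by
    intro h hh c
    rw [intervalIntegral.integral_comp_add_left h c, add_zero,
      hh.intervalIntegral_add_eq c 0, zero_add]
  let F : ℝ → ℝ → ℝ := fun a t => H (join (slow x.1) a, x.2.1, t)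
  have hF1 : ∀ a t, F (a + 1) t = F a t := by
    intro a t
    refine Eq.trans ?_ (hdeck (Sum.inl (Fin.last m)) (join (slow x.1) a, x.2.1, t))
    simp only [F, angleDir, Prod.mk_add_mk, add_zero]
    congr 2
    ext i
    refine Fin.lastCases ?_ (fun i => ?_) i <;> simp [join, Fin.castSucc_ne_last]
  have hF2 : ∀ a t, F a (t + 1) = F a t := by
    intro a t
    refine Eq.trans ?_ (hdeck (Sum.inr ()) (join (slow x.1) a, x.2.1, t))
    simp [F, angleDir]
  have hFx : ∀ a t : ℝ, H (x + a • angleDir m (Sum.inl (Fin.last m)) +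
      t • angleDir m (Sum.inr ())) = F (x.1 (Fin.last m) + a) (x.2.2 + t) := by
    intro a t
    simp only [F]
    congr 1
    refine Prod.ext ?_ (Prod.ext ?_ ?_)
    · ext i
      refine Fin.lastCases ?_ (fun i => ?_) i <;>
        simp [join, slow, angleDir, Fin.castSucc_ne_last]
    · simp [angleDir]
    · simp [angleDir]
  simp only [fastAverage, hFx]
  simp only [hint _ (hF2 _)]
  rw [hint (fun a => ∫ t in (0 : ℝ)..1, F a t) fun a => by simp only [hF1]]
  rfl

/-! ### Globalization, and the remainder on all of the ball. -/

theorem isOpen_cyl {m : ℕ} {U : Set (E m)} (hU : IsOpen U) : IsOpen (cyl U) :=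
  isOpen_univ.prod (hU.prod isOpen_univ)

theorem mem_cyl {m : ℕ} {A : Set (E m)} {x : X m} : x ∈ cyl A ↔ x.2.1 ∈ A := by
  simp [cyl]

theorem deck_momentum {m : ℕ} (k : Fin (m + 1) → ℤ) (l : ℤ) : (deck (m := m) k l).2.1 = 0 := rfl

theorem IsCoordChange.mono_right {m : ℕ} {Φ : X m → X m} {f : X m → ℝ} {A U U' : Set (E m)}
    (h : IsCoordChange Φ f A U) (hU : U ⊆ U') : IsCoordChange Φ f A U' :=
  { h with mapsTo := fun _ hx => mem_cyl.2 (hU (mem_cyl.1 (h.mapsTo hx))) }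

theorem isCoordChange_id {m : ℕ} {U : Set (E m)} (hU : B m ⊆ U) :
    IsCoordChange (fun x : X m => x) (fun _ => 0) (B m) U where
  contDiffOn := contDiffOn_id
  contDiffOn_energy := contDiffOn_const
  mapsTo := fun _ hx => mem_cyl.2 (hU (mem_cyl.1 hx))
  injOn := injOn_id _
  periodic := fun x _ k l => by simp
  periodic_energy := fun x _ k l => rfl
  time := fun _ _ => rfl
  symplectic := fun z hz v w => by
    have h1 : extendMap (fun x : X m => x) (fun _ => 0) = id := by ext z <;> simp [extendMap]
    rw [h1, fderivWithin_id ((uniqueDiffOn_cyl_B m).prod uniqueDiffOn_univ z hz)]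
    rfl

/-- Functions over a neighbourhood of the unit ball can be replaced by globally defined ones. -/
theorem exists_globalization (m : ℕ) {U : Set (E m)} (hU : IsOpen U) (hBU : B m ⊆ U) :
    ∃ ρ C : ℝ, 0 < ρ ∧ 0 ≤ C ∧ Metric.closedBall 0 (1 + ρ) ⊆ U ∧
      (∀ (H₀ : E m → ℝ) (M : ℝ≥0), ContDiffOn ℝ 4 H₀ U → cNorm (dirE m) 4 U U H₀ ≤ M →
        ∃ H, DerivBound 4 H (C * M) 1 ∧ ∀ p ∈ Metric.closedBall 0 (1 + ρ), H p = H₀ p) ∧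
      (∀ (H₁ : X m → ℝ) (M : ℝ≥0), ContDiffOn ℝ 4 H₁ (cyl U) → PeriodicOn H₁ U →
        cNorm (dirX m) 4 (cyl U) (cyl U) H₁ ≤ M →
        ∃ H, DerivBound 4 H (C * M) 1 ∧ PeriodicOn H univ ∧
          ∀ x ∈ cyl (Metric.closedBall 0 (1 + ρ)), H x = H₁ x) := by
  obtain ⟨r, hr, hrU⟩ := (isCompact_closedBall (0 : E m) 1).exists_cthickening_subset_open hU hBU
  rw [cthickening_closedBall hr.le zero_le_one] at hrU
  -- The cutoff depends on p only, so periodicity survives. It equals 1 slightly beyond B, leaving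
  -- room for the image of Φ.
  let χ : ContDiffBump (0 : E m) := ⟨1 + r / 2, 1 + r, by linarith, by linarith⟩
  have hχ1 : ∀ p ∈ Metric.closedBall (0 : E m) (1 + r / 2), χ p = 1 :=
    fun p hp => χ.one_of_mem_closedBall hp
  have hχs : tsupport χ ⊆ U := by
    rw [χ.tsupport_eq]
    refine Subset.trans ?_ hrU
    rw [add_comm r 1]
  obtain ⟨Cχ, hCχ⟩ := exists_derivBound_of_hasCompactSupport (r := 4) (f := χ)
    χ.contDiff χ.hasCompactSupport
  have hCχ0 := hCχ.nonneg
  obtain ⟨n, hn⟩ : ∃ n : ℝ, n = (Fintype.card (Fin (m + 1)) : ℝ) ^ 4 := ⟨_, rfl⟩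
  obtain ⟨n', hn'⟩ : ∃ n : ℝ, n =
    (Fintype.card (Fin (m + 1) ⊕ Fin (m + 1) ⊕ Unit) : ℝ) ^ 4 := ⟨_, rfl⟩
  have hn0 : 0 ≤ n := by rw [hn]; positivity
  have hn0' : 0 ≤ n' := by rw [hn']; positivity
  refine ⟨r / 2, 2 ^ 4 * (Cχ * (n + n')), by linarith, by positivity, ?_, ?_, ?_⟩
  · refine Subset.trans (Metric.closedBall_subset_closedBall ?_) hrU
    linarith
  · intro H₀ M hH₀ hM
    refine ⟨fun p => χ p * H₀ p, ?_, fun p hp => by simp [hχ1 p hp]⟩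
    refine (derivBound_cutoff_mul (M := n * M) hU hCχ hχs hH₀ (by positivity)
      fun j hj x hx => ?_).mono_const ?_ zero_le_one
    · rw [hn]
      exact norm_iteratedFDerivWithin_le_of_cNorm_le (l := fun i v => v i)
        (fun i v => PiLp.norm_apply_le v i) sum_smul_single (by simp) hM hj hx
    · have : 0 ≤ 2 ^ 4 * (Cχ * (n' * M)) := by positivity
      linarith
  · intro H₁ M hH₁ hper hM
    refine ⟨fun x => χ (momentum m x) * H₁ x, ?_, ?_, fun x hx => ?_⟩
    · refine (derivBound_cutoff_mul (M := n' * M) (isOpen_cyl hU)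
        (hCχ.comp_clm (momentum m) (norm_momentum_le m)) ?_ hH₁ (by positivity)
        fun j hj x hx => ?_).mono_const ?_ zero_le_one
      · intro x hx
        exact mem_cyl.2 (hχs (tsupport_comp_subset_preimage χ (momentum m).continuous hx))
      · rw [hn']
        exact norm_iteratedFDerivWithin_le_of_cNorm_le (l := coordX m)
          (abs_coordX_le m) (sum_coordX m) Fintype.card_pos hM hj hx
      · have : 0 ≤ 2 ^ 4 * (Cχ * (n * M)) := by positivity
        linarith
    · intro x _ k l
      have h1 : momentum m (x + deck k l) = momentum m x := by simp [deck_momentum]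
      simp only [h1]
      by_cases hx : x.2.1 ∈ U
      · rw [hper x (mem_cyl.2 hx)]
      · have h2 : χ (momentum m x) = 0 := by
          by_contra h
          exact hx (hχs (subset_tsupport _ h))
        rw [h2, zero_mul, zero_mul]
    · have h1 : χ (momentum m x) = 1 := hχ1 _ (mem_cyl.1 hx)
      simp only [h1, one_mul]

theorem nonresonant_congr {m : ℕ} {H H' : E m → ℝ} (h : ∀ p ∈ B m, H =ᶠ[𝓝 p] H') (K s : ℝ) :
    nonresonant H K s = nonresonant H' K s := by
  have hg : ∀ p ∈ B m, ∇ H p = ∇ H' p := fun p hp => by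
    rw [gradient, gradient, (h p hp).fderiv_eq]
  ext p
  simp only [nonresonant, Set.mem_ofPred_eq]
  refine and_congr_right fun hp => ?_
  rw [hg p hp]

theorem exists_coordChange (m : ℕ) {M B ρ : ℝ} (hM : 1 ≤ M) (hB : 0 ≤ B)
    (hρ : 0 < ρ) : ∃ c : ℝ, 1 ≤ c ∧ ∀ (H₀ : E m → ℝ) (H₁ : X m → ℝ) (δ K ε : ℝ),
      DerivBound 4 H₀ M 1 → DerivBound 4 H₁ B 1 → PeriodicOn H₁ univ → 0 < δ → δ < 1 →
      c * δ ^ (-2 : ℤ) ≤ K → 0 < ε →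
      ∃ (Φ : X m → X m) (f R : X m → ℝ),
        IsCoordChange Φ f (NearlyIntegrable.B m) (Metric.closedBall 0 (1 + ρ)) ∧
        (∀ y, ‖(Φ y - y, f y)‖ ≤ √ε) ∧
        DerivBound 2 (fun y => (Φ y - y, f y)) δ 1 ∧
        ContDiff ℝ 2 R ∧ PeriodicOn R (NearlyIntegrable.B m) ∧
        (∀ y, H₀ (Φ y).2.1 + ε * H₁ (Φ y) + f y =
              H₀ y.2.1 + ε * fastAverage H₁ y + ε * R y) ∧
        cNorm (dirX m) 2 (cyl (NearlyIntegrable.B m)) (cyl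
          (nonresonant H₀ K (c * δ ^ (-1 - ((m + 1 : ℕ) : ℤ)) * ε ^ (1 / 4 : ℝ)))) R
          ≤ ENNReal.ofReal δ := by
  obtain ⟨c, hc, h⟩ := exists_coordChange_of_nonresonant m hM hB hρ
  refine ⟨c, hc, fun H₀ H₁ δ K ε hH₀ hH₁ hper hδ hδ1 hK hε => ?_⟩
  specialize h H₀ H₁ δ K ε hH₀ hH₁ hper hδ hδ1 hK hε
  have hDB : ∀ s, nonresonant H₀ K s ⊆ NearlyIntegrable.B m := fun s p hp => hp.1
  specialize hDB (c * δ ^ (-1 - ((m + 1 : ℕ) : ℤ)) * ε ^ (1 / 4 : ℝ))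
  generalize nonresonant H₀ K (c * δ ^ (-1 - ((m + 1 : ℕ) : ℤ)) * ε ^ (1 / 4 : ℝ)) = D at *
  have h' : ∃ (Φ : X m → X m) (f R : X m → ℝ),
      IsCoordChange Φ f (NearlyIntegrable.B m) (Metric.closedBall 0 (1 + ρ)) ∧
      (∀ y, ‖(Φ y - y, f y)‖ ≤ √ε) ∧ DerivBound 2 (fun y => (Φ y - y, f y)) δ 1 ∧
      DerivBound 2 R δ 1 ∧ ∀ p ∈ D, ∀ᶠ q in 𝓝 p, ∀ y : X m, y.2.1 = q →
        H₀ (Φ y).2.1 + ε * H₁ (Φ y) + f y =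
          H₀ y.2.1 + ε * fastAverage H₁ y + ε * R y := by
    -- With an empty nonresonant set there is nothing to estimate, and the identity serves.
    rcases D.eq_empty_or_nonempty with hD | hD
    · refine ⟨fun x => x, fun _ => 0, fun _ => 0, isCoordChange_id
        (Metric.closedBall_subset_closedBall (by linarith)), fun y => ?_, ?_, ?_, ?_⟩
      · simp
      · simp only [sub_self]
        exact DerivBound.zero (r := 2) (V := X m) (F := X m × ℝ) hδ.le zero_le_one
      · exact DerivBound.zero hδ.le zero_le_one
      · simp [hD]
    · exact h hD
  obtain ⟨Φ, f, R₁, h1, h2, h3, h4, h5⟩ := h'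
  have hf : ContDiff ℝ 2 f := h3.1.snd
  have hΦ : ContDiff ℝ 2 Φ := by
    have := h3.1.fst.add contDiff_id
    simpa using this
  have hZ := derivBound_fastAverage hH₁
  have hH₀' : ContDiff ℝ 2 H₀ := hH₀.1.of_le (by norm_num)
  have hH₁' : ContDiff ℝ 2 H₁ := hH₁.1.of_le (by norm_num)
  have hZ' : ContDiff ℝ 2 (fastAverage H₁) := hZ.1.of_le (by norm_num)
  have hmul : ∀ x, ε * (ε⁻¹ * x) = x := fun x => mul_inv_cancel_left₀ hε.ne' x
  have hR : ∀ y, H₀ (Φ y).2.1 + ε * H₁ (Φ y) + f y = H₀ y.2.1 + ε * fastAverage H₁ y +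
      ε * (ε⁻¹ * (H₀ (Φ y).2.1 + ε * H₁ (Φ y) + f y - (H₀ y.2.1 + ε * fastAverage H₁ y))) := by
    intro y
    rw [hmul]
    ring
  -- The final remainder is defined by the conjugacy equation itself, so that equation holds
  -- everywhere. Near 𝒟 it coincides with the estimated `R₁`, whose bounds therefore apply there.
  refine ⟨Φ, f, fun y => ε⁻¹ * (H₀ (Φ y).2.1 + ε * H₁ (Φ y) + f y -
    (H₀ y.2.1 + ε * fastAverage H₁ y)), h1, h2, h3, ?_, ?_, hR, ?_⟩
  · have e1 : ContDiff ℝ 2 fun y => H₀ (Φ y).2.1 := hH₀'.comp hΦ.snd.fst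
    have e2 : ContDiff ℝ 2 fun y => H₁ (Φ y) := hH₁'.comp hΦ
    have e3 : ContDiff ℝ 2 fun y : X m => H₀ y.2.1 := hH₀'.comp contDiff_snd.fst
    exact contDiff_const.mul (((e1.add (contDiff_const.mul e2)).add hf).sub
      (e3.add (contDiff_const.mul hZ')))
  · intro x hx k l
    have e1 : Φ (x + deck k l) = Φ x + deck k l := by
      have := h1.periodic x hx k l
      simp only at this
      rw [← sub_eq_zero] at this ⊢
      rw [← this]
      abel
    have e2 : ∀ y : X m, (y + deck k l).2.1 = y.2.1 := fun y => by simp [deck_momentum]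
    have e3 : ∀ y : X m, H₁ (y + deck k l) = H₁ y := fun y => hper y (by simp [cyl]) k l
    simp only [e1, e2, e3, fastAverage_translate e3, h1.periodic_energy x hx k l]
  · refine cNorm_le_of_derivBound (norm_dirX_le m) (uniqueDiffOn_cyl_B m) ?_ h4 fun x hx => ?_
    · exact fun x hx => mem_cyl.2 (hDB (mem_cyl.1 hx))
    · have hcont : Tendsto (fun y : X m => y.2.1) (𝓝 x) (𝓝 x.2.1) :=
        (continuous_fst.comp continuous_snd).tendsto x
      refine mem_nhdsWithin_of_mem_nhds ?_
      filter_upwards [hcont.eventually (h5 _ (mem_cyl.1 hx))] with y hy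
      have := (hR y).symm.trans (hy y rfl)
      exact mul_left_cancel₀ hε.ne' (add_left_cancel this)

end

end NearlyIntegrable

/-! ### The theorem over U. -/

open NearlyIntegrable in
theorem mainTheorem3 (m : ℕ) (hm : 2 ≤ m + 1) (U : Set (E m)) (hU : IsOpen U) (hBU : B m ⊆ U)
    (M : ℝ≥0) :
    ∃ c : ℝ, 0 < c ∧
      ∀ H₀ : E m → ℝ, ContDiffOn ℝ 4 H₀ U → cNorm (dirE m) 4 U U H₀ ≤ M →
      ∀ δ : ℝ, 0 < δ → δ < 1 →
      ∀ H₁ : X m → ℝ, ContDiffOn ℝ 4 H₁ (cyl U) → PeriodicOn H₁ U →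
        cNorm (dirX m) 4 (cyl U) (cyl U) H₁ ≤ 1 →
      ∀ K ε : ℝ, c * δ ^ (-2 : ℤ) ≤ K → 0 < ε → ε ≤ δ ^ (6 * (m + 1) + 5) / c →
      ∃ (Φ : X m → X m) (f : X m → ℝ) (R : X m → ℝ),
        IsCoordChange Φ f (B m) U ∧
        cNorm (dirX m) 0 (cyl (B m)) (cyl (B m)) (fun x => (Φ x - x, f x))
          ≤ ENNReal.ofReal (Real.sqrt ε) ∧
        cNorm (dirX m) 2 (cyl (B m)) (cyl (B m)) (fun x => (Φ x - x, f x))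
          ≤ ENNReal.ofReal δ ∧
        TakesForm (fun x => H₀ x.2.1 + ε * H₁ x) Φ f (B m)
          (fun x => H₀ x.2.1 + ε * average H₁ (slow x.1) x.2.1 + ε * R x) ∧
        ContDiffOn ℝ 2 R (cyl (B m)) ∧ PeriodicOn R (B m) ∧
        cNorm (dirX m) 2 (cyl (B m))
          (cyl (nonresonant H₀ K (c * δ ^ (-1 - ((m + 1 : ℕ) : ℤ)) * ε ^ (1 / 4 : ℝ)))) R
          ≤ ENNReal.ofReal δ := by
  obtain ⟨ρ, C, hρ, hC, hρU, hglob₀, hglob₁⟩ := exists_globalization m hU hBU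
  obtain ⟨c, hc, h⟩ := exists_coordChange m (le_max_left 1 (C * M)) hC hρ
  refine ⟨c, zero_lt_one.trans_le hc, ?_⟩
  intro H₀ hH₀ hM δ hδ hδ1 H₁ hH₁ hper hH₁1 K ε hK hε _
  obtain ⟨G₀, hG₀, hGH₀⟩ := hglob₀ H₀ M hH₀ hM
  obtain ⟨G₁, hG₁, hG₁per, hGH₁⟩ := hglob₁ H₁ 1 hH₁ hper (by simpa using hH₁1)
  obtain ⟨Φ, f, R, h1, h2, h3, h4, h5, h6, h7⟩ := h G₀ G₁ δ K ε
    (hG₀.mono_const (le_max_right _ _) zero_le_one) (by simpa using hG₁) hG₁per hδ hδ1 hK hε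
  have hBρ : B m ⊆ Metric.closedBall 0 (1 + ρ) :=
    Metric.closedBall_subset_closedBall (by linarith)
  have hres : nonresonant H₀ K (c * δ ^ (-1 - ((m + 1 : ℕ) : ℤ)) * ε ^ (1 / 4 : ℝ)) =
      nonresonant G₀ K (c * δ ^ (-1 - ((m + 1 : ℕ) : ℤ)) * ε ^ (1 / 4 : ℝ)) := by
    -- The extension agrees with H₀ on a neighbourhood of each point of the closed ball, so the
    -- gradients, and hence the nonresonant sets, are the same.
    refine nonresonant_congr (fun p hp => ?_) _ _
    have hp' : Metric.closedBall (0 : E m) (1 + ρ) ∈ nhds p :=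
      Filter.mem_of_superset (Metric.isOpen_ball.mem_nhds (show p ∈ Metric.ball 0 (1 + ρ) from by
        rw [B, mem_closedBall_zero_iff] at hp
        rw [mem_ball_zero_iff]
        linarith)) Metric.ball_subset_closedBall
    filter_upwards [hp'] with q hq
    exact (hGH₀ q hq).symm
  refine ⟨Φ, f, R, h1.mono_right hρU, ?_, ?_, ?_, h4.contDiffOn, h5, ?_⟩
  · exact cNorm_le_of_derivBound (norm_dirX_le m) (uniqueDiffOn_cyl_B m) subset_rfl
      (DerivBound.of_norm_le h3.1.continuous h2) fun x _ => Filter.EventuallyEq.rfl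
  · exact cNorm_le_of_derivBound (norm_dirX_le m) (uniqueDiffOn_cyl_B m) subset_rfl
      h3 fun x _ => Filter.EventuallyEq.rfl
  · intro x hx e
    have hxB := mem_cyl.1 hx
    have hΦx := h1.mapsTo hx
    have havg : average H₁ (slow x.1) x.2.1 = fastAverage G₁ x := by
      rw [← average_eq_fastAverage hG₁per]
      exact average_congr (fun y hy => (hGH₁ y (mem_cyl.2 (hy ▸ hBρ hxB))).symm) _
    have key := h6 x
    rw [hGH₀ _ (mem_cyl.1 hΦx), hGH₀ _ (hBρ hxB), hGH₁ _ hΦx, ← havg] at key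
    simp only [extendMap]
    linarith
  · rw [hres]
    exact h7
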